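/- **One-step languages.** A one-step model over a finite set $A$ of monadic predicates is a pair $(D,V)$ with $D$ a (possibly empty) set and $V:A\to\wp(D)$. A one-step language $L_1$ assigns to each finite set $A$ (up to renaming, $A=\{a_0,\dots,a_{n-1}\}$) a set $L_1(A)$ of one-step formulas, with a truth relation $(D,V)\models\alpha$, a set of predicates occurring in each formula, on which alone its truth depends, and renaming of predicates $\alpha\mapsto\alpha[f]$ for $f:A\to A'$, such that $(D,V)\models\alpha[f]$ iff $(D,V\circ f)\models\alpha$ and only predicates $f(a)$ with $a$ occurring in $\alpha$ occur in $\alpha[f]$. For $B\subseteq A$ write $V\le_B V'$ if $V(b)\subseteq V'(b)$ for $b\in B$ and $V(a)=V'(a)$ for $a\notin B$. A formula $\alpha$ is monotone in $B$ if its truth is preserved from $V$ to every $V'\ge_B V$; it is $B$-continuous if it is monotone in $B$ and whenever $(D,V)\models\alpha$ there is $V'\le_B V$ with $(D,V')\models\alpha$ and $V'(b)$ finite for all $b\in B$; $B$-cocontinuity is the dual property (monotone in $B$, and whenever $(D,V)\not\models\alpha$ there is $V'\ge_B V$ with $(D,V')\not\models\alpha$ and $D\setminus V'(b)$ finite for all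 $b\in B$). We assume that fragments $L_1^+(A)$, $\mathrm{Con}_B(L_1(A))$, $\mathrm{Cocon}_B(L_1(A))$ of $L_1(A)$ have been isolated, consisting of formulas that are, respectively, monotone in $A$, $B$-continuous and $B$-cocontinuous, such that: formulas of $L_1^+(A)$ without predicates from $B$ are in both $\mathrm{Con}_B$ and $\mathrm{Cocon}_B$; $L_1^+$ is closed under renaming; and if $\alpha\in\mathrm{Con}_B(L_1(A))$ and $f:A\to A'$, $B'\subseteq A'$ satisfy $f^{-1}(B')\subseteq B$, then $\alpha[f]\in\mathrm{Con}_{B'}(L_1(A'))$, and likewise for $\mathrm{Cocon}$. (For instance, the fragments of all formulas that are monotone, resp. monotone and $B$-continuous, resp. monotone and $B$-cocontinuous.) $L_1$ is *closed under conjunctions and disjunctions* if there are operations $\top,\bot,\wedge,\vee$ on one-step formulas with the usual semantics that introduce no new predicates and under which the fragments are closed. **The calculus.** Proposition letters are natural numbers, and $P$ is a finite set of them. A $P$-transition system is $\mathbb S=(T,R,\kappa,s_I)$ with $R\subseteq T^2$, $\kappa:T\to\wp(P)$, $s_I\in T$. Formulas of $\mu L_1$ are given by $$\varphi::=q\mid\neg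 q\mid\varphi\vee\varphi\mid\varphi\wedge\varphi\mid\bigcirc_\alpha(\varphi_1,\dots,\varphi_n)\mid\mu p.\varphi'\mid\nu p.\varphi',$$ with $\alpha(a_1,\dots,a_n)\in L_1^+$ and with no free occurrence of $\neg p$ in $\varphi'$. The semantics is standard, and $\bigcirc_\alpha(\varphi_1,\dots,\varphi_n)$ holds at $s$ iff $(R[s],V)\models\alpha$, where $V(a_i)$ is the set of $t\in R[s]$ at which $\varphi_i$ holds. $\mu L_1(P)$ is the set of formulas whose free variables are in $P$. A formula is $Q$-free if none of its free variables is in $Q$. The formulas noetherian in $Q$ are $\varphi::=q\mid\psi\mid\varphi\vee\varphi\mid\varphi\wedge\varphi\mid\bigcirc_\alpha(\varphi_1,\dots,\varphi_n)\mid\mu p.\varphi'$ with $q\in Q$, $\psi$ $Q$-free, $\alpha\in L_1^+$ and $\varphi'$ noetherian in $Q\cup\{p\}$. The formulas continuous in $Q$ are defined in the same way, but with the modal clause restricted to $\bigcirc_\alpha(\varphi_1,\dots,\varphi_k,\psi_1,\dots,\psi_m)$ where the $\varphi_i$ are continuous in $Q$, the $\psi_j$ are $Q$-free and $\alpha(\bar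 a,\bar b)\in\mathrm{Con}_{\bar a}$. The co-noetherian and co-continuous formulas are defined dually, with $\nu$ for $\mu$ and $\mathrm{Cocon}$ for $\mathrm{Con}$. The fragment $\mu_DL_1$ (resp. $\mu_CL_1$) consists of the formulas of $\mu L_1$ in which, for every subformula $\mu p.\varphi$, $\varphi$ is noetherian (resp. continuous) in $\{p\}$ and, for every subformula $\nu p.\varphi$, $\varphi$ is co-noetherian (resp. co-continuous) in $\{p\}$. **Automata.** An $L_1$-automaton over $P$ is $\mathbb A=(A,\Delta,\Omega,a_I)$ with $A$ a finite set, $a_I\in A$, $\Delta:A\times\wp(P)\to L_1^+(A)$ and $\Omega:A\to\mathbb N$. It accepts $\mathbb S$ if $\exists$ has a winning strategy from $(a_I,s_I)$ in the following parity game (an infinite match is won by $\exists$ iff the maximal priority met infinitely often is even; a player who gets stuck loses): at $(a,s)\in A\times T$, of priority $\Omega(a)$, $\exists$ chooses $V:A\to\wp(R[s])$ with $(R[s],V)\models\Delta(a,\kappa(s))$; at $V$, of priority $0$, $\forall$ chooses $(b,t)$ with $t\in V(b)$. Let $\prec$ be the transitive closure of $\{(a,b)\mid b\text{ occurs in }\Delta(a,c)\text{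 for some }c\}$. The clusters are the classes of the equivalence relation generated by $\prec\cap\succ$. $\mathbb A$ is *weak* if $\Omega$ takes values in $\{0,1\}$ and is constant on each cluster. It is *continuous-weak* if it is weak and, for every cluster $M$, $a\in M$ and $c\in\wp(P)$, $\Omega(a)=1$ implies $\Delta(a,c)\in\mathrm{Con}_M(L_1(A))$ and $\Omega(a)=0$ implies $\Delta(a,c)\in\mathrm{Cocon}_M(L_1(A))$. **Theorem.** Let $L_1$ be a one-step language that is closed under conjunctions and disjunctions, and let $P$ be a finite set of proposition letters. There is an effective procedure that, given a formula $\xi\in\mu L_1(P)$, returns an $L_1$-automaton $\mathbb A_\xi$ over $P$ such that 1. $\mathbb A_\xi$ is equivalent to $\xi$: it accepts a $P$-transition system $\mathbb S$ iff $\xi$ is true at the initial point $s_I$ of $\mathbb S$; 2. $\mathbb A_\xi$ is weak if $\xi\in\mu_DL_1$; 3. $\mathbb A_\xi$ is continuous-weak if $\xi\in\mu_CL_1$. Here "effective" means that, for every coding of one-step formulas by natural numbers (injective on each $L_1(\{a_0,\dots,a_{n-1}\})$) for which the operations $\top,\bot,\wedge,\vee$ and renaming are computable, the map from $\xi$ (as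 a word) to $\mathbb A_\xi$ (as a finite table) is computable. -/

import Mathlib

universe u w

/-! ## One-step languages -/

/-- A one-step language.  `Form n` is the set of one-step formulas over the monadic predicates
`a_0, …, a_{n-1}` (every finite set of predicates is of this shape up to renaming), `sat V α` is
truth of `α` in the one-step model `(D, V)` (the domain `D` may be empty), `occ α` is the set of
predicates that occur in `α`, and `rename f α` is `α` with every predicate `a_i` replaced by
`a_{f i}`; for `α` over `n` predicates it is the formula written `α(a_{f 0}, …, a_{f (n-1)})`. -/
structure OneStepLanguage where
  Form : ℕ → Type w
  sat : ∀ {n : ℕ} {D : Type u}, (Fin n → Set D) → Form n → Prop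
  occ : ∀ {n : ℕ}, Form n → Set (Fin n)
  rename : ∀ {n m : ℕ}, (Fin n → Fin m) → Form n → Form m
  sat_congr : ∀ {n : ℕ} {D : Type u} (V V' : Fin n → Set D) (α : Form n),
    (∀ a ∈ occ α, V a = V' a) → (sat V α ↔ sat V' α)
  sat_rename : ∀ {n m : ℕ} {D : Type u} (f : Fin n → Fin m) (V : Fin m → Set D) (α : Form n),
    sat V (rename f α) ↔ sat (fun i => V (f i)) α
  occ_rename : ∀ {n m : ℕ} (f : Fin n → Fin m) (α : Form n), occ (rename f α) ⊆ f '' occ α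

/-- `V ≤_B V'`: the valuation `V'` is a `B`-extension of `V`. -/
def ExtendsOn {n : ℕ} {D : Type u} (B : Set (Fin n)) (V V' : Fin n → Set D) : Prop :=
  (∀ b ∈ B, V b ⊆ V' b) ∧ ∀ a ∉ B, V a = V' a

namespace OneStepLanguage

variable (L : OneStepLanguage.{u, w})

def MonotoneIn {n : ℕ} (B : Set (Fin n)) (α : L.Form n) : Prop :=
  ∀ (D : Type u) (V V' : Fin n → Set D), ExtendsOn B V V' → L.sat V α → L.sat V' α

def ContinuousIn {n : ℕ} (B : Set (Fin n)) (α : L.Form n) : Prop :=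
  L.MonotoneIn B α ∧ ∀ (D : Type u) (V : Fin n → Set D), L.sat V α →
    ∃ V' : Fin n → Set D, ExtendsOn B V' V ∧ L.sat V' α ∧ ∀ b ∈ B, (V' b).Finite

/-- Cocontinuity, spelled out so that it makes sense even if the language has no boolean duals;
`cocontinuousIn_iff_of_isDual` says that it is continuity of the boolean dual if there is one. -/
def CocontinuousIn {n : ℕ} (B : Set (Fin n)) (α : L.Form n) : Prop :=
  L.MonotoneIn B α ∧ ∀ (D : Type u) (V : Fin n → Set D), ¬ L.sat V α →
    ∃ V' : Fin n → Set D, ExtendsOn B V V' ∧ ¬ L.sat V' α ∧ ∀ b ∈ B, (V' b)ᶜ.Finite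

/-- `β` is a boolean dual of `α`. -/
def IsDual {n : ℕ} (α β : L.Form n) : Prop :=
  ∀ (D : Type u) (V : Fin n → Set D), L.sat V α ↔ ¬ L.sat (fun a => (V a)ᶜ) β

theorem _root_.ExtendsOn.compl {n : ℕ} {D : Type u} {B : Set (Fin n)} {V V' : Fin n → Set D}
    (h : ExtendsOn B V V') : ExtendsOn B (fun a => (V' a)ᶜ) (fun a => (V a)ᶜ) :=
  ⟨fun b hb => Set.compl_subset_compl.2 (h.1 b hb), fun a ha => by simp [h.2 a ha]⟩

theorem cocontinuousIn_iff_of_isDual {n : ℕ} (B : Set (Fin n)) (α β : L.Form n)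
    (h : L.IsDual α β) : L.CocontinuousIn B α ↔ L.ContinuousIn B β := by
  have h' : ∀ (D : Type u) (V : Fin n → Set D), L.sat V β ↔ ¬ L.sat (fun a => (V a)ᶜ) α := by
    intro D V
    have := h D (fun a => (V a)ᶜ)
    simp only [compl_compl] at this
    tauto
  constructor
  · rintro ⟨hm, hc⟩
    refine ⟨fun D V V' hV hs => ?_, fun D V hs => ?_⟩
    · rw [h'] at hs ⊢
      exact fun hn => hs (hm D _ _ hV.compl hn)
    · obtain ⟨U, hU, hUs, hUf⟩ := hc D _ ((h' D V).1 hs)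
      refine ⟨fun a => (U a)ᶜ, ?_, ?_, hUf⟩
      · simpa using hU.compl
      · rw [h']
        simpa using hUs
  · rintro ⟨hm, hc⟩
    refine ⟨fun D V V' hV hs => ?_, fun D V hs => ?_⟩
    · rw [h] at hs ⊢
      exact fun hn => hs (hm D _ _ hV.compl hn)
    · rw [h, not_not] at hs
      obtain ⟨U, hU, hUs, hUf⟩ := hc D _ hs
      refine ⟨fun a => (U a)ᶜ, ?_, ?_, ?_⟩
      · simpa using hU.compl
      · rw [h, not_not]
        simpa using hUs
      · simpa using hUf

/-- Isolated fragments of a one-step language: `pos` is `L₁⁺`, consisting of monotone formulas,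
`cont B` and `cocont B` consist of `B`-continuous and of `B`-cocontinuous formulas.  As for
fragments given by a grammar, positive formulas without predicates from `B` are in `cont B` and
`cocont B`, and the fragments respect renaming of predicates, where a predicate may become one
of `B'` only if it was one of `B`.  (The sets of all monotone, of all monotone `B`-continuous and of
all monotone `B`-cocontinuous formulas are an example.) -/
structure Fragments where
  pos : ∀ {n : ℕ}, Set (L.Form n)
  cont : ∀ {n : ℕ}, Set (Fin n) → Set (L.Form n)
  cocont : ∀ {n : ℕ}, Set (Fin n) → Set (L.Form n)
  pos_sound : ∀ {n : ℕ} (α : L.Form n), α ∈ pos → L.MonotoneIn Set.univ α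
  cont_sound : ∀ {n : ℕ} (B : Set (Fin n)) (α : L.Form n), α ∈ cont B → L.ContinuousIn B α
  cocont_sound : ∀ {n : ℕ} (B : Set (Fin n)) (α : L.Form n), α ∈ cocont B → L.CocontinuousIn B α
  cont_of_disjoint : ∀ {n : ℕ} (B : Set (Fin n)) (α : L.Form n),
    α ∈ pos → Disjoint (L.occ α) B → α ∈ cont B
  cocont_of_disjoint : ∀ {n : ℕ} (B : Set (Fin n)) (α : L.Form n),
    α ∈ pos → Disjoint (L.occ α) B → α ∈ cocont B
  pos_rename : ∀ {n m : ℕ} (f : Fin n → Fin m) (α : L.Form n), α ∈ pos → L.rename f α ∈ pos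
  cont_rename : ∀ {n m : ℕ} (f : Fin n → Fin m) (B : Set (Fin n)) (B' : Set (Fin m))
    (α : L.Form n), f ⁻¹' B' ⊆ B → α ∈ cont B → L.rename f α ∈ cont B'
  cocont_rename : ∀ {n m : ℕ} (f : Fin n → Fin m) (B : Set (Fin n)) (B' : Set (Fin m))
    (α : L.Form n), f ⁻¹' B' ⊆ B → α ∈ cocont B → L.rename f α ∈ cocont B'

/-- Closure of a one-step language and of its fragments under finite (possibly empty)
conjunctions and disjunctions. -/
structure Closed (F : L.Fragments) where
  top : ∀ n : ℕ, L.Form n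
  bot : ∀ n : ℕ, L.Form n
  conj : ∀ {n : ℕ}, L.Form n → L.Form n → L.Form n
  disj : ∀ {n : ℕ}, L.Form n → L.Form n → L.Form n
  sat_top : ∀ {n : ℕ} {D : Type u} (V : Fin n → Set D), L.sat V (top n)
  sat_bot : ∀ {n : ℕ} {D : Type u} (V : Fin n → Set D), ¬ L.sat V (bot n)
  sat_conj : ∀ {n : ℕ} {D : Type u} (V : Fin n → Set D) (α β : L.Form n),
    L.sat V (conj α β) ↔ L.sat V α ∧ L.sat V β
  sat_disj : ∀ {n : ℕ} {D : Type u} (V : Fin n → Set D) (α β : L.Form n),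
    L.sat V (disj α β) ↔ L.sat V α ∨ L.sat V β
  occ_top : ∀ n : ℕ, L.occ (top n) = ∅
  occ_bot : ∀ n : ℕ, L.occ (bot n) = ∅
  occ_conj : ∀ {n : ℕ} (α β : L.Form n), L.occ (conj α β) ⊆ L.occ α ∪ L.occ β
  occ_disj : ∀ {n : ℕ} (α β : L.Form n), L.occ (disj α β) ⊆ L.occ α ∪ L.occ β
  pos_top : ∀ n : ℕ, top n ∈ F.pos
  pos_bot : ∀ n : ℕ, bot n ∈ F.pos
  pos_conj : ∀ {n : ℕ} (α β : L.Form n), α ∈ F.pos → β ∈ F.pos → conj α β ∈ F.pos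
  pos_disj : ∀ {n : ℕ} (α β : L.Form n), α ∈ F.pos → β ∈ F.pos → disj α β ∈ F.pos
  cont_conj : ∀ {n : ℕ} (B : Set (Fin n)) (α β : L.Form n),
    α ∈ F.cont B → β ∈ F.cont B → conj α β ∈ F.cont B
  cont_disj : ∀ {n : ℕ} (B : Set (Fin n)) (α β : L.Form n),
    α ∈ F.cont B → β ∈ F.cont B → disj α β ∈ F.cont B
  cocont_conj : ∀ {n : ℕ} (B : Set (Fin n)) (α β : L.Form n),
    α ∈ F.cocont B → β ∈ F.cocont B → conj α β ∈ F.cocont B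
  cocont_disj : ∀ {n : ℕ} (B : Set (Fin n)) (α β : L.Form n),
    α ∈ F.cocont B → β ∈ F.cocont B → disj α β ∈ F.cocont B

variable {L}

/-- A coding of the one-step formulas as natural numbers for which the syntactic operations
(finite conjunctions and disjunctions, renaming) are computable. -/
structure Closed.Coding {F : L.Fragments} (C : L.Closed F) where
  code : ∀ {n : ℕ}, L.Form n → ℕ
  code_injective : ∀ n : ℕ, Function.Injective (code (n := n))
  computable_top : Computable fun n : ℕ => code (C.top n)
  computable_bot : Computable fun n : ℕ => code (C.bot n)
  computable_conj : ∃ g : ℕ × ℕ × ℕ → ℕ, Computable g ∧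
    ∀ (n : ℕ) (α β : L.Form n), g (n, code α, code β) = code (C.conj α β)
  computable_disj : ∃ g : ℕ × ℕ × ℕ → ℕ, Computable g ∧
    ∀ (n : ℕ) (α β : L.Form n), g (n, code α, code β) = code (C.disj α β)
  computable_rename : ∃ g : ℕ × ℕ × List ℕ × ℕ → ℕ, Computable g ∧
    ∀ (n m : ℕ) (f : Fin n → Fin m) (α : L.Form n),
      g (n, m, List.ofFn (fun i => (f i : ℕ)), code α) = code (L.rename f α)

end OneStepLanguage

/-! ## Transition systems -/

/-- `P`-labelled transition systems, for a finite set `P` of proposition letters; the proposition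
letters are the natural numbers. -/
structure LTS (P : Finset ℕ) where
  T : Type u
  R : T → T → Prop
  colour : T → P.powerset
  init : T

/-- The set `R[s]` of successors of `s`, as a type: the domain of one-step models. -/
abbrev LTS.Succ {P : Finset ℕ} (S : LTS.{u} P) (s : S.T) : Type u := {t : S.T // S.R s t}

/-! ## The μ-calculus over a one-step language -/

/-- Raw formulas; `nxt α φ` is the modality of the one-step formula `α(a_0, …, a_{n-1})`
applied to `φ 0, …, φ (n-1)`. -/
inductive MuForm (L : OneStepLanguage.{u, w}) : Type w
  | atom (q : ℕ) : MuForm L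
  | natom (q : ℕ) : MuForm L
  | or (φ ψ : MuForm L) : MuForm L
  | and (φ ψ : MuForm L) : MuForm L
  | nxt {n : ℕ} (α : L.Form n) (φ : Fin n → MuForm L) : MuForm L
  | mu (p : ℕ) (φ : MuForm L) : MuForm L
  | nu (p : ℕ) (φ : MuForm L) : MuForm L

namespace MuForm

variable {L : OneStepLanguage.{u, w}}

/-- Free variables. -/
def fv : MuForm L → Set ℕ
  | atom q => {q}
  | natom q => {q}
  | or φ ψ => fv φ ∪ fv ψ
  | and φ ψ => fv φ ∪ fv ψ
  | nxt _ φ => ⋃ i, fv (φ i)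
  | mu p φ => fv φ \ {p}
  | nu p φ => fv φ \ {p}

/-- `p` has no free negated occurrence. -/
def PositiveIn (p : ℕ) : MuForm L → Prop
  | atom _ => True
  | natom q => q ≠ p
  | or φ ψ => PositiveIn p φ ∧ PositiveIn p ψ
  | and φ ψ => PositiveIn p φ ∧ PositiveIn p ψ
  | nxt _ φ => ∀ i, PositiveIn p (φ i)
  | mu q φ => q = p ∨ PositiveIn p φ
  | nu q φ => q = p ∨ PositiveIn p φ

/-- Membership in `μL₁`: modalities come from `L₁⁺`, fixpoint variables are positive. -/
def IsMuL (F : L.Fragments) : MuForm L → Prop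
  | atom _ => True
  | natom _ => True
  | or φ ψ => IsMuL F φ ∧ IsMuL F ψ
  | and φ ψ => IsMuL F φ ∧ IsMuL F ψ
  | nxt α φ => α ∈ F.pos ∧ ∀ i, IsMuL F (φ i)
  | mu p φ => φ.PositiveIn p ∧ IsMuL F φ
  | nu p φ => φ.PositiveIn p ∧ IsMuL F φ

def FreeOf (Q : Set ℕ) (φ : MuForm L) : Prop := Disjoint φ.fv Q

/-- Formulas that are syntactically noetherian in `Q`. -/
inductive Noe : Set ℕ → MuForm L → Prop
  | var {Q : Set ℕ} {q : ℕ} : q ∈ Q → Noe Q (atom q)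
  | free {Q : Set ℕ} {ψ : MuForm L} : FreeOf Q ψ → Noe Q ψ
  | or {Q : Set ℕ} {φ ψ : MuForm L} : Noe Q φ → Noe Q ψ → Noe Q (or φ ψ)
  | and {Q : Set ℕ} {φ ψ : MuForm L} : Noe Q φ → Noe Q ψ → Noe Q (and φ ψ)
  | nxt {Q : Set ℕ} {n : ℕ} {α : L.Form n} {φ : Fin n → MuForm L} :
      (∀ i, Noe Q (φ i)) → Noe Q (nxt α φ)
  | mu {Q : Set ℕ} {p : ℕ} {φ : MuForm L} : Noe (Q ∪ {p}) φ → Noe Q (mu p φ)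

/-- Formulas that are syntactically co-noetherian in `Q`. -/
inductive CoNoe : Set ℕ → MuForm L → Prop
  | var {Q : Set ℕ} {q : ℕ} : q ∈ Q → CoNoe Q (atom q)
  | free {Q : Set ℕ} {ψ : MuForm L} : FreeOf Q ψ → CoNoe Q ψ
  | or {Q : Set ℕ} {φ ψ : MuForm L} : CoNoe Q φ → CoNoe Q ψ → CoNoe Q (or φ ψ)
  | and {Q : Set ℕ} {φ ψ : MuForm L} : CoNoe Q φ → CoNoe Q ψ → CoNoe Q (and φ ψ)
  | nxt {Q : Set ℕ} {n : ℕ} {α : L.Form n} {φ : Fin n → MuForm L} :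
      (∀ i, CoNoe Q (φ i)) → CoNoe Q (nxt α φ)
  | nu {Q : Set ℕ} {p : ℕ} {φ : MuForm L} : CoNoe (Q ∪ {p}) φ → CoNoe Q (nu p φ)

/-- Formulas that are syntactically continuous in `Q`.  In the clause for modalities, `B` is the
set of argument places in which the variables from `Q` may occur. -/
inductive Cont (F : L.Fragments) : Set ℕ → MuForm L → Prop
  | var {Q : Set ℕ} {q : ℕ} : q ∈ Q → Cont F Q (atom q)
  | free {Q : Set ℕ} {ψ : MuForm L} : FreeOf Q ψ → Cont F Q ψ
  | or {Q : Set ℕ} {φ ψ : MuForm L} : Cont F Q φ → Cont F Q ψ → Cont F Q (or φ ψ)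
  | and {Q : Set ℕ} {φ ψ : MuForm L} : Cont F Q φ → Cont F Q ψ → Cont F Q (and φ ψ)
  | nxt {Q : Set ℕ} {n : ℕ} {α : L.Form n} {φ : Fin n → MuForm L} (B : Set (Fin n)) :
      α ∈ F.cont B → (∀ i ∈ B, Cont F Q (φ i)) → (∀ i ∉ B, FreeOf Q (φ i)) → Cont F Q (nxt α φ)
  | mu {Q : Set ℕ} {p : ℕ} {φ : MuForm L} : Cont F (Q ∪ {p}) φ → Cont F Q (mu p φ)

/-- Formulas that are syntactically co-continuous in `Q`. -/
inductive CoCont (F : L.Fragments) : Set ℕ → MuForm L → Prop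
  | var {Q : Set ℕ} {q : ℕ} : q ∈ Q → CoCont F Q (atom q)
  | free {Q : Set ℕ} {ψ : MuForm L} : FreeOf Q ψ → CoCont F Q ψ
  | or {Q : Set ℕ} {φ ψ : MuForm L} : CoCont F Q φ → CoCont F Q ψ → CoCont F Q (or φ ψ)
  | and {Q : Set ℕ} {φ ψ : MuForm L} : CoCont F Q φ → CoCont F Q ψ → CoCont F Q (and φ ψ)
  | nxt {Q : Set ℕ} {n : ℕ} {α : L.Form n} {φ : Fin n → MuForm L} (B : Set (Fin n)) :
      α ∈ F.cocont B → (∀ i ∈ B, CoCont F Q (φ i)) → (∀ i ∉ B, FreeOf Q (φ i)) →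
        CoCont F Q (nxt α φ)
  | nu {Q : Set ℕ} {p : ℕ} {φ : MuForm L} : CoCont F (Q ∪ {p}) φ → CoCont F Q (nu p φ)

/-- The restrictions on fixpoints that, within `μL₁`, define the alternation-free fragment
`μ_D L₁`. -/
def IsMuD : MuForm L → Prop
  | atom _ => True
  | natom _ => True
  | or φ ψ => IsMuD φ ∧ IsMuD ψ
  | and φ ψ => IsMuD φ ∧ IsMuD ψ
  | nxt _ φ => ∀ i, IsMuD (φ i)
  | mu p φ => IsMuD φ ∧ Noe {p} φ
  | nu p φ => IsMuD φ ∧ CoNoe {p} φ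

/-- The restrictions on fixpoints that, within `μL₁`, define the continuous fragment
`μ_C L₁`. -/
def IsMuC (F : L.Fragments) : MuForm L → Prop
  | atom _ => True
  | natom _ => True
  | or φ ψ => IsMuC F φ ∧ IsMuC F ψ
  | and φ ψ => IsMuC F φ ∧ IsMuC F ψ
  | nxt _ φ => ∀ i, IsMuC F (φ i)
  | mu p φ => IsMuC F φ ∧ Cont F {p} φ
  | nu p φ => IsMuC F φ ∧ CoCont F {p} φ

/-- The meaning of a formula in a frame `(T, R)` with valuation `ρ`. -/
def ext {T : Type u} (R : T → T → Prop) : (ℕ → Set T) → MuForm L → Set T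
  | ρ, atom q => ρ q
  | ρ, natom q => (ρ q)ᶜ
  | ρ, or φ ψ => ext R ρ φ ∪ ext R ρ ψ
  | ρ, and φ ψ => ext R ρ φ ∩ ext R ρ ψ
  | ρ, nxt α φ =>
      {s | L.sat (D := {t : T // R s t}) (fun i => {t | t.1 ∈ ext R ρ (φ i)}) α}
  | ρ, mu p φ => ⋂₀ {X | ext R (Function.update ρ p X) φ ⊆ X}
  | ρ, nu p φ => ⋃₀ {X | X ⊆ ext R (Function.update ρ p X) φ}

/-- Truth of a formula in a transition system. -/
def Holds {P : Finset ℕ} (S : LTS.{u} P) (ξ : MuForm L) : Prop :=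
  S.init ∈ ξ.ext S.R (fun q => {s | q ∈ (S.colour s).1})

/-- A formula as a word, in prefix notation. -/
def toWord {F : L.Fragments} {C : L.Closed F} (E : C.Coding) : MuForm L → List (ℕ × ℕ)
  | atom q => [(0, q)]
  | natom q => [(1, q)]
  | or φ ψ => (2, 0) :: (toWord E φ ++ toWord E ψ)
  | and φ ψ => (3, 0) :: (toWord E φ ++ toWord E ψ)
  | nxt (n := n) α φ => (4, Nat.pair n (E.code α)) :: (List.ofFn fun i => toWord E (φ i)).flatten
  | mu p φ => (5, p) :: toWord E φ
  | nu p φ => (6, p) :: toWord E φ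

end MuForm

/-- The set `μL₁(P)` of formulas of `μL₁` with free variables in `P`. -/
def MuL {L : OneStepLanguage.{u, w}} (F : L.Fragments) (P : Finset ℕ) : Type w :=
  {ξ : MuForm L // ξ.IsMuL F ∧ ξ.fv ⊆ P}

/-! ## Games -/

/-- Board games between Éloise and Abelard; the positions outside `eloise` are Abelard's. -/
structure BoardGame where
  Pos : Type u
  eloise : Set Pos
  E : Pos → Pos → Prop
  Win : Set (ℕ → Pos)

namespace BoardGame

variable (G : BoardGame.{u})

/-- `π` is a finite match from `x` that is guided by the strategy `f` of Éloise; a strategy gives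
the next position from the list of all positions so far. -/
def IsFiniteMatch (f : List G.Pos → G.Pos) (x : G.Pos) (π : List G.Pos) : Prop :=
  π.head? = some x ∧ ∀ (i : ℕ) (h : i + 1 < π.length),
    G.E π[i] π[i + 1] ∧ (π[i] ∈ G.eloise → π[i + 1] = f (π.take (i + 1)))

/-- Infinite matches from `x` that are guided by the strategy `f` of Éloise. -/
def IsInfiniteMatch (f : List G.Pos → G.Pos) (x : G.Pos) (π : ℕ → G.Pos) : Prop :=
  π 0 = x ∧ ∀ i : ℕ,
    G.E (π i) (π (i + 1)) ∧ (π i ∈ G.eloise → π (i + 1) = f ((List.range (i + 1)).map π))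

/-- `f` is a winning strategy for Éloise from `x`: it always provides a legitimate move (so that
Éloise never gets stuck, and every finite total match is lost by Abelard), and all infinite
matches that it guides are won by Éloise. -/
def IsWinningStrategy (f : List G.Pos → G.Pos) (x : G.Pos) : Prop :=
  (∀ (π : List G.Pos) (y : G.Pos), G.IsFiniteMatch f x π → π.getLast? = some y →
    y ∈ G.eloise → G.E y (f π)) ∧
  ∀ π : ℕ → G.Pos, G.IsInfiniteMatch f x π → π ∈ G.Win

def EloiseWins (x : G.Pos) : Prop := ∃ f : List G.Pos → G.Pos, G.IsWinningStrategy f x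

end BoardGame

/-- The parity condition: the maximal priority that is reached infinitely often is even. -/
def parityWin {X : Type u} (prio : X → ℕ) : Set (ℕ → X) :=
  {π | ∃ m : ℕ, Even m ∧ (∃ᶠ i in Filter.atTop, prio (π i) = m) ∧
    ∀ k : ℕ, (∃ᶠ i in Filter.atTop, prio (π i) = k) → k ≤ m}

/-! ## Automata -/

/-- Parity automata over `P` based on `L₁`.  The states are numbered `0, …, size - 1`. -/
structure ParityAutomaton {L : OneStepLanguage.{u, w}} (F : L.Fragments) (P : Finset ℕ) where
  size : ℕ
  trans : Fin size → P.powerset → L.Form size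
  trans_pos : ∀ a c, trans a c ∈ F.pos
  prio : Fin size → ℕ
  init : Fin size

namespace ParityAutomaton

variable {L : OneStepLanguage.{u, w}} {F : L.Fragments} {P : Finset ℕ}

/-- The acceptance game.  At a position `(a, s)` Éloise chooses a valuation `V : A → ℘(R[s])`
with `(R[s], V) ⊨ Δ(a, κ(s))`; at a position `V` Abelard chooses `(b, t)` with `t ∈ V(b)`. -/
def acceptanceGame (A : ParityAutomaton F P) (S : LTS.{u} P) : BoardGame.{u} where
  Pos := (Fin A.size × S.T) ⊕ (Fin A.size → Set S.T)
  eloise := Set.range Sum.inl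
  E x y := match x, y with
    | .inl (a, s), .inr V => (∀ b, ∀ t ∈ V b, S.R s t) ∧
        L.sat (D := S.Succ s) (fun b => {t | t.1 ∈ V b}) (A.trans a (S.colour s))
    | .inr V, .inl (b, t) => t ∈ V b
    | _, _ => False
  Win := parityWin (Sum.elim (fun x => A.prio x.1) (fun _ => 0))

def Accepts (A : ParityAutomaton F P) (S : LTS.{u} P) : Prop :=
  (A.acceptanceGame S).EloiseWins (Sum.inl (A.init, S.init))

/-- `A.Active a b`: the state `b` is active in `a`, that is, `a ≺ b`. -/
def Active (A : ParityAutomaton F P) : Fin A.size → Fin A.size → Prop :=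
  Relation.TransGen fun a b => ∃ c, b ∈ L.occ (A.trans a c)

/-- The cluster of a state. -/
def cluster (A : ParityAutomaton F P) (a : Fin A.size) : Set (Fin A.size) :=
  {b | Relation.EqvGen (fun x y => A.Active x y ∧ A.Active y x) a b}

/-- Weak automata, with the usual convention that their priorities are `0` and `1`. -/
def IsWeak (A : ParityAutomaton F P) : Prop :=
  (∀ a, A.prio a ≤ 1) ∧ ∀ a, ∀ b ∈ A.cluster a, A.prio a = A.prio b

/-- The continuity condition. -/
def IsContinuous (A : ParityAutomaton F P) : Prop :=
  ∀ a c, (A.prio a = 1 → A.trans a c ∈ F.cont (A.cluster a)) ∧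
    (A.prio a = 0 → A.trans a c ∈ F.cocont (A.cluster a))

def IsWeakContinuous (A : ParityAutomaton F P) : Prop := A.IsWeak ∧ A.IsContinuous

/-- The colour that consists of the letters `q ∈ P` for which the `q`-th binary digit of `m`
is `1`. -/
def colourOf (P : Finset ℕ) (m : ℕ) : P.powerset :=
  ⟨P.filter fun q => m.testBit q = true, Finset.mem_powerset.2 (Finset.filter_subset _ _)⟩

/-- An automaton as a finite object: the number of states, the initial state, and for each state
its priority and the table of the codes of its transition formulas (all colours are among the
`colourOf P m` with `m < 2 ^ (1 + max P)`). -/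
def toTable {C : L.Closed F} (E : C.Coding) (A : ParityAutomaton F P) :
    ℕ × ℕ × List (ℕ × List ℕ) :=
  (A.size, A.init, List.ofFn fun a : Fin A.size =>
    (A.prio a, (List.range (2 ^ P.sup Nat.succ)).map fun m => E.code (A.trans a (colourOf P m))))

end ParityAutomaton

/-- A translation from formulas to automata is effective if it is computable (as a function from
words to tables) for every coding of the one-step formulas for which the syntactic operations of
the one-step language are computable. -/
def EffectiveTranslation {L : OneStepLanguage.{u, w}} {F : L.Fragments} (C : L.Closed F)
    {P : Finset ℕ} (tr : MuL F P → ParityAutomaton F P) : Prop :=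
  ∀ E : C.Coding, ∃ f : List (ℕ × ℕ) → ℕ × ℕ × List (ℕ × List ℕ), Computable f ∧
    ∀ ξ : MuL F P, f (ξ.1.toWord E) = (tr ξ).toTable E

/-!
The automaton of a formula `ξ` is built by structural recursion on `ξ`; the formula need not be
guarded. Every subformula is turned into a *block*, an automaton in which its free variables
occur as literals.

**Construction** (`MuForm.block`). A block has a list of states, each with a *transition term*,
that is, a positive boolean combination of literals and modal atoms `α(x₁, …, xₙ)`, and a
transition term for the formula itself, its *head*. Boolean connectives act on the heads; a
modality turns the heads of its arguments into states and refers to them. To bind `p` by `μ` or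
`ν`, replace `p` in the head by `⊥` or `⊤` (an unguarded occurrence of `p` contributes nothing
else), and in the states by the new head. The references in the latter copies are *tagged* with a
number that is odd for `μ`, even for `ν`, and larger than all earlier tags: passing such a
reference means unfolding the fixpoint. In the final automaton a state carries the tag of the
reference through which it was reached, and `Block.toAutomaton` uses the tags as priorities.

**Equivalence** (`MuForm.accepts_iff`). Whether a formula holds at a point is witnessed by a
*progress measure*: every state has a set of points at which it is supposed to be satisfied and,
at each of them, an ordinal signature whose component at the tag of a least fixpoint is a stage of
the approximation of that fixpoint. Following a reference with tag `m` does not increase the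
components from `m` on, and decreases them lexicographically if `m` is the tag of a least fixpoint
(`IsProgress`). So the maximal tag that occurs infinitely often on a path belongs to a greatest
fixpoint, and Éloise wins (`Block.accepts_of_isProgress`). If the formula fails, the same
construction for the dual fixpoints gives Abelard a progress measure with which he beats every
strategy of Éloise (`Block.not_accepts_of_isProgress`). Both cases are treated at once by a
polarity `pol`; `MuForm.realizes_block` constructs the progress measures by recursion.

**Clusters.** With each state the construction records the variables it depends on and its
*class*, the kinds of fixpoints unfolded in its cluster. Binding `p` merges the states that
depend on `p`. A labelling of the states (`MuForm.exists_labelled`) shows that states in a common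
cluster have the same class. If the class contains only `μ` or only `ν`, the priority may be
taken to be constantly `1` or `0` (`statePrio`, `path_parity`). For `μ_D L₁` this applies to all
states, since a formula noetherian in `p` yields a block in which the states that depend on `p`
unfold no `ν` (`FixRestr.blockRestr`), and the automaton is weak. For `μ_C L₁`, in addition,
modal atoms are continuous in those arguments that stay in the cluster, and this passes to the
transition formulas.

**Effectiveness.** The construction uses only shifting, retagging and substitution on transition
terms. It is therefore carried out in the same way on codes of terms in prefix notation
(`MuForm.foldr_parseStep`), where it is primitive recursive; the final evaluation of terms to
one-step formulas uses the given computable operations on their codes (`computable_blockTable`).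
-/

section

/-! ### Transition terms -/

/-- Transition terms: the right-hand sides of the transition table while the automaton is under
construction.  They are positive boolean combinations of literals (`lit true q` is `q`, `lit false q`
is `¬q`), of constants (`cst true` is `⊤`, `cst false` is `⊥`) and of modal atoms `mod α f`;
`bin true` is disjunction and `bin false` is conjunction.  In a modal atom, `f i = (b, m)` refers to
the state with number `b`; the *tag* `m` is the priority of the fixpoint operator that has been
unfolded on the way there, and `0` if there is none. -/
inductive TransTerm (L : OneStepLanguage.{u, w}) : Type w
  | lit (b : Bool) (q : ℕ) : TransTerm L
  | cst (b : Bool) : TransTerm L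
  | bin (isOr : Bool) (s t : TransTerm L) : TransTerm L
  | mod {n : ℕ} (α : L.Form n) (f : Fin n → ℕ × ℕ) : TransTerm L

namespace TransTerm

variable {L : OneStepLanguage.{u, w}}

/-- The literals that occur in a term. -/
def lits : TransTerm L → Set (Bool × ℕ)
  | lit b q => {(b, q)}
  | cst _ => ∅
  | bin _ s t => lits s ∪ lits t
  | mod _ _ => ∅

/-- All modal atoms of a term satisfy `Q`. -/
def AllMod (Q : ∀ n : ℕ, L.Form n → (Fin n → ℕ × ℕ) → Prop) : TransTerm L → Prop
  | lit _ _ => True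
  | cst _ => True
  | bin _ s t => AllMod Q s ∧ AllMod Q t
  | mod α f => Q _ α f

def mapRef (g : ℕ × ℕ → ℕ × ℕ) : TransTerm L → TransTerm L
  | lit b q => lit b q
  | cst b => cst b
  | bin b s t => bin b (mapRef g s) (mapRef g t)
  | mod α f => mod α fun i => g (f i)

def shift (k : ℕ) : TransTerm L → TransTerm L := mapRef fun x => (x.1 + k, x.2)

def retag (m : ℕ) : TransTerm L → TransTerm L := mapRef fun x => (x.1, m)

/-- `t.subst p v` replaces the literal `p` by `v` in `t`; the literal `¬p` is left alone. -/
def subst (p : ℕ) : TransTerm L → TransTerm L → TransTerm L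
  | lit b q, v => if (b, q) = (true, p) then v else lit b q
  | cst b, _ => cst b
  | bin b s t, v => bin b (subst p s v) (subst p t v)
  | mod α f, _ => mod α f

variable {Q Q' : ∀ n : ℕ, L.Form n → (Fin n → ℕ × ℕ) → Prop}

theorem AllMod.imp (h : ∀ n α f, Q n α f → Q' n α f) {t : TransTerm L} (ht : t.AllMod Q) :
    t.AllMod Q' := by
  induction t with
  | lit | cst => trivial
  | bin b s t hs ht' => exact ⟨hs ht.1, ht' ht.2⟩
  | mod α f => exact h _ _ _ ht

theorem AllMod.and {t : TransTerm L} (h : t.AllMod Q) (h' : t.AllMod Q') :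
    t.AllMod fun n α f => Q n α f ∧ Q' n α f := by
  induction t with
  | lit | cst => trivial
  | bin b s t hs ht => exact ⟨hs h.1 h'.1, ht h.2 h'.2⟩
  | mod α f => exact ⟨h, h'⟩

theorem allMod_cst (b : Bool) : ∀ Q, (cst b : TransTerm L).AllMod Q := fun _ => trivial

theorem allMod_mapRef (g : ℕ × ℕ → ℕ × ℕ) (t : TransTerm L) :
    (t.mapRef g).AllMod Q ↔ t.AllMod fun n α f => Q n α fun i => g (f i) := by
  induction t with
  | lit | cst => exact Iff.rfl
  | bin b s t hs ht => exact and_congr hs ht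
  | mod α f => exact Iff.rfl

theorem AllMod.subst {p : ℕ} {v t : TransTerm L} (ht : t.AllMod Q)
    (hv : (true, p) ∈ t.lits → v.AllMod Q) : (t.subst p v).AllMod Q := by
  induction t with
  | lit b q =>
    unfold TransTerm.subst
    split_ifs with h
    · exact hv (by simp [lits, h])
    · trivial
  | cst => trivial
  | bin b s t hs ht' =>
    exact ⟨hs ht.1 fun h => hv (Or.inl h), ht' ht.2 fun h => hv (Or.inr h)⟩
  | mod α f => exact ht

theorem lits_mapRef (g : ℕ × ℕ → ℕ × ℕ) (t : TransTerm L) : (t.mapRef g).lits = t.lits := by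
  induction t with
  | lit | cst | mod => rfl
  | bin b s t hs ht => simp [mapRef, lits, hs, ht]

theorem mem_lits_subst {p : ℕ} {v t : TransTerm L} {x : Bool × ℕ} (h : x ∈ (t.subst p v).lits) :
    (x ∈ t.lits ∧ x ≠ (true, p)) ∨ ((true, p) ∈ t.lits ∧ x ∈ v.lits) := by
  induction t with
  | lit b q =>
    unfold subst at h
    split_ifs at h with h'
    · exact Or.inr ⟨by simp [lits, h'], h⟩
    · obtain rfl : x = (b, q) := by simpa [lits] using h
      exact Or.inl ⟨rfl, h'⟩
  | cst => exact h.elim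
  | bin b s t hs ht =>
    rcases h with h | h
    · rcases hs h with h | h
      · exact Or.inl ⟨Or.inl h.1, h.2⟩
      · exact Or.inr ⟨Or.inl h.1, h.2⟩
    · rcases ht h with h | h
      · exact Or.inl ⟨Or.inr h.1, h.2⟩
      · exact Or.inr ⟨Or.inr h.1, h.2⟩
  | mod => exact h.elim

theorem lits_shift (k : ℕ) (t : TransTerm L) : (t.shift k).lits = t.lits := lits_mapRef _ t

theorem lits_retag (k : ℕ) (t : TransTerm L) : (t.retag k).lits = t.lits := lits_mapRef _ t

end TransTerm

/-! ### Blocks: automata under construction -/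

/-- A state under construction.  `dep` lists the variables on which the state depends (those that
are free at the state or become so by unfolding fixpoints), `cls` lists the kinds (`true` for `μ`,
`false` for `ν`) of the fixpoint operators whose unfoldings belong to its cluster.  The type `τ` of
transition terms is a parameter, since the construction is carried out both on terms and on
their codes. -/
structure State (τ : Type*) where
  term : τ
  dep : List ℕ
  cls : List Bool

/-- The automaton of a formula under construction: `head` describes the first step from the
formula itself, `fv` lists the free variables of the formula, `tail` lists the states, and `height`
bounds the nesting depth of modalities and fixpoint operators. -/
structure Block (τ : Type*) where
  head : τ
  fv : List ℕ
  tail : List (State τ)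
  height : ℕ

/-- The operations on transition terms that are used in the construction. -/
structure TermOps (τ : Type*) where
  shift : ℕ → τ → τ
  retag : ℕ → τ → τ
  subst : ℕ → τ → τ → τ

def State.mapTerm {τ σ : Type*} (g : τ → σ) (s : State τ) : State σ := ⟨g s.term, s.dep, s.cls⟩

/-- The tag, and priority, of a `μ` (`mu = true`) or `ν` (`mu = false`) that binds a formula of
height `h`: it is odd for `μ`, even for `ν`, and larger than all tags inside the formula. -/
def fixTag (mu : Bool) (h : ℕ) : ℕ := 2 * h + bif mu then 1 else 2

namespace Block

variable {τ : Type*} (o : TermOps τ)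

def shiftStates (k : ℕ) (S : List (State τ)) : List (State τ) := S.map (State.mapTerm (o.shift k))

/-- The states of a block, the head being turned into a state with number `0`. -/
def states (b : Block τ) : List (State τ) :=
  ⟨o.shift 1 b.head, b.fv, []⟩ :: shiftStates o 1 b.tail

/-- The disjoint union of the states of a list of blocks, with the numbers of the heads. -/
def cat : List (Block τ) → List (State τ) × List ℕ
  | [] => ([], [])
  | b :: bs => (b.states o ++ shiftStates o (b.tail.length + 1) (cat bs).1,
      0 :: (cat bs).2.map fun k => k + (b.tail.length + 1))

/-- The block of a boolean combination, `f` being the connective on terms. -/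
def bin (f : τ → τ → τ) (b c : Block τ) : Block τ :=
  ⟨f b.head (o.shift b.tail.length c.head), b.fv ++ c.fv,
    b.tail ++ shiftStates o b.tail.length c.tail, max b.height c.height⟩

/-- The block of a modality; `mk` makes a modal atom from the numbers of the argument states. -/
def next (mk : List ℕ → τ) (bs : List (Block τ)) : Block τ :=
  ⟨mk (cat o bs).2, bs.flatMap Block.fv, (cat o bs).1, (bs.map Block.height).foldr max 0 + 1⟩

/-- The block of a fixpoint formula that binds `p`.  In the head, the occurrences of `p` are
unguarded, and they are replaced by the constant `c` (`⊥` for `μ`, `⊤` for `ν`).  In the states, `p` is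
replaced by the new head, tagged with the priority of the fixpoint operator.  The states that
depend on `p` now belong to a common cluster. -/
def fix (mu : Bool) (c : τ) (p : ℕ) (b : Block τ) : Block τ :=
  let t := o.subst p b.head c
  let fv := b.fv.filter fun q => q ≠ p
  let cls := mu :: (b.tail.filter fun s => p ∈ s.dep).flatMap State.cls
  ⟨t, fv, b.tail.map fun s =>
    if p ∈ s.dep then
      ⟨o.subst p s.term (o.retag (fixTag mu b.height) t), (s.dep.filter fun q => q ≠ p) ++ fv, cls⟩
    else s, b.height + 1⟩

end Block

variable {L : OneStepLanguage.{u, w}}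

def TransTerm.ops (L : OneStepLanguage.{u, w}) : TermOps (TransTerm L) :=
  ⟨TransTerm.shift, TransTerm.retag, TransTerm.subst⟩

/-- The block of a formula. -/
def MuForm.block : MuForm L → Block (TransTerm L)
  | atom q => ⟨.lit true q, [q], [], 0⟩
  | natom q => ⟨.lit false q, [q], [], 0⟩
  | or φ ψ => .bin (TransTerm.ops L) (.bin true) φ.block ψ.block
  | and φ ψ => .bin (TransTerm.ops L) (.bin false) φ.block ψ.block
  | nxt α φ => .next (TransTerm.ops L) (fun os => .mod α fun i => (os.getD i 0, 0))
      (List.ofFn fun i => (φ i).block)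
  | mu p φ => .fix (TransTerm.ops L) true (.cst false) p φ.block
  | nu p φ => .fix (TransTerm.ops L) false (.cst true) p φ.block

/-! ### Well-formedness of blocks -/

/-- Conditions on a reference `x = (b, m)` from the state `s` with number `j`: untagged references
go to larger numbers, tags are accounted for in the class of the state, and the state referred to
depends on fewer variables. -/
def RefOK (h : ℕ) (S : List (State (TransTerm L))) (j : ℕ) (s : State (TransTerm L))
    (x : ℕ × ℕ) : Prop :=
  x.2 ≤ 2 * h ∧ (x.2 = 0 → j < x.1) ∧ (x.2 ≠ 0 → x.2.bodd ∈ s.cls) ∧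
    ∃ s', S[x.1]? = some s' ∧ s'.dep ⊆ s.dep

structure StatesWF (F : L.Fragments) (h : ℕ) (S : List (State (TransTerm L))) : Prop where
  mods : ∀ (j : ℕ) (s : State (TransTerm L)), S[j]? = some s →
    s.term.AllMod fun _ α f => α ∈ F.pos ∧ ∀ i, RefOK h S j s (f i)
  lits : ∀ (j : ℕ) (s : State (TransTerm L)), S[j]? = some s →
    ∀ q, (true, q) ∈ s.term.lits → q ∈ s.dep

structure BlockWF (F : L.Fragments) (b : Block (TransTerm L)) : Prop where
  tail : StatesWF F b.height b.tail
  mods : b.head.AllMod fun _ α f => α ∈ F.pos ∧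
    ∀ i, (f i).2 = 0 ∧ ∃ s', b.tail[(f i).1]? = some s' ∧ s'.dep ⊆ b.fv
  lits : ∀ q, (true, q) ∈ b.head.lits → q ∈ b.fv
  dep : ∀ (j : ℕ) (s : State (TransTerm L)), b.tail[j]? = some s → s.dep ⊆ b.fv

open Block

theorem shiftStates_getElem? (k j : ℕ) (S : List (State (TransTerm L))) :
    (shiftStates (TransTerm.ops L) k S)[j]? = (S[j]?).map (State.mapTerm (TransTerm.shift k)) := by
  simp [shiftStates, TransTerm.ops]

theorem shiftStates_length (k : ℕ) (S : List (State (TransTerm L))) :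
    (shiftStates (TransTerm.ops L) k S).length = S.length := by simp [shiftStates]

/-- The states of a disjoint union are those of the first part and those of the second. -/
theorem append_shift_getElem? {S S' : List (State (TransTerm L))} {j : ℕ}
    {s : State (TransTerm L)}
    (h : (S ++ shiftStates (TransTerm.ops L) S.length S')[j]? = some s) :
    S[j]? = some s ∨ ∃ i s', j = i + S.length ∧ S'[i]? = some s' ∧
      s = s'.mapTerm (TransTerm.shift S.length) := by
  rw [List.getElem?_append] at h
  split_ifs at h with hj
  · exact Or.inl h
  · rw [shiftStates_getElem?, Option.map_eq_some_iff] at h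
    obtain ⟨s', h1, h2⟩ := h
    exact Or.inr ⟨j - S.length, s', by omega, h1, h2.symm⟩

theorem append_shift_getElem?_left {S S' : List (State (TransTerm L))} {j : ℕ}
    {s : State (TransTerm L)} (h : S[j]? = some s) :
    (S ++ shiftStates (TransTerm.ops L) S.length S')[j]? = some s := by
  rw [List.getElem?_append_left (List.getElem?_eq_some_iff.1 h).1, h]

theorem append_shift_getElem?_right {S S' : List (State (TransTerm L))} {j : ℕ}
    {s : State (TransTerm L)} (h : S'[j]? = some s) :
    (S ++ shiftStates (TransTerm.ops L) S.length S')[j + S.length]? =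
      some (s.mapTerm (TransTerm.shift S.length)) := by
  rw [List.getElem?_append_right (by omega), shiftStates_getElem?]
  simp [h]

theorem RefOK.mono {h h' : ℕ} (hh : h ≤ h') {S : List (State (TransTerm L))} {j : ℕ}
    {s : State (TransTerm L)} {x : ℕ × ℕ} (hx : RefOK h S j s x) : RefOK h' S j s x :=
  ⟨hx.1.trans (by omega), hx.2⟩

namespace StatesWF

variable {F : L.Fragments} {h h' : ℕ} {S S' : List (State (TransTerm L))}

theorem mono (hS : StatesWF F h S) (hh : h ≤ h') : StatesWF F h' S :=
  ⟨fun j s hj => (hS.mods j s hj).imp fun _ _ _ hf => ⟨hf.1, fun i => (hf.2 i).mono hh⟩, hS.lits⟩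

theorem append (hS : StatesWF F h S) (hS' : StatesWF F h S') :
    StatesWF F h (S ++ shiftStates (TransTerm.ops L) S.length S') := by
  constructor
  · intro j s hj
    rcases append_shift_getElem? hj with hj | ⟨i, s', rfl, hi, rfl⟩
    · refine (hS.mods j s hj).imp fun _ _ _ hf => ⟨hf.1, fun i => ?_⟩
      obtain ⟨h1, h2, h3, s', h4, h5⟩ := hf.2 i
      exact ⟨h1, h2, h3, s', append_shift_getElem?_left h4, h5⟩
    · refine (TransTerm.allMod_mapRef _ _).2 ((hS'.mods i s' hi).imp fun _ _ _ hf =>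
        ⟨hf.1, fun k => ?_⟩)
      obtain ⟨h1, h2, h3, s'', h4, h5⟩ := hf.2 k
      exact ⟨h1, fun h => by have := h2 h; dsimp only; omega, h3, _,
        append_shift_getElem?_right h4, h5⟩
  · intro j s hj
    rcases append_shift_getElem? hj with hj | ⟨i, s', rfl, hi, rfl⟩
    · exact hS.lits j s hj
    · intro q hq
      exact hS'.lits i s' hi q (by simpa [State.mapTerm, TransTerm.lits_shift] using hq)

end StatesWF

theorem states_getElem?_zero (b : Block (TransTerm L)) :
    (b.states (TransTerm.ops L))[0]? = some ⟨b.head.shift 1, b.fv, []⟩ := rfl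

theorem states_getElem?_succ (b : Block (TransTerm L)) (j : ℕ) :
    (b.states (TransTerm.ops L))[j + 1]? =
      (b.tail[j]?).map (State.mapTerm (TransTerm.shift 1)) := by
  simp [states, shiftStates_getElem?]

theorem states_length (b : Block (TransTerm L)) :
    (b.states (TransTerm.ops L)).length = b.tail.length + 1 := by
  simp [states, shiftStates_length]

theorem states_cases {b : Block (TransTerm L)} {j : ℕ} {s : State (TransTerm L)}
    (h : (b.states (TransTerm.ops L))[j]? = some s) :
    (j = 0 ∧ s = ⟨b.head.shift 1, b.fv, []⟩) ∨
      ∃ i s', j = i + 1 ∧ b.tail[i]? = some s' ∧ s = s'.mapTerm (TransTerm.shift 1) := by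
  cases j with
  | zero => exact Or.inl ⟨rfl, by simpa [states_getElem?_zero] using h.symm⟩
  | succ i =>
    rw [states_getElem?_succ, Option.map_eq_some_iff] at h
    obtain ⟨s', h1, h2⟩ := h
    exact Or.inr ⟨i, s', rfl, h1, h2.symm⟩

variable {F : L.Fragments}

theorem BlockWF.states {b : Block (TransTerm L)} (hb : BlockWF F b) :
    StatesWF F b.height (b.states (TransTerm.ops L)) := by
  have key : ∀ {i : ℕ} {s : State (TransTerm L)}, b.tail[i]? = some s →
      (b.states (TransTerm.ops L))[i + 1]? = some (s.mapTerm (TransTerm.shift 1)) := by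
    intro i s h
    rw [states_getElem?_succ, h, Option.map_some]
  constructor
  · intro j s hj
    rcases states_cases hj with ⟨rfl, rfl⟩ | ⟨i, s', rfl, hi, rfl⟩
    · refine (TransTerm.allMod_mapRef _ _).2 (hb.mods.imp fun _ _ _ hf => ⟨hf.1, fun k => ?_⟩)
      obtain ⟨h1, s', h2, h3⟩ := hf.2 k
      exact ⟨by simp [h1], fun _ => Nat.succ_pos _, fun h => (h h1).elim, _, key h2, h3⟩
    · refine (TransTerm.allMod_mapRef _ _).2 ((hb.tail.mods i s' hi).imp fun _ _ _ hf =>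
        ⟨hf.1, fun k => ?_⟩)
      obtain ⟨h1, h2, h3, s'', h4, h5⟩ := hf.2 k
      exact ⟨h1, fun h => Nat.succ_lt_succ (h2 h), h3, _, key h4, h5⟩
  · intro j s hj q hq
    rcases states_cases hj with ⟨rfl, rfl⟩ | ⟨i, s', rfl, hi, rfl⟩
    · exact hb.lits q (by simpa [TransTerm.lits_shift] using hq)
    · exact hb.tail.lits i s' hi q (by simpa [State.mapTerm, TransTerm.lits_shift] using hq)

theorem BlockWF.states_dep {b : Block (TransTerm L)} (hb : BlockWF F b) {j : ℕ}
    {s : State (TransTerm L)} (hj : (b.states (TransTerm.ops L))[j]? = some s) : s.dep ⊆ b.fv := by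
  rcases states_cases hj with ⟨rfl, rfl⟩ | ⟨i, s', rfl, hi, rfl⟩
  · exact List.Subset.refl _
  · exact hb.dep i s' hi

theorem cat_offset {bs : List (Block (TransTerm L))} {i : ℕ} {b : Block (TransTerm L)}
    (hi : bs[i]? = some b) : ∃ s, (cat (TransTerm.ops L) bs).1[
      (cat (TransTerm.ops L) bs).2.getD i 0]? = some s ∧ s.dep = b.fv ∧ s.cls = [] ∧
        ∃ k, s.term = b.head.shift k := by
  induction bs generalizing i with
  | nil => simp at hi
  | cons c bs ih =>
    cases i with
    | zero =>
      obtain rfl : c = b := by simpa using hi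
      exact ⟨⟨c.head.shift 1, c.fv, []⟩, by simp [cat, Block.states, TransTerm.ops], rfl, rfl, 1,
        rfl⟩
    | succ i =>
      obtain ⟨s, h1, h2, h3, k, h4⟩ := ih (i := i) (by simpa using hi)
      have hlen : i < (cat (TransTerm.ops L) bs).2.length := by
        have : ∀ cs : List (Block (TransTerm L)),
            (cat (TransTerm.ops L) cs).2.length = cs.length := by
          intro cs
          induction cs with
          | nil => rfl
          | cons d cs ih => simp [cat, ih]
        rw [this]
        exact (List.getElem?_eq_some_iff.1 (by simpa using hi)).1
      refine ⟨s.mapTerm (TransTerm.shift (c.tail.length + 1)), ?_, h2, h3,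
        k + (c.tail.length + 1), ?_⟩
      · have := append_shift_getElem?_right (S := c.states (TransTerm.ops L)) h1
        rw [states_length] at this
        simp only [cat, List.getD_cons_succ]
        rw [← this]
        congr 1
        simp [List.getD_eq_getElem?_getD, List.getElem?_eq_getElem hlen]
      · have : ∀ t : TransTerm L, (t.shift k).shift (c.tail.length + 1) =
            t.shift (k + (c.tail.length + 1)) := by
          intro t
          induction t with
          | lit | cst => rfl
          | bin b s t hs ht => exact congrArg₂ (TransTerm.bin b) hs ht
          | mod α f => simp [TransTerm.shift, TransTerm.mapRef, add_assoc]
        simp [State.mapTerm, h4, this]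

theorem cat_wf {bs : List (Block (TransTerm L))} (hbs : ∀ b ∈ bs, BlockWF F b) :
    StatesWF F ((bs.map Block.height).foldr max 0) (cat (TransTerm.ops L) bs).1 := by
  induction bs with
  | nil => exact ⟨fun j s h => by simp [cat] at h, fun j s h => by simp [cat] at h⟩
  | cons b bs ih =>
    have h := ((hbs b List.mem_cons_self).states.mono (le_max_left _ _)).append
      ((ih fun c hc => hbs c (List.mem_cons_of_mem _ hc)).mono (le_max_right b.height _))
    rw [states_length] at h
    exact h

theorem cat_dep {bs : List (Block (TransTerm L))} (hbs : ∀ b ∈ bs, BlockWF F b) {j : ℕ}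
    {s : State (TransTerm L)} (hj : (cat (TransTerm.ops L) bs).1[j]? = some s) :
    ∃ b ∈ bs, s.dep ⊆ b.fv := by
  induction bs generalizing j s with
  | nil => simp [cat] at hj
  | cons b bs ih =>
    simp only [cat, ← states_length] at hj
    rcases append_shift_getElem? hj with hj | ⟨i, s', rfl, hi, rfl⟩
    · exact ⟨b, List.mem_cons_self, (hbs b List.mem_cons_self).states_dep hj⟩
    · obtain ⟨c, hc, h⟩ := ih (fun c hc => hbs c (List.mem_cons_of_mem _ hc)) hi
      exact ⟨c, List.mem_cons_of_mem _ hc, h⟩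

theorem BlockWF.bin (d : Bool) {b c : Block (TransTerm L)} (hb : BlockWF F b) (hc : BlockWF F c) :
    BlockWF F (Block.bin (TransTerm.ops L) (.bin d) b c) := by
  constructor
  · exact (hb.tail.mono (le_max_left _ _)).append (hc.tail.mono (le_max_right _ _))
  · refine ⟨hb.mods.imp fun _ _ _ hf => ⟨hf.1, fun i => ?_⟩,
      (TransTerm.allMod_mapRef _ _).2 (hc.mods.imp fun _ _ _ hf => ⟨hf.1, fun i => ?_⟩)⟩
    · obtain ⟨h1, s, h2, h3⟩ := hf.2 i
      exact ⟨h1, s, append_shift_getElem?_left h2, List.subset_append_of_subset_left _ h3⟩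
    · obtain ⟨h1, s, h2, h3⟩ := hf.2 i
      exact ⟨h1, _, append_shift_getElem?_right h2, List.subset_append_of_subset_right _ h3⟩
  · rintro q (h | h)
    · exact List.mem_append_left _ (hb.lits q h)
    · exact List.mem_append_right _ (hc.lits q (by
        simpa [TransTerm.ops, TransTerm.lits_shift] using h))
  · intro j s hj
    rcases append_shift_getElem? hj with hj | ⟨i, s', rfl, hi, rfl⟩
    · exact List.subset_append_of_subset_left _ (hb.dep j s hj)
    · exact List.subset_append_of_subset_right _ (hc.dep i s' hi)

theorem BlockWF.next {n : ℕ} {α : L.Form n} (hα : α ∈ F.pos) {b : Fin n → Block (TransTerm L)}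
    (hb : ∀ i, BlockWF F (b i)) : BlockWF F (Block.next (TransTerm.ops L)
      (fun os => .mod α fun i => (os.getD i 0, 0)) (List.ofFn b)) := by
  have hbs : ∀ c ∈ List.ofFn b, BlockWF F c := by
    intro c hc
    obtain ⟨i, rfl⟩ := List.mem_ofFn.1 hc
    exact hb i
  constructor
  · exact (cat_wf hbs).mono (Nat.le_succ _)
  · refine ⟨hα, fun i => ⟨rfl, ?_⟩⟩
    obtain ⟨s, h1, h2, -⟩ := cat_offset (bs := List.ofFn b) (i := i) (b := b i) (by simp)
    refine ⟨s, h1, ?_⟩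
    rw [h2]
    exact fun q hq => List.mem_flatMap.2 ⟨b i, by simp, hq⟩
  · rintro q ⟨⟩
  · intro j s hj
    obtain ⟨c, hc, h⟩ := cat_dep hbs hj
    exact fun q hq => List.mem_flatMap.2 ⟨c, hc, h hq⟩

section Fix

variable (mu : Bool) (c : TransTerm L) (p : ℕ) (b : Block (TransTerm L))

/-- The states of a fixpoint block. -/
theorem fix_tail_getElem? (j : ℕ) : (b.fix (TransTerm.ops L) mu c p).tail[j]? =
    (b.tail[j]?).map fun s => if p ∈ s.dep then
      ⟨s.term.subst p ((b.head.subst p c).retag (fixTag mu b.height)),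
        (s.dep.filter fun q => q ≠ p) ++ b.fv.filter fun q => q ≠ p,
        mu :: (b.tail.filter fun s => p ∈ s.dep).flatMap State.cls⟩ else s := by
  simp [Block.fix, TransTerm.ops]

variable {mu c p b}

theorem fix_tail_cases {j : ℕ} {s : State (TransTerm L)}
    (h : (b.fix (TransTerm.ops L) mu c p).tail[j]? = some s) :
    ∃ s', b.tail[j]? = some s' ∧ ((p ∉ s'.dep ∧ s = s') ∨ (p ∈ s'.dep ∧
      s = ⟨s'.term.subst p ((b.head.subst p c).retag (fixTag mu b.height)),
        (s'.dep.filter fun q => q ≠ p) ++ b.fv.filter fun q => q ≠ p,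
        mu :: (b.tail.filter fun s => p ∈ s.dep).flatMap State.cls⟩)) := by
  rw [fix_tail_getElem?, Option.map_eq_some_iff] at h
  obtain ⟨s', h1, h2⟩ := h
  refine ⟨s', h1, ?_⟩
  split_ifs at h2 with hp
  · exact Or.inr ⟨hp, h2.symm⟩
  · exact Or.inl ⟨hp, h2.symm⟩

/-- After binding `p`, a state depends on what it depended on before, apart from `p`, and on the
free variables of the fixpoint formula if it depended on `p`. -/
theorem exists_fix_tail {j : ℕ} {s : State (TransTerm L)} (h : b.tail[j]? = some s) :
    ∃ s', (b.fix (TransTerm.ops L) mu c p).tail[j]? = some s' ∧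
      ∀ q, q ∈ s'.dep ↔ q ≠ p ∧ (q ∈ s.dep ∨ (p ∈ s.dep ∧ q ∈ b.fv)) := by
  rw [fix_tail_getElem?, h]
  refine ⟨_, rfl, fun q => ?_⟩
  dsimp only
  split_ifs with hp
  · simp [hp]
    tauto
  · simp [hp]
    rintro h rfl
    exact hp h

theorem BlockWF.fix (hc : c.lits = ∅) (hcm : ∀ Q, c.AllMod Q) (hb : BlockWF F b) :
    BlockWF F (b.fix (TransTerm.ops L) mu c p) := by
  have hdep : ∀ {j : ℕ} {s : State (TransTerm L)} {D : List ℕ}, b.tail[j]? = some s →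
      (∀ q, q ≠ p → q ∈ s.dep ∨ (p ∈ s.dep ∧ q ∈ b.fv) → q ∈ D) →
      ∃ s', (b.fix (TransTerm.ops L) mu c p).tail[j]? = some s' ∧ s'.dep ⊆ D := by
    intro j s D hj hD
    obtain ⟨s', h1, h2⟩ := exists_fix_tail (mu := mu) (c := c) (p := p) hj
    exact ⟨s', h1, fun q hq => hD q ((h2 q).1 hq).1 ((h2 q).1 hq).2⟩
  have hsub : (b.head.subst p c).AllMod fun _ α f => α ∈ F.pos ∧
      ∀ i, (f i).2 = 0 ∧ ∃ s', b.tail[(f i).1]? = some s' ∧ s'.dep ⊆ b.fv :=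
    hb.mods.subst fun _ => hcm _
  have hlits : ∀ q, (true, q) ∈ (b.head.subst p c).lits → q ≠ p ∧ q ∈ b.fv := by
    intro q hq
    rcases TransTerm.mem_lits_subst hq with ⟨h1, h2⟩ | ⟨-, h⟩
    · exact ⟨fun h => h2 (by rw [h]), hb.lits q h1⟩
    · simp [hc] at h
  constructor
  · constructor
    · intro j s hj
      obtain ⟨s', hj', ⟨hp, rfl⟩ | ⟨hp, rfl⟩⟩ := fix_tail_cases hj
      · refine (hb.tail.mods j s hj').imp fun _ _ _ hf => ⟨hf.1, fun i => ?_⟩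
        obtain ⟨h1, h2, h3, s', h4, h5⟩ := hf.2 i
        refine ⟨h1.trans (by simp [Block.fix]), h2, h3, hdep h4 ?_⟩
        rintro q hq (h | ⟨h, -⟩)
        exacts [h5 h, (hp (h5 h)).elim]
      · refine TransTerm.AllMod.subst ?_ fun _ => ?_
        · refine (hb.tail.mods j s' hj').imp fun _ _ _ hf => ⟨hf.1, fun i => ?_⟩
          obtain ⟨h1, h2, h3, s'', h4, h5⟩ := hf.2 i
          refine ⟨h1.trans (by simp [Block.fix]), h2, fun h => ?_, hdep h4 ?_⟩
          · refine List.mem_cons_of_mem _ (List.mem_flatMap.2 ⟨s', ?_, h3 h⟩)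
            simp [hp, List.mem_of_getElem? hj']
          · rintro q hq (h | ⟨-, h⟩)
            · simp [h5 h, hq]
            · simp [h, hq]
        · refine (TransTerm.allMod_mapRef _ _).2 (hsub.imp fun _ _ _ hf => ⟨hf.1, fun i => ?_⟩)
          obtain ⟨h1, s'', h2, h3⟩ := hf.2 i
          refine ⟨?_, ?_, fun _ => ?_, hdep h2 ?_⟩
          · cases mu <;> simp [fixTag, Block.fix, mul_add]
          · cases mu <;> simp [fixTag]
          · cases mu <;> simp [fixTag]
          · rintro q hq (h | ⟨-, h⟩)
            · simp [h3 h, hq]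
            · simp [h, hq]
    · intro j s hj q hq
      obtain ⟨s', hj', ⟨hp, rfl⟩ | ⟨hp, rfl⟩⟩ := fix_tail_cases hj
      · exact hb.tail.lits j s hj' q hq
      · rcases TransTerm.mem_lits_subst hq with ⟨h1, h2⟩ | ⟨-, h⟩
        · have : q ≠ p := fun h => h2 (by rw [h])
          simp [hb.tail.lits j s' hj' q h1, this]
        · rw [TransTerm.lits_retag] at h
          simp [hlits q h]
  · refine hsub.imp fun _ _ _ hf => ⟨hf.1, fun i => ?_⟩
    obtain ⟨h1, s'', h2, h3⟩ := hf.2 i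
    refine ⟨h1, hdep h2 ?_⟩
    rintro q hq (h | ⟨-, h⟩)
    · simp [Block.fix, h3 h, hq]
    · simp [Block.fix, h, hq]
  · intro q hq
    simp [Block.fix, hlits q hq]
  · intro j s hj q hq
    obtain ⟨s', hj', ⟨hp, rfl⟩ | ⟨hp, rfl⟩⟩ := fix_tail_cases hj
    · have := hb.dep j s hj' hq
      have hqp : q ≠ p := fun h => hp (h ▸ hq)
      simp [Block.fix, this, hqp]
    · rcases List.mem_append.1 hq with h | h
      · have h' := List.mem_filter.1 h
        exact List.mem_filter.2 ⟨hb.dep j s' hj' h'.1, h'.2⟩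
      · exact h

end Fix

theorem MuForm.block_wf {φ : MuForm L} (hφ : φ.IsMuL F) : BlockWF F φ.block := by
  induction φ with
  | atom q =>
    exact ⟨⟨fun j s h => by simp [block] at h, fun j s h => by simp [block] at h⟩, trivial,
      fun q h => by simpa [block, TransTerm.lits] using h, fun j s h => by simp [block] at h⟩
  | natom q =>
    exact ⟨⟨fun j s h => by simp [block] at h, fun j s h => by simp [block] at h⟩, trivial,
      fun q h => by simp [block, TransTerm.lits] at h, fun j s h => by simp [block] at h⟩
  | or φ ψ hφ' hψ => exact (hφ' hφ.1).bin true (hψ hφ.2)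
  | and φ ψ hφ' hψ => exact (hφ' hφ.1).bin false (hψ hφ.2)
  | nxt α φ ih => exact BlockWF.next hφ.1 fun i => ih i (hφ.2 i)
  | mu p φ ih => exact (ih hφ.2).fix rfl fun _ => trivial
  | nu p φ ih => exact (ih hφ.2).fix rfl fun _ => trivial

theorem MuForm.mem_block_fv {φ : MuForm L} {q : ℕ} : q ∈ φ.block.fv ↔ q ∈ φ.fv := by
  induction φ with
  | atom | natom => simp [block, fv]
  | or φ ψ hφ hψ | and φ ψ hφ hψ => simp [block, fv, Block.bin, hφ, hψ]
  | nxt α φ ih =>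
    simp only [block, fv, Block.next, List.mem_flatMap, List.mem_ofFn, Set.mem_iUnion, ← ih]
    simp
  | mu p φ ih | nu p φ ih => simp [block, fv, Block.fix, ih]

end

section

open Block

/-! ### Signatures -/

/-- Strict lexicographic comparison of signatures at the components from `m` on; larger components
are more significant. -/
def LexLT (m : ℕ) (a b : ℕ → Ordinal.{u}) : Prop := ∃ k ≥ m, a k < b k ∧ ∀ l > k, a l = b l

/-- The signature `a` is lexicographically at most `b` at the components from `m` on. -/
def LexLE (m : ℕ) (a b : ℕ → Ordinal.{u}) : Prop := (∀ l ≥ m, a l = b l) ∨ LexLT m a b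

theorem LexLE.weaken {m m' : ℕ} (h : m ≤ m') {a b : ℕ → Ordinal.{u}} (hab : LexLE m a b) :
    LexLE m' a b := by
  rcases hab with hab | ⟨k, hk, h1, h2⟩
  · exact Or.inl fun l hl => hab l (h.trans hl)
  · by_cases hkm : m' ≤ k
    · exact Or.inr ⟨k, hkm, h1, h2⟩
    · exact Or.inl fun l hl => h2 l (by omega)

/-- In a sequence of signatures of bounded length that is non-increasing at the components from
`m` on, there are only finitely many strict decreases. -/
theorem eventually_not_lexLT {m N : ℕ} {r : ℕ → ℕ → Ordinal.{u}} (hN : ∀ i, ∀ k > N, r i k = 0)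
    (hr : ∀ i, LexLE m (r (i + 1)) (r i)) : ∃ i₀, ∀ i ≥ i₀, ¬ LexLT m (r (i + 1)) (r i) := by
  -- by downward induction on `k`, the components from `k` on are eventually constant
  have key : ∀ d k, k + d = N + 1 → m ≤ k → ∃ i₀, ∀ i ≥ i₀, ∀ l ≥ k, r (i + 1) l = r i l := by
    intro d
    induction d with
    | zero =>
      intro k hk _
      exact ⟨0, fun i _ l hl => by rw [hN _ l (by omega), hN _ l (by omega)]⟩
    | succ d ih =>
      intro k hk hm
      obtain ⟨i₀, hi₀⟩ := ih (k + 1) (by omega) (by omega)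
      have hle : ∀ i, r (i₀ + i + 1) k ≤ r (i₀ + i) k := by
        intro i
        rcases hr (i₀ + i) with h | ⟨k', hk', h1, h2⟩
        · exact (h k hm).le
        · rcases lt_trichotomy k' k with h | rfl | h
          · exact (h2 k h).le
          · exact h1.le
          · exact absurd (hi₀ (i₀ + i) (by omega) k' (by omega)) h1.ne
      obtain ⟨n, hn⟩ : ∃ n, ∀ i, n ≤ i → r (i₀ + n) k = r (i₀ + i) k := by
        have hanti : Antitone fun i => r (i₀ + i) k := antitone_nat_of_succ_le hle
        obtain ⟨n, hn⟩ := csInf_mem (Set.range_nonempty fun i => r (i₀ + i) k)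
        exact ⟨n, fun i hi => le_antisymm (hn.trans_le (csInf_le' ⟨i, rfl⟩)) (hanti hi)⟩
      refine ⟨i₀ + n, fun i hi l hl => ?_⟩
      rcases Nat.lt_or_ge k l with h | h
      · exact hi₀ i (by omega) l (by omega)
      · obtain rfl : l = k := by omega
        obtain ⟨e, rfl⟩ : ∃ e, i = i₀ + e := ⟨i - i₀, by omega⟩
        rw [← hn e (by omega), add_assoc, ← hn (e + 1) (by omega)]
  by_cases hm : m ≤ N + 1
  · obtain ⟨i₀, hi₀⟩ := key (N + 1 - m) m (by omega) le_rfl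
    refine ⟨i₀, fun i hi ⟨k, hk, h1, _⟩ => ?_⟩
    exact h1.ne (hi₀ i hi k hk)
  · refine ⟨0, fun i _ ⟨k, hk, h1, _⟩ => ?_⟩
    rw [hN _ k (by omega), hN _ k (by omega)] at h1
    exact lt_irrefl _ h1

/-! ### Semantics of transition terms and of formulas, with polarity -/

variable {L : OneStepLanguage.{u, w}} {T : Type u}

/-- The meaning of a transition term in a frame `(T, R)`, where `ρ` interprets the variables and `U`
the references.  For `pol = true` this is the set of points at which Éloise can satisfy the term;
for `pol = false` it is the dual notion for Abelard, the set of points at which the term is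
refuted if `ρ` and `U` consist of the points at which variables and references are refuted. -/
def tsem (pol : Bool) (R : T → T → Prop) (ρ : ℕ → Set T) (U : ℕ × ℕ → Set T) :
    TransTerm L → Set T
  | .lit b q => if b = true then ρ q else (ρ q)ᶜ
  | .cst b => if b = pol then Set.univ else ∅
  | .bin b s t => if b = pol then tsem pol R ρ U s ∪ tsem pol R ρ U t
      else tsem pol R ρ U s ∩ tsem pol R ρ U t
  | .mod α f => {s | if pol = true
      then L.sat (D := {t : T // R s t}) (fun i => {t | t.1 ∈ U (f i)}) α
      else ¬ L.sat (D := {t : T // R s t}) (fun i => {t | t.1 ∉ U (f i)}) α}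

/-- The meaning of a formula (`pol = true`), or its boolean dual (`pol = false`). -/
def polExt (pol : Bool) (R : T → T → Prop) (ρ : ℕ → Set T) (φ : MuForm L) : Set T :=
  if pol = true then φ.ext R ρ else (φ.ext R fun q => (ρ q)ᶜ)ᶜ

variable {F : L.Fragments} {pol : Bool} {R : T → T → Prop}

theorem OneStepLanguage.Fragments.sat_mono {n : ℕ} {α : L.Form n} (hα : α ∈ F.pos) {D : Type u}
    {V V' : Fin n → Set D} (h : ∀ i, V i ⊆ V' i) (hs : L.sat V α) : L.sat V' α :=
  F.pos_sound α hα D V V' ⟨fun i _ => h i, fun i hi => (hi (Set.mem_univ i)).elim⟩ hs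

theorem tsem_mono {ρ ρ' : ℕ → Set T} {U U' : ℕ × ℕ → Set T} {t : TransTerm L} {s : T}
    (hpos : ∀ q, (true, q) ∈ t.lits → s ∈ ρ q → s ∈ ρ' q)
    (hneg : ∀ q, (false, q) ∈ t.lits → s ∈ ρ' q → s ∈ ρ q)
    (hU : t.AllMod fun _ α f => α ∈ F.pos ∧ ∀ i, U (f i) ⊆ U' (f i))
    (hs : s ∈ tsem pol R ρ U t) : s ∈ tsem pol R ρ' U' t := by
  induction t with
  | lit b q =>
    cases b
    · exact fun h => hs (hneg q rfl h)
    · exact hpos q rfl hs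
  | cst b => exact hs
  | bin b t t' ht ht' =>
    have h1 := ht (fun q hq => hpos q (Or.inl hq)) (fun q hq => hneg q (Or.inl hq)) hU.1
    have h2 := ht' (fun q hq => hpos q (Or.inr hq)) (fun q hq => hneg q (Or.inr hq)) hU.2
    simp only [tsem] at hs ⊢
    split_ifs at hs ⊢
    · exact hs.imp h1 h2
    · exact hs.imp h1 h2
  | mod α f =>
    simp only [tsem, Set.mem_ofPred_eq] at hs ⊢
    split_ifs at hs ⊢
    · exact F.sat_mono hU.1 (fun i t ht => hU.2 i ht) hs
    · exact fun h => hs (F.sat_mono hU.1 (fun i t (ht : t.1 ∉ U' (f i)) (ht' : t.1 ∈ U (f i)) =>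
        ht (hU.2 i ht')) h)

theorem tsem_mapRef (ρ : ℕ → Set T) (U : ℕ × ℕ → Set T) (g : ℕ × ℕ → ℕ × ℕ) (t : TransTerm L) :
    tsem pol R ρ U (t.mapRef g) = tsem pol R ρ (fun x => U (g x)) t := by
  induction t with
  | lit | cst | mod => rfl
  | bin b s t hs ht => simp only [TransTerm.mapRef, tsem, hs, ht]

theorem tsem_subst (ρ : ℕ → Set T) (U : ℕ × ℕ → Set T) {p : ℕ} {t v : TransTerm L}
    (hp : (false, p) ∉ t.lits) : tsem pol R ρ U (t.subst p v) =
      tsem pol R (Function.update ρ p (tsem pol R ρ U v)) U t := by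
  induction t with
  | lit b q =>
    by_cases hq : q = p
    · subst hq
      cases b
      · exact (hp rfl).elim
      · simp [TransTerm.subst, tsem]
    · simp [TransTerm.subst, tsem, hq]
  | cst | mod => rfl
  | bin b s t hs ht =>
    simp only [TransTerm.subst, tsem, hs fun h => hp (Or.inl h), ht fun h => hp (Or.inr h)]

section polExt

variable (ρ : ℕ → Set T) (φ ψ : MuForm L) (p : ℕ)

theorem polExt_or : polExt pol R ρ (.or φ ψ) =
    if true = pol then polExt pol R ρ φ ∪ polExt pol R ρ ψ
    else polExt pol R ρ φ ∩ polExt pol R ρ ψ := by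
  cases pol <;> simp [polExt, MuForm.ext]

theorem polExt_and : polExt pol R ρ (.and φ ψ) =
    if false = pol then polExt pol R ρ φ ∪ polExt pol R ρ ψ
    else polExt pol R ρ φ ∩ polExt pol R ρ ψ := by
  cases pol <;> simp [polExt, MuForm.ext, Set.compl_inter]

theorem compl_update (X : Set T) : (fun q => (Function.update ρ p X q)ᶜ) =
    Function.update (fun q => (ρ q)ᶜ) p Xᶜ := by
  ext1 q
  by_cases h : q = p
  · subst h; simp
  · simp [h]

/-- The polarity of a fixpoint formula is reversed by dualization. -/
theorem polExt_mu : polExt pol R ρ (.mu p φ) = if pol = true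
    then ⋂₀ {X | polExt pol R (Function.update ρ p X) φ ⊆ X}
    else ⋃₀ {X | X ⊆ polExt pol R (Function.update ρ p X) φ} := by
  cases pol
  · ext s
    simp only [polExt, MuForm.ext, compl_update, Bool.false_eq_true, if_false, Set.mem_compl_iff,
      Set.mem_sInter, Set.mem_sUnion, Set.mem_ofPred_eq, not_forall]
    constructor
    · rintro ⟨X, hX, hs⟩
      exact ⟨Xᶜ, by simpa using hX, hs⟩
    · rintro ⟨X, hX, hs⟩
      exact ⟨Xᶜ, by simpa [Set.subset_compl_comm] using hX, by simpa using hs⟩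
  · simp [polExt, MuForm.ext]

theorem polExt_nu : polExt pol R ρ (.nu p φ) = if pol = false
    then ⋂₀ {X | polExt pol R (Function.update ρ p X) φ ⊆ X}
    else ⋃₀ {X | X ⊆ polExt pol R (Function.update ρ p X) φ} := by
  cases pol
  · ext s
    simp only [polExt, MuForm.ext, compl_update, Bool.false_eq_true, if_false, if_true,
      Set.mem_compl_iff, Set.mem_sInter, Set.mem_sUnion, Set.mem_ofPred_eq, not_exists, not_and]
    constructor
    · intro h X hX
      by_contra hs
      exact h Xᶜ (by simpa [Set.compl_subset_comm] using hX) hs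
    · intro h X hX hs
      exact h Xᶜ (by simpa using hX) hs
  · simp [polExt, MuForm.ext]

end polExt

theorem MuForm.ext_mono {φ : MuForm L} (hφ : φ.IsMuL F) {ρ ρ' : ℕ → Set T}
    (h : ∀ q, ρ q ⊆ ρ' q) (h' : ∀ q, ¬ φ.PositiveIn q → ρ' q ⊆ ρ q) :
    φ.ext R ρ ⊆ φ.ext R ρ' := by
  induction φ generalizing ρ ρ' with
  | atom q => exact h q
  | natom q => exact Set.compl_subset_compl.2 (h' q (by simp [PositiveIn]))
  | or φ ψ ih1 ih2 =>
    exact Set.union_subset_union (ih1 hφ.1 h fun q hq => h' q fun hn => hq hn.1)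
      (ih2 hφ.2 h fun q hq => h' q fun hn => hq hn.2)
  | and φ ψ ih1 ih2 =>
    exact Set.inter_subset_inter (ih1 hφ.1 h fun q hq => h' q fun hn => hq hn.1)
      (ih2 hφ.2 h fun q hq => h' q fun hn => hq hn.2)
  | nxt α φ ih =>
    exact fun s hs => F.sat_mono hφ.1
      (fun i t ht => ih i (hφ.2 i) h (fun q hq => h' q fun hn => hq (hn i)) ht) hs
  | mu p φ ih | nu p φ ih =>
    have key : ∀ X : Set T, φ.ext R (Function.update ρ p X) ⊆ φ.ext R (Function.update ρ' p X) := by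
      intro X
      refine ih hφ.2 (fun q => ?_) fun q hq => ?_
      · by_cases hqp : q = p
        · subst hqp; simp
        · simpa [hqp] using h q
      · by_cases hqp : q = p
        · subst hqp; simp
        · simpa [hqp] using h' q fun hn => hn.elim (fun hn => hqp hn.symm) hq
    first
    | exact fun s hs X hX => hs X ((key X).trans hX)
    | exact fun s ⟨X, hX, hs⟩ => ⟨X, Set.Subset.trans hX (key X), hs⟩

theorem polExt_mono {φ : MuForm L} (hφ : φ.IsMuL F) {p : ℕ} (hp : φ.PositiveIn p)
    (ρ : ℕ → Set T) : Monotone fun X => polExt pol R (Function.update ρ p X) φ := by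
  have key : ∀ (ρ : ℕ → Set T) {X Y : Set T}, X ⊆ Y →
      φ.ext R (Function.update ρ p X) ⊆ φ.ext R (Function.update ρ p Y) := by
    intro ρ X Y hXY
    refine MuForm.ext_mono hφ (fun q => ?_) fun q hq => ?_
    · by_cases hqp : q = p
      · subst hqp; simpa using hXY
      · simp [hqp]
    · by_cases hqp : q = p
      · subst hqp; exact (hq hp).elim
      · simp [hqp]
  intro X Y hXY
  cases pol
  · simp only [polExt, compl_update, Bool.false_eq_true, if_false]
    exact Set.compl_subset_compl.2 (key _ (Set.compl_subset_compl.2 hXY))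
  · exact key ρ hXY

theorem exists_approximants {f : Set T → Set T} (hf : Monotone f) :
    ∃ A : Ordinal.{u} → Set T, (∀ γ s, s ∈ A γ ↔ ∃ δ < γ, s ∈ f (A δ)) ∧
      ∀ s ∈ ⋂₀ {X | f X ⊆ X}, ∃ γ, s ∈ A γ := by
  obtain ⟨γ, hγ⟩ := OrdinalApprox.lfp_mem_range_lfpApprox (⟨f, hf⟩ : Set T →o Set T)
  refine ⟨OrdinalApprox.lfpApprox ⟨f, hf⟩ ⊥, fun γ s => ?_, fun s hs => ⟨γ, ?_⟩⟩
  · rw [OrdinalApprox.lfpApprox]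
    simp
  · rw [hγ]
    exact hs

/-! ### Progress measures -/

/-- The targets that a reference may have if the current signature is `a`: they belong to `W`, and
the signature does not increase at the components from the tag on, and decreases there if the tag
is that of a least fixpoint (`μ` for Éloise, `ν` for Abelard). -/
def target (pol : Bool) (W : ℕ → Set T) (r : ℕ → T → ℕ → Ordinal.{u}) (a : ℕ → Ordinal.{u}) :
    ℕ × ℕ → Set T :=
  fun x => {t | t ∈ W x.1 ∧ LexLE x.2 (r x.1 t) a ∧
    (x.2 ≠ 0 → x.2.bodd = pol → LexLT x.2 (r x.1 t) a)}

/-- `r` is a progress measure on `W`: at every point of `W j`, the term of the state with number `j` is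
satisfied (refuted, for `pol = false`) by references that respect the signatures.  Signatures vanish
beyond the component `2 * h`. -/
structure IsProgress (pol : Bool) (R : T → T → Prop) (ρ : ℕ → Set T) (h : ℕ)
    (S : List (State (TransTerm L))) (W : ℕ → Set T) (r : ℕ → T → ℕ → Ordinal.{u}) : Prop where
  zero : ∀ j t k, 2 * h < k → r j t k = 0
  step : ∀ j s, S[j]? = some s → ∀ t ∈ W j, t ∈ tsem pol R ρ (target pol W r (r j t)) s.term

/-- The block `b` is satisfied (refuted, for `pol = false`) on `X`, with a progress measure as a
witness. -/
def Realizes (pol : Bool) (R : T → T → Prop) (ρ : ℕ → Set T) (b : Block (TransTerm L))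
    (X : Set T) : Prop :=
  ∃ W r, IsProgress pol R ρ b.height b.tail W r ∧ X ⊆ tsem pol R ρ (fun x => W x.1) b.head

/-- The function that is `f` below `k`, followed by `g`. -/
def joinFun {β : Type*} (k : ℕ) (f g : ℕ → β) : ℕ → β := fun j => if j < k then f j else g (j - k)

/-- The function with value `a` at `0`, followed by `f`. -/
def consFun {β : Type*} (a : β) (f : ℕ → β) : ℕ → β
  | 0 => a
  | j + 1 => f j

theorem joinFun_lt {β : Type*} {k j : ℕ} (f g : ℕ → β) (h : j < k) : joinFun k f g j = f j :=
  if_pos h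

theorem joinFun_add {β : Type*} (k j : ℕ) (f g : ℕ → β) : joinFun k f g (j + k) = g j := by
  simp [joinFun]

section Progress

variable {ρ : ℕ → Set T} {h h' : ℕ} {S S' : List (State (TransTerm L))} {W W' : ℕ → Set T}
  {r r' : ℕ → T → ℕ → Ordinal.{u}}

theorem IsProgress.mono (hS : IsProgress pol R ρ h S W r) (hh : h ≤ h') :
    IsProgress pol R ρ h' S W r :=
  ⟨fun j t k hk => hS.zero j t k (by omega), hS.step⟩

theorem StatesWF.ref_lt (hS : StatesWF F h S) {j : ℕ} {s : State (TransTerm L)}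
    (hj : S[j]? = some s) : s.term.AllMod fun _ α f => α ∈ F.pos ∧ ∀ i, (f i).1 < S.length :=
  (hS.mods j s hj).imp fun _ _ _ hf => ⟨hf.1, fun i => by
    obtain ⟨-, -, -, s', h4, -⟩ := hf.2 i
    exact (List.getElem?_eq_some_iff.1 h4).1⟩

theorem IsProgress.append {h₁ h₂ : ℕ} (hwf : StatesWF F h₁ S) (hwf' : StatesWF F h₂ S')
    (hS : IsProgress pol R ρ h S W r) (hS' : IsProgress pol R ρ h S' W' r') :
    IsProgress pol R ρ h (S ++ shiftStates (TransTerm.ops L) S.length S')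
      (joinFun S.length W W') (joinFun S.length r r') := by
  constructor
  · intro j t k hk
    by_cases hj : j < S.length
    · simp only [joinFun_lt _ _ hj, hS.zero j t k hk]
    · simp only [joinFun, if_neg hj, hS'.zero _ t k hk]
  · intro j s hj t ht
    rcases append_shift_getElem? hj with hj | ⟨i, s', rfl, hi, rfl⟩
    · have hlt := (List.getElem?_eq_some_iff.1 hj).1
      rw [joinFun_lt _ _ hlt] at ht ⊢
      refine tsem_mono (F := F) (fun _ _ => id) (fun _ _ => id) ?_ (hS.step j s hj t ht)
      refine (hwf.ref_lt hj).imp fun _ _ f hf => ⟨hf.1, fun i => ?_⟩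
      simp only [target, joinFun_lt _ _ (hf.2 i)]
      exact fun _ => id
    · rw [joinFun_add] at ht ⊢
      simp only [State.mapTerm, TransTerm.shift, tsem_mapRef]
      refine tsem_mono (F := F) (fun _ _ => id) (fun _ _ => id) ?_ (hS'.step i s' hi t ht)
      refine (hwf'.ref_lt hi).imp fun _ _ f hf => ⟨hf.1, fun i => ?_⟩
      simp only [target, joinFun_add]
      exact fun _ => id

variable {b c : Block (TransTerm L)} {X Y : Set T}

/-- The head of a block becomes a state whose signature has an additional top component, so that
every move into the block is a decrease. -/
theorem Realizes.states (hb : BlockWF F b) (hX : Realizes pol R ρ b X) :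
    ∃ W r, IsProgress pol R ρ (b.height + 1) (b.states (TransTerm.ops L)) W r ∧ X ⊆ W 0 := by
  obtain ⟨W, r, hS, hX⟩ := hX
  refine ⟨consFun (tsem pol R ρ (fun x => W x.1) b.head) W,
    consFun (fun _ k => if k = 2 * b.height + 1 then 1 else 0) r, ⟨?_, ?_⟩, hX⟩
  · intro j t k hk
    cases j with
    | zero => exact if_neg (by omega)
    | succ j => exact hS.zero j t k (by omega)
  · intro j s hj t ht
    rcases states_cases hj with ⟨rfl, rfl⟩ | ⟨i, s', rfl, hi, rfl⟩
    · simp only [TransTerm.shift, tsem_mapRef]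
      refine tsem_mono (F := F) (fun _ _ => id) (fun _ _ => id) ?_ ht
      refine hb.mods.imp fun _ _ f hf => ⟨hf.1, fun i t ht =>
        ⟨ht, ?_, fun h => (h (hf.2 i).1).elim⟩⟩
      refine Or.inr ⟨2 * b.height + 1, by simp [(hf.2 i).1], ?_, fun l hl => ?_⟩
      · simp [consFun, hS.zero]
      · simp [consFun, hS.zero _ _ l (show 2 * b.height < l by omega),
          show l ≠ 2 * b.height + 1 by omega]
    · simp only [State.mapTerm, TransTerm.shift, tsem_mapRef]
      exact hS.step i s' hi t ht

theorem Realizes.bin (d : Bool) (hb : BlockWF F b) (hc : BlockWF F c)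
    (hX : Realizes pol R ρ b X) (hY : Realizes pol R ρ c Y) :
    Realizes pol R ρ (Block.bin (TransTerm.ops L) (.bin d) b c)
      (if d = pol then X ∪ Y else X ∩ Y) := by
  obtain ⟨W, r, hS, hX⟩ := hX
  obtain ⟨W', r', hS', hY⟩ := hY
  refine ⟨_, _, (hS.mono (le_max_left _ _)).append hb.tail hc.tail
    (hS'.mono (le_max_right _ _)), ?_⟩
  have h1 : X ⊆ tsem pol R ρ (fun x => joinFun b.tail.length W W' x.1) b.head := by
    refine fun t ht => tsem_mono (F := F) (fun _ _ => id) (fun _ _ => id) ?_ (hX ht)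
    refine hb.mods.imp fun _ _ f hf => ⟨hf.1, fun i => ?_⟩
    obtain ⟨-, s', h4, -⟩ := hf.2 i
    simp only [joinFun_lt _ _ (List.getElem?_eq_some_iff.1 h4).1]
    exact fun _ => id
  have h2 : Y ⊆ tsem pol R ρ (fun x => joinFun b.tail.length W W' x.1)
      (c.head.shift b.tail.length) := by
    simp only [TransTerm.shift, tsem_mapRef, joinFun_add]
    exact hY
  simp only [Block.bin, TransTerm.ops, tsem]
  split_ifs
  · exact Set.union_subset_union h1 h2
  · exact Set.inter_subset_inter h1 h2

theorem Realizes.cat {bs : List (Block (TransTerm L))} {X : ℕ → Set T}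
    (hbs : ∀ i b, bs[i]? = some b → BlockWF F b ∧ Realizes pol R ρ b (X i)) :
    ∃ W r, IsProgress pol R ρ ((bs.map Block.height).foldr max 0 + 1)
      (cat (TransTerm.ops L) bs).1 W r ∧
        ∀ i < bs.length, X i ⊆ W ((cat (TransTerm.ops L) bs).2.getD i 0) := by
  induction bs generalizing X with
  | nil =>
    exact ⟨fun _ => ∅, fun _ _ _ => 0, ⟨fun _ _ _ _ => rfl, fun _ _ _ _ h => h.elim⟩, by simp⟩
  | cons b bs ih =>
    obtain ⟨hb, hX⟩ := hbs 0 b rfl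
    obtain ⟨W, r, hS, h1⟩ := hX.states hb
    obtain ⟨W', r', hS', h2⟩ := ih (X := fun i => X (i + 1)) fun i c hc => hbs (i + 1) c (by simpa)
    have hwf : StatesWF F _ (Block.cat (TransTerm.ops L) bs).1 := cat_wf fun c hc => by
      obtain ⟨i, hi⟩ := List.mem_iff_getElem?.1 hc
      exact (hbs (i + 1) c (by simpa)).1
    have hlen : ∀ cs : List (Block (TransTerm L)),
        (Block.cat (TransTerm.ops L) cs).2.length = cs.length := by
      intro cs
      induction cs with
      | nil => rfl
      | cons d cs ih => simp [Block.cat, ih]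
    have key := (hS.mono
      (show _ ≤ max b.height ((bs.map Block.height).foldr max 0) + 1 by simp)).append
      hb.states hwf (hS'.mono (by simp))
    refine ⟨_, _, by rw [states_length] at key; exact key, fun i hi => ?_⟩
    cases i with
    | zero => simpa [Block.cat, joinFun] using h1
    | succ i =>
      have hi' : i < bs.length := by simpa using hi
      have : (Block.cat (TransTerm.ops L) (b :: bs)).2.getD (i + 1) 0 =
          (Block.cat (TransTerm.ops L) bs).2.getD i 0 + (b.tail.length + 1) := by
        simp [Block.cat, List.getD_eq_getElem?_getD, hlen, hi']
      rw [this, joinFun_add]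
      exact h2 i hi'

theorem Realizes.next {n : ℕ} {α : L.Form n} (hα : α ∈ F.pos) {b : Fin n → Block (TransTerm L)}
    (hb : ∀ i, BlockWF F (b i)) {X : Fin n → Set T} (hX : ∀ i, Realizes pol R ρ (b i) (X i)) :
    Realizes pol R ρ (Block.next (TransTerm.ops L)
      (fun os => .mod α fun i => (os.getD i 0, 0)) (List.ofFn b))
      {s | if pol = true then L.sat (D := {t : T // R s t}) (fun i => {t | t.1 ∈ X i}) α
        else ¬ L.sat (D := {t : T // R s t}) (fun i => {t | t.1 ∉ X i}) α} := by
  obtain ⟨W, r, hS, h⟩ := Realizes.cat (bs := List.ofFn b) (pol := pol) (R := R) (ρ := ρ) (F := F)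
    (X := fun i => if h : i < n then X ⟨i, h⟩ else ∅) (by
      intro i c hc
      obtain ⟨hi, rfl⟩ := List.getElem?_eq_some_iff.1 hc
      simp only [List.length_ofFn] at hi
      simpa [hi] using ⟨hb ⟨i, hi⟩, hX ⟨i, hi⟩⟩)
  refine ⟨W, r, hS, fun s hs => ?_⟩
  have h' : ∀ i : Fin n, X i ⊆ W ((Block.cat (TransTerm.ops L) (List.ofFn b)).2.getD i 0) := by
    intro i
    simpa using h i (by simp)
  simp only [Block.next, tsem, Set.mem_ofPred_eq] at hs ⊢
  split_ifs at hs ⊢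
  · exact F.sat_mono hα (fun i t ht => h' i ht) hs
  · exact fun hn => hs (F.sat_mono hα (fun i t (ht : t.1 ∉ W _) (ht' : t.1 ∈ X i) =>
      ht (h' i ht')) hn)

/-- A step of a fixpoint block, for either kind of fixpoint: it suffices to check the state before
the substitution, with the bound variable interpreted by the tagged new head. -/
theorem tsem_fix_tail {mu : Bool} {c : TransTerm L} {p : ℕ} (hb : BlockWF F b)
    (hn : ∀ (j : ℕ) (s : State (TransTerm L)), b.tail[j]? = some s → (false, p) ∉ s.term.lits)
    {U U' : ℕ × ℕ → Set T} {Z : Set T}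
    {t : T} {j : ℕ} {s : State (TransTerm L)}
    (hZ : Z ⊆ tsem pol R ρ U' ((b.head.subst p c).retag (fixTag mu b.height)))
    (hU : ∀ x, x.2 ≤ 2 * b.height → U x ⊆ U' x)
    (hj : (b.fix (TransTerm.ops L) mu c p).tail[j]? = some s)
    (ht : ∀ s', b.tail[j]? = some s' → t ∈ tsem pol R (Function.update ρ p Z) U s'.term) :
    t ∈ tsem pol R ρ U' s.term := by
  obtain ⟨s', hj', hs'⟩ := fix_tail_cases hj
  have hm : s'.term.AllMod fun _ α f => α ∈ F.pos ∧ ∀ i, U (f i) ⊆ U' (f i) :=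
    (hb.tail.mods j s' hj').imp fun _ _ f hf => ⟨hf.1, fun i => hU _ (hf.2 i).1⟩
  rcases hs' with ⟨hp, rfl⟩ | ⟨hp, rfl⟩
  · have hne : ∀ d q, (d, q) ∈ s.term.lits → q ≠ p := by
      rintro d q hq rfl
      cases d
      · exact hn j s hj' hq
      · exact hp (hb.tail.lits j s hj' q hq)
    refine tsem_mono (F := F) (fun q hq h => ?_) (fun q hq h => ?_) hm (ht s hj')
    · simpa [hne _ q hq] using h
    · simpa [hne _ q hq] using h
  · rw [tsem_subst _ _ (hn j s' hj')]
    refine tsem_mono (F := F) (fun q hq h => ?_) (fun q hq h => ?_) hm (ht s' hj')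
    · by_cases hqp : q = p
      · subst hqp
        simp only [Function.update_self] at h ⊢
        exact hZ h
      · simpa [hqp] using h
    · have hqp : q ≠ p := by
        rintro rfl
        exact hn j s' hj' hq
      simpa [hqp] using h

/-- Least fixpoints.  The new component of the signature of a point is the least stage of the
approximation in whose measure the point occurs.  Entering the fixpoint at a minimal stage, the
point is not in the approximant that interprets the bound variable, so that the unguarded
occurrences of that variable may be replaced by falsity. -/
theorem Realizes.fix_least {p : ℕ} (hb : BlockWF F b) (hnh : (false, p) ∉ b.head.lits)
    (hn : ∀ (j : ℕ) (s : State (TransTerm L)), b.tail[j]? = some s → (false, p) ∉ s.term.lits)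
    {f : Set T → Set T}
    (hf : Monotone f) (h : ∀ X, Realizes pol R (Function.update ρ p X) b (f X)) :
    Realizes pol R ρ (b.fix (TransTerm.ops L) pol (.cst !pol) p) (⋂₀ {X | f X ⊆ X}) := by
  obtain ⟨A, hA, hA'⟩ := exists_approximants hf
  choose W r hS hH using fun γ => h (A γ)
  set m := fixTag pol b.height with hm
  have hm1 : 2 * b.height < m := by cases pol <;> simp [hm, fixTag]
  have hm2 : m ≤ 2 * (b.height + 1) := by cases pol <;> simp [hm, fixTag]; omega
  let W' : ℕ → Set T := fun j => {t | ∃ γ, t ∈ W γ j}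
  let rk : ℕ → T → Ordinal.{u} := fun j t => sInf {γ | t ∈ W γ j}
  have hrk : ∀ {j : ℕ} {t : T}, t ∈ W' j → t ∈ W (rk j t) j :=
    fun {j t} h => csInf_mem (s := {γ | t ∈ W γ j}) h
  have hrk' : ∀ {j : ℕ} {t : T} {γ : Ordinal.{u}}, t ∈ W γ j → rk j t ≤ γ :=
    fun {j t γ} h => csInf_le' (s := {γ | t ∈ W γ j}) h
  let r' : ℕ → T → ℕ → Ordinal.{u} := fun j t => Function.update (r (rk j t) j t) m (rk j t)
  have hr' : ∀ j t k, k > m → r' j t k = 0 := by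
    intro j t k hk
    simp only [r', Function.update_of_ne hk.ne']
    exact (hS _).zero _ _ _ (by omega)
  have hlt : ∀ {j j' t t' m'}, m' ≤ m → rk j' t' < rk j t → LexLT m' (r' j' t') (r' j t) := by
    intro j j' t t' m' hm' hlt
    exact ⟨m, hm', by simpa [r'] using hlt, fun l hl => by rw [hr' _ _ _ hl, hr' _ _ _ hl]⟩
  have hhead : ∀ {γ t}, t ∈ A γ → ∃ δ < γ,
      t ∈ tsem pol R ρ (fun x => W δ x.1) (b.head.subst p (.cst !pol)) := by
    intro γ t ht
    obtain ⟨δ₀, hδ₀, h0⟩ := (hA γ t).1 ht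
    have hne : {δ | t ∈ f (A δ)}.Nonempty := ⟨δ₀, h0⟩
    have hmem : t ∈ f (A (sInf {δ | t ∈ f (A δ)})) := csInf_mem hne
    set δ := sInf {δ | t ∈ f (A δ)}
    have hnot : t ∉ A δ := fun hin => by
      obtain ⟨ε, hε, h1⟩ := (hA δ t).1 hin
      exact hε.not_ge (csInf_le' (s := {δ | t ∈ f (A δ)}) h1)
    refine ⟨δ, (csInf_le' (s := {δ | t ∈ f (A δ)}) h0).trans_lt hδ₀, ?_⟩
    rw [tsem_subst _ _ hnh]
    refine tsem_mono (F := F) (fun q hq h => ?_) (fun q hq h => ?_)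
      (hb.mods.imp fun _ _ f hf => ⟨hf.1, fun i => Set.Subset.refl _⟩) (hH δ hmem)
    · by_cases hqp : q = p
      · subst hqp
        exact (hnot (by simpa using h)).elim
      · simpa [hqp] using h
    · have hqp : q ≠ p := by
        rintro rfl
        exact hnh hq
      simpa [hqp] using h
  have hheadm : ∀ {Q : ∀ n : ℕ, L.Form n → (Fin n → ℕ × ℕ) → Prop},
      (∀ n (α : L.Form n) f, α ∈ F.pos → Q n α f) →
        (b.head.subst p (.cst !pol)).AllMod Q := fun {Q} hQ =>
    (hb.mods.imp fun _ _ f hf => hQ _ _ f hf.1).subst fun _ => trivial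
  refine ⟨W', r', ⟨fun j t k hk => hr' j t k (by simp only [Block.fix] at hk; omega), ?_⟩, ?_⟩
  · intro j s hj t ht
    have htγ := hrk ht
    refine tsem_fix_tail hb hn (Z := A (rk j t)) (U := target pol (W (rk j t)) (r (rk j t))
      (r (rk j t) j t)) ?_ ?_ hj fun s' hs' => (hS _).step j s' hs' t htγ
    · intro t' ht'
      obtain ⟨δ, hδ, h1⟩ := hhead ht'
      rw [TransTerm.retag, tsem_mapRef]
      refine tsem_mono (F := F) (fun _ _ => id) (fun _ _ => id)
        (hheadm fun _ α f hα => ⟨hα, fun i y hy => ?_⟩) h1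
      have hlt' := hlt (j := j) (t := t) (j' := (f i).1) (t' := y) le_rfl
        ((hrk' hy).trans_lt hδ)
      exact ⟨⟨δ, hy⟩, Or.inr hlt', fun _ _ => hlt'⟩
    · rintro ⟨j', m'⟩ hm' y ⟨hy, h1, h2⟩
      have hmm : m' ≤ m := le_trans hm' hm1.le
      refine ⟨⟨_, hy⟩, ?_⟩
      rcases (hrk' hy).lt_or_eq with hlt' | heq
      · exact ⟨Or.inr (hlt hmm hlt'), fun _ _ => hlt hmm hlt'⟩
      · have hupd : ∀ {a a' : ℕ → Ordinal.{u}}, LexLT m' a a' → (∀ k > 2 * b.height, a k = 0) →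
            (∀ k > 2 * b.height, a' k = 0) → LexLT m' (Function.update a m (rk j t))
              (Function.update a' m (rk j t)) := by
          rintro a a' ⟨k, hk, hk1, hk2⟩ ha ha'
          have hkm : k ≠ m := by
            rintro rfl
            rw [ha _ hm1, ha' _ hm1] at hk1
            exact lt_irrefl _ hk1
          refine ⟨k, hk, by simpa [hkm] using hk1, fun l hl => ?_⟩
          by_cases hlm : l = m
          · simp [hlm]
          · simpa [hlm] using hk2 l hl
        have hz : ∀ j' y, ∀ k > 2 * b.height, r (rk j t) j' y k = 0 :=
          fun j' y k hk => (hS _).zero j' y k hk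
        simp only [r', heq]
        refine ⟨?_, fun h3 h4 => hupd (h2 h3 h4) (hz _ _) (hz _ _)⟩
        rcases h1 with h1 | h1
        · refine Or.inl fun l hl => ?_
          by_cases hlm : l = m
          · simp [hlm]
          · simpa [hlm] using h1 l hl
        · exact Or.inr (hupd h1 (hz _ _) (hz _ _))
  · intro t ht
    obtain ⟨γ, hγ⟩ := hA' t ht
    obtain ⟨δ, -, h1⟩ := hhead hγ
    exact tsem_mono (F := F) (fun _ _ => id) (fun _ _ => id)
      (hheadm fun _ α f hα => ⟨hα, fun i y hy => ⟨δ, hy⟩⟩) h1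

/-- Greatest fixpoints: the measure for the fixpoint itself will do, and the unguarded occurrences
of the bound variable may be replaced by truth. -/
theorem Realizes.fix_greatest {p : ℕ} (hb : BlockWF F b) (hnh : (false, p) ∉ b.head.lits)
    (hn : ∀ (j : ℕ) (s : State (TransTerm L)), b.tail[j]? = some s → (false, p) ∉ s.term.lits)
    {f : Set T → Set T}
    (hf : Monotone f) (h : ∀ X, Realizes pol R (Function.update ρ p X) b (f X)) :
    Realizes pol R ρ (b.fix (TransTerm.ops L) (!pol) (.cst pol) p) (⋃₀ {X | X ⊆ f X}) := by
  set Z := ⋃₀ {X | X ⊆ f X} with hZ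
  have hZf : Z ⊆ f Z := by
    rintro t ⟨X, hX, ht⟩
    exact hf (show X ⊆ Z from fun y hy => ⟨X, hX, hy⟩) (hX ht)
  obtain ⟨W, r, hS, hH⟩ := h Z
  have hhead : Z ⊆ tsem pol R ρ (fun x => W x.1) (b.head.subst p (.cst pol)) := by
    intro t ht
    rw [tsem_subst _ _ hnh]
    refine tsem_mono (F := F) (fun q hq h => ?_) (fun q hq h => ?_)
      (hb.mods.imp fun _ _ f hf => ⟨hf.1, fun i => Set.Subset.refl _⟩) (hH (hZf ht))
    · by_cases hqp : q = p
      · subst hqp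
        simp [tsem]
      · simpa [hqp] using h
    · have hqp : q ≠ p := by
        rintro rfl
        exact hnh hq
      simpa [hqp] using h
  refine ⟨W, r, ⟨fun j t k hk => hS.zero j t k (by simp only [Block.fix] at hk; omega), ?_⟩, hhead⟩
  intro j s hj t ht
  refine tsem_fix_tail hb hn (Z := Z) (U := target pol W r (r j t)) ?_
    (fun _ _ => Set.Subset.refl _) hj fun s' hs' => hS.step j s' hs' t ht
  intro t' ht'
  rw [TransTerm.retag, tsem_mapRef]
  have hm1 : 2 * b.height < fixTag (!pol) b.height := by cases pol <;> simp [fixTag]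
  have hbodd : (fixTag (!pol) b.height).bodd ≠ pol := by cases pol <;> simp [fixTag]
  refine tsem_mono (F := F) (fun _ _ => id) (fun _ _ => id)
    ((hb.mods.imp fun _ _ f hf => ⟨hf.1, fun i y hy => ?_⟩).subst fun _ => trivial) (hhead ht')
  refine ⟨hy, Or.inl fun l hl => ?_, fun _ h => (hbodd h).elim⟩
  rw [hS.zero _ _ l (lt_of_lt_of_le hm1 hl), hS.zero _ _ l (lt_of_lt_of_le hm1 hl)]

end Progress

/-- A literal occurs in the block. -/
def Block.HasLit (b : Block (TransTerm L)) (x : Bool × ℕ) : Prop :=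
  x ∈ b.head.lits ∨ ∃ (j : ℕ) (s : State (TransTerm L)), b.tail[j]? = some s ∧ x ∈ s.term.lits

theorem Block.HasLit.of_states {b : Block (TransTerm L)} {x : Bool × ℕ} {j : ℕ}
    {s : State (TransTerm L)} (hj : (b.states (TransTerm.ops L))[j]? = some s)
    (hx : x ∈ s.term.lits) : b.HasLit x := by
  rcases states_cases hj with ⟨rfl, rfl⟩ | ⟨i, s', rfl, hi, rfl⟩
  · exact Or.inl (by simpa [TransTerm.lits_shift] using hx)
  · exact Or.inr ⟨i, s', hi, by simpa [State.mapTerm, TransTerm.lits_shift] using hx⟩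

theorem Block.HasLit.of_cat {bs : List (Block (TransTerm L))} {x : Bool × ℕ} {j : ℕ}
    {s : State (TransTerm L)} (hj : (cat (TransTerm.ops L) bs).1[j]? = some s)
    (hx : x ∈ s.term.lits) : ∃ b ∈ bs, b.HasLit x := by
  induction bs generalizing j s with
  | nil => simp [cat] at hj
  | cons b bs ih =>
    simp only [cat, ← states_length] at hj
    rcases append_shift_getElem? hj with hj | ⟨i, s', rfl, hi, rfl⟩
    · exact ⟨b, List.mem_cons_self, .of_states hj hx⟩
    · obtain ⟨c, hc, h⟩ := ih hi (by simpa [State.mapTerm, TransTerm.lits_shift] using hx)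
      exact ⟨c, List.mem_cons_of_mem _ hc, h⟩

theorem Block.HasLit.of_bin {d : Bool} {b c : Block (TransTerm L)} {x : Bool × ℕ}
    (h : (Block.bin (TransTerm.ops L) (.bin d) b c).HasLit x) : b.HasLit x ∨ c.HasLit x := by
  rcases h with (h | h) | ⟨j, s, hj, h⟩
  · exact Or.inl (Or.inl h)
  · exact Or.inr (Or.inl (by simpa [TransTerm.ops, TransTerm.lits_shift] using h))
  · rcases append_shift_getElem? hj with hj | ⟨i, s', rfl, hi, rfl⟩
    · exact Or.inl (Or.inr ⟨j, s, hj, h⟩)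
    · exact Or.inr (Or.inr ⟨i, s', hi, by simpa [State.mapTerm, TransTerm.lits_shift] using h⟩)

theorem Block.HasLit.of_fix {mu : Bool} {c : TransTerm L} (hc : c.lits = ∅) {p : ℕ}
    {b : Block (TransTerm L)} {x : Bool × ℕ}
    (h : (b.fix (TransTerm.ops L) mu c p).HasLit x) : b.HasLit x := by
  have hsub : x ∈ (b.head.subst p c).lits → x ∈ b.head.lits := by
    intro h
    rcases TransTerm.mem_lits_subst h with h | h
    · exact h.1
    · simp [hc] at h
  rcases h with h | ⟨j, s, hj, h⟩
  · exact Or.inl (hsub h)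
  · obtain ⟨s', hj', ⟨-, rfl⟩ | ⟨-, rfl⟩⟩ := fix_tail_cases hj
    · exact Or.inr ⟨j, s, hj', h⟩
    · rcases TransTerm.mem_lits_subst h with h | h
      · exact Or.inr ⟨j, s', hj', h.1⟩
      · exact Or.inl (hsub (by simpa [TransTerm.lits_retag] using h.2))

/-- Negative literals come from negative free occurrences. -/
theorem MuForm.not_positiveIn_of_hasLit {φ : MuForm L} (hφ : φ.IsMuL F) {q : ℕ}
    (h : φ.block.HasLit (false, q)) : ¬ φ.PositiveIn q := by
  induction φ with
  | atom q' =>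
    rcases h with h | ⟨j, s, hj, h⟩
    · simp [block, TransTerm.lits] at h
    · simp [block] at hj
  | natom q' =>
    rcases h with h | ⟨j, s, hj, h⟩
    · simp only [block, TransTerm.lits, Set.mem_singleton_iff, Prod.mk.injEq, true_and] at h
      exact fun hn => hn h.symm
    · simp [block] at hj
  | or φ ψ ih1 ih2 | and φ ψ ih1 ih2 =>
    rcases HasLit.of_bin h with h | h
    · exact fun hn => ih1 hφ.1 h hn.1
    · exact fun hn => ih2 hφ.2 h hn.2
  | nxt α φ ih =>
    rcases h with h | ⟨j, s, hj, h⟩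
    · exact h.elim
    · obtain ⟨b, hb, h⟩ := HasLit.of_cat hj h
      obtain ⟨i, rfl⟩ := List.mem_ofFn.1 hb
      exact fun hn => ih i (hφ.2 i) h (hn i)
  | mu p φ ih | nu p φ ih =>
    have h' := ih hφ.2 (HasLit.of_fix rfl h)
    rintro (rfl | hn)
    · exact h' hφ.1
    · exact h' hn

/-- A formula is realized by its block, for both polarities. -/
theorem MuForm.realizes_block {φ : MuForm L} (hφ : φ.IsMuL F) (pol : Bool) (R : T → T → Prop)
    (ρ : ℕ → Set T) : Realizes pol R ρ φ.block (polExt pol R ρ φ) := by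
  induction φ generalizing ρ with
  | atom q =>
    refine ⟨fun _ => ∅, fun _ _ _ => 0, ⟨fun _ _ _ _ => rfl, fun _ _ _ _ h => h.elim⟩, ?_⟩
    cases pol <;> simp [polExt, ext, block, tsem]
  | natom q =>
    refine ⟨fun _ => ∅, fun _ _ _ => 0, ⟨fun _ _ _ _ => rfl, fun _ _ _ _ h => h.elim⟩, ?_⟩
    cases pol <;> simp [polExt, ext, block, tsem]
  | or φ ψ ih1 ih2 =>
    rw [polExt_or]
    exact (ih1 hφ.1 ρ).bin true (block_wf hφ.1) (block_wf hφ.2) (ih2 hφ.2 ρ)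
  | and φ ψ ih1 ih2 =>
    rw [polExt_and]
    exact (ih1 hφ.1 ρ).bin false (block_wf hφ.1) (block_wf hφ.2) (ih2 hφ.2 ρ)
  | nxt α φ ih =>
    have h := Realizes.next hφ.1 (fun i => block_wf (hφ.2 i)) fun i => ih i (hφ.2 i) ρ
    refine (congrArg (Realizes pol R ρ _) ?_).mpr h
    cases pol <;> ext s <;> simp [polExt, ext]
  | mu p φ ih =>
    have hn : ∀ x, φ.block.HasLit x → x ≠ (false, p) := by
      rintro x hx rfl
      exact not_positiveIn_of_hasLit hφ.2 hx hφ.1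
    have hwf := block_wf hφ.2
    have h1 : (false, p) ∉ φ.block.head.lits := fun h => hn _ (Or.inl h) rfl
    have h2 : ∀ (j : ℕ) (s : State (TransTerm L)), φ.block.tail[j]? = some s →
        (false, p) ∉ s.term.lits := fun j s hj h => hn _ (Or.inr ⟨j, s, hj, h⟩) rfl
    rw [polExt_mu]
    cases pol
    · exact Realizes.fix_greatest hwf h1 h2 (polExt_mono hφ.2 hφ.1 ρ) fun X => ih hφ.2 _
    · exact Realizes.fix_least hwf h1 h2 (polExt_mono hφ.2 hφ.1 ρ) fun X => ih hφ.2 _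
  | nu p φ ih =>
    have hn : ∀ x, φ.block.HasLit x → x ≠ (false, p) := by
      rintro x hx rfl
      exact not_positiveIn_of_hasLit hφ.2 hx hφ.1
    have hwf := block_wf hφ.2
    have h1 : (false, p) ∉ φ.block.head.lits := fun h => hn _ (Or.inl h) rfl
    have h2 : ∀ (j : ℕ) (s : State (TransTerm L)), φ.block.tail[j]? = some s →
        (false, p) ∉ s.term.lits := fun j s hj h => hn _ (Or.inr ⟨j, s, hj, h⟩) rfl
    rw [polExt_nu]
    cases pol
    · exact Realizes.fix_least hwf h1 h2 (polExt_mono hφ.2 hφ.1 ρ) fun X => ih hφ.2 _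
    · exact Realizes.fix_greatest hwf h1 h2 (polExt_mono hφ.2 hφ.1 ρ) fun X => ih hφ.2 _

end

section

open Block

/-! ### Syntactic restrictions on fixpoints -/

variable {L : OneStepLanguage.{u, w}} {F : L.Fragments}

/-- A common form of the four syntactic restrictions: only fixpoint operators of kind `d` may
bind a variable on which `Q` depends, and `G α B` constrains the modalities `α` in which the
variables from `Q` may occur in the argument places from `B`. -/
inductive FixRestr (d : Bool) (G : ∀ n : ℕ, L.Form n → Set (Fin n) → Prop) :
    Set ℕ → MuForm L → Prop
  | var {Q : Set ℕ} {q : ℕ} : q ∈ Q → FixRestr d G Q (.atom q)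
  | free {Q : Set ℕ} {ψ : MuForm L} : ψ.FreeOf Q → FixRestr d G Q ψ
  | or {Q : Set ℕ} {φ ψ : MuForm L} : FixRestr d G Q φ → FixRestr d G Q ψ →
      FixRestr d G Q (.or φ ψ)
  | and {Q : Set ℕ} {φ ψ : MuForm L} : FixRestr d G Q φ → FixRestr d G Q ψ →
      FixRestr d G Q (.and φ ψ)
  | nxt {Q : Set ℕ} {n : ℕ} {α : L.Form n} {φ : Fin n → MuForm L} (B : Set (Fin n)) :
      G n α B → (∀ i ∈ B, FixRestr d G Q (φ i)) → (∀ i ∉ B, (φ i).FreeOf Q) →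
        FixRestr d G Q (.nxt α φ)
  | mu {Q : Set ℕ} {p : ℕ} {φ : MuForm L} : d = true → FixRestr d G (Q ∪ {p}) φ →
      FixRestr d G Q (.mu p φ)
  | nu {Q : Set ℕ} {p : ℕ} {φ : MuForm L} : d = false → FixRestr d G (Q ∪ {p}) φ →
      FixRestr d G Q (.nu p φ)

/-- The fragment `Con_B` for `d = true`, and `Cocon_B` for `d = false`. -/
def OneStepLanguage.Fragments.contFrag (F : L.Fragments) (d : Bool) (n : ℕ) (α : L.Form n)
    (B : Set (Fin n)) : Prop := if d = true then α ∈ F.cont B else α ∈ F.cocont B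

theorem MuForm.Noe.fixRestr {Q : Set ℕ} {φ : MuForm L} (h : φ.Noe Q) :
    FixRestr true (fun _ _ _ => True) Q φ := by
  induction h with
  | var h => exact .var h
  | free h => exact .free h
  | or _ _ h1 h2 => exact .or h1 h2
  | and _ _ h1 h2 => exact .and h1 h2
  | nxt _ h => exact .nxt Set.univ trivial (fun i _ => h i) fun i hi => (hi trivial).elim
  | mu _ h => exact .mu rfl h

theorem MuForm.CoNoe.fixRestr {Q : Set ℕ} {φ : MuForm L} (h : φ.CoNoe Q) :
    FixRestr false (fun _ _ _ => True) Q φ := by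
  induction h with
  | var h => exact .var h
  | free h => exact .free h
  | or _ _ h1 h2 => exact .or h1 h2
  | and _ _ h1 h2 => exact .and h1 h2
  | nxt _ h => exact .nxt Set.univ trivial (fun i _ => h i) fun i hi => (hi trivial).elim
  | nu _ h => exact .nu rfl h

theorem MuForm.Cont.fixRestr {Q : Set ℕ} {φ : MuForm L} (h : φ.Cont F Q) :
    FixRestr true (F.contFrag true) Q φ := by
  induction h with
  | var h => exact .var h
  | free h => exact .free h
  | or _ _ h1 h2 => exact .or h1 h2
  | and _ _ h1 h2 => exact .and h1 h2
  | nxt B hα _ h2 h1 => exact .nxt B hα h1 h2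
  | mu _ h => exact .mu rfl h

theorem MuForm.CoCont.fixRestr {Q : Set ℕ} {φ : MuForm L} (h : φ.CoCont F Q) :
    FixRestr false (F.contFrag false) Q φ := by
  induction h with
  | var h => exact .var h
  | free h => exact .free h
  | or _ _ h1 h2 => exact .or h1 h2
  | and _ _ h1 h2 => exact .and h1 h2
  | nxt B hα _ h2 h1 => exact .nxt B hα h1 h2
  | nu _ h => exact .nu rfl h

section Restr

variable (d : Bool) (G : ∀ n : ℕ, L.Form n → Set (Fin n) → Prop) (Q : Set ℕ)

/-- The modal atom satisfies the constraint `G`, for the argument places that refer to states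
depending on `Q`. -/
def ModRestr (S : List (State (TransTerm L))) (n : ℕ) (α : L.Form n) (f : Fin n → ℕ × ℕ) : Prop :=
  ∃ B : Set (Fin n), G n α B ∧ ∀ i ∉ B, ∀ s', S[(f i).1]? = some s' → ∀ q ∈ s'.dep, q ∉ Q

def StatesRestr (S : List (State (TransTerm L))) : Prop :=
  ∀ (j : ℕ) (s : State (TransTerm L)), S[j]? = some s → (∃ q ∈ s.dep, q ∈ Q) →
    (!d) ∉ s.cls ∧ s.term.AllMod (ModRestr G Q S)

def BlockRestr (b : Block (TransTerm L)) : Prop :=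
  StatesRestr d G Q b.tail ∧ b.head.AllMod (ModRestr G Q b.tail)

variable {d G Q}

theorem StatesRestr.append {S S' : List (State (TransTerm L))} {h : ℕ} (hwf : StatesWF F h S)
    (hS : StatesRestr d G Q S) (hS' : StatesRestr d G Q S') :
    StatesRestr d G Q (S ++ shiftStates (TransTerm.ops L) S.length S') := by
  intro j s hj hq
  rcases append_shift_getElem? hj with hj | ⟨i, s', rfl, hi, rfl⟩
  · obtain ⟨h1, h2⟩ := hS j s hj hq
    refine ⟨h1, (h2.and (hwf.ref_lt hj)).imp ?_⟩
    rintro n α f ⟨⟨B, hB, hB'⟩, -, hf⟩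
    refine ⟨B, hB, fun i hi s' hs' => hB' i hi s' ?_⟩
    rwa [List.getElem?_append_left (hf i)] at hs'
  · obtain ⟨h1, h2⟩ := hS' i s' hi hq
    refine ⟨h1, (TransTerm.allMod_mapRef _ _).2 (h2.imp ?_)⟩
    rintro n α f ⟨B, hB, hB'⟩
    refine ⟨B, hB, fun k hk s'' hs'' => ?_⟩
    rcases append_shift_getElem? hs'' with hlt | ⟨i', t, h3, h4, rfl⟩
    · have := (List.getElem?_eq_some_iff.1 hlt).1
      dsimp only at this
      omega
    · obtain rfl : i' = (f k).1 := by dsimp only at h3; omega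
      exact hB' k hk t h4

theorem BlockRestr.states {b : Block (TransTerm L)} (hb : BlockRestr d G Q b) :
    StatesRestr d G Q (b.states (TransTerm.ops L)) := by
  have key : ∀ {t : TransTerm L}, t.AllMod (ModRestr G Q b.tail) →
      (t.shift 1).AllMod (ModRestr G Q (b.states (TransTerm.ops L))) := by
    intro t ht
    refine (TransTerm.allMod_mapRef _ _).2 (ht.imp ?_)
    rintro n α f ⟨B, hB, hB'⟩
    refine ⟨B, hB, fun k hk s'' hs'' => ?_⟩
    rcases states_cases hs'' with ⟨h, -⟩ | ⟨i, s', h1, h2, rfl⟩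
    · simp at h
    · obtain rfl : (f k).1 = i := by simpa using h1
      exact hB' k hk s' h2
  intro j s hj hq
  rcases states_cases hj with ⟨rfl, rfl⟩ | ⟨i, s', rfl, hi, rfl⟩
  · exact ⟨List.not_mem_nil, key hb.2⟩
  · obtain ⟨h1, h2⟩ := hb.1 i s' hi hq
    exact ⟨h1, key h2⟩

theorem BlockRestr.of_disjoint (hG : ∀ n (α : L.Form n), α ∈ F.pos → G n α ∅)
    {b : Block (TransTerm L)} (hb : BlockWF F b) (h : ∀ q ∈ b.fv, q ∉ Q) :
    BlockRestr d G Q b := by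
  constructor
  · rintro j s hj ⟨q, hq, hqQ⟩
    exact (h q (hb.dep j s hj hq) hqQ).elim
  · exact hb.mods.imp fun n α f hf => ⟨∅, hG n α hf.1, fun i _ s' hs' q hq =>
      h q (hb.dep _ s' hs' hq)⟩

theorem BlockRestr.bin (e : Bool) {b c : Block (TransTerm L)} (hwf : BlockWF F b)
    (hb : BlockRestr d G Q b) (hc : BlockRestr d G Q c) :
    BlockRestr d G Q (Block.bin (TransTerm.ops L) (.bin e) b c) := by
  refine ⟨hb.1.append hwf.tail hc.1, (hb.2.and hwf.mods).imp ?_,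
    (TransTerm.allMod_mapRef _ _).2 (hc.2.imp ?_)⟩
  · rintro n α f ⟨⟨B, hB, hB'⟩, -, hf⟩
    refine ⟨B, hB, fun i hi s' hs' => hB' i hi s' ?_⟩
    obtain ⟨-, t, ht, -⟩ := hf i
    exact (List.getElem?_append_left (List.getElem?_eq_some_iff.1 ht).1).symm.trans hs'
  · rintro n α f ⟨B, hB, hB'⟩
    refine ⟨B, hB, fun k hk s'' hs'' => ?_⟩
    rcases append_shift_getElem? hs'' with hlt | ⟨i', t, h3, h4, rfl⟩
    · have := (List.getElem?_eq_some_iff.1 hlt).1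
      dsimp only at this
      omega
    · obtain rfl : i' = (f k).1 := by dsimp only at h3; omega
      exact hB' k hk t h4

theorem StatesRestr.cat {bs : List (Block (TransTerm L))}
    (hbs : ∀ b ∈ bs, BlockWF F b ∧ BlockRestr d G Q b) :
    StatesRestr d G Q (cat (TransTerm.ops L) bs).1 := by
  induction bs with
  | nil => intro j s h; simp [Block.cat] at h
  | cons b bs ih =>
    obtain ⟨h1, h2⟩ := hbs b List.mem_cons_self
    have h := h2.states.append h1.states (ih fun c hc => hbs c (List.mem_cons_of_mem _ hc))
    rw [states_length] at h
    exact h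

/-- Binding `p`: what depends on `Q` afterwards depended on `Q` or on `p` before. -/
theorem BlockRestr.fix {mu : Bool} {c : TransTerm L} (hc : ∀ Q, c.AllMod Q) {p : ℕ}
    {b : Block (TransTerm L)} (hb : BlockRestr mu G (Q ∪ {p}) b) :
    BlockRestr mu G Q (b.fix (TransTerm.ops L) mu c p) := by
  have key : ∀ {n : ℕ} {α : L.Form n} {f : Fin n → ℕ × ℕ}, ModRestr G (Q ∪ {p}) b.tail n α f →
      ModRestr G Q (b.fix (TransTerm.ops L) mu c p).tail n α f := by
    rintro n α f ⟨B, hB, hB'⟩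
    refine ⟨B, hB, fun i hi s' hs' q hq hqQ => ?_⟩
    obtain ⟨s, hs, ⟨-, rfl⟩ | ⟨hp, -⟩⟩ := fix_tail_cases hs'
    · exact hB' i hi s' hs q hq (Or.inl hqQ)
    · exact hB' i hi s hs p hp (Or.inr rfl)
  have hhead : (b.head.subst p c).AllMod
      (ModRestr G Q (b.fix (TransTerm.ops L) mu c p).tail) :=
    (hb.2.imp fun _ _ _ => key).subst fun _ => hc _
  refine ⟨?_, hhead⟩
  rintro j s hj ⟨q, hq, hqQ⟩
  obtain ⟨s', hj', ⟨hp, rfl⟩ | ⟨hp, rfl⟩⟩ := fix_tail_cases hj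
  · obtain ⟨h1, h2⟩ := hb.1 j s hj' ⟨q, hq, Or.inl hqQ⟩
    exact ⟨h1, h2.imp fun _ _ _ => key⟩
  · obtain ⟨h1, h2⟩ := hb.1 j s' hj' ⟨p, hp, Or.inr rfl⟩
    refine ⟨?_, (h2.imp fun _ _ _ => key).subst fun _ => (TransTerm.allMod_mapRef _ _).2 hhead⟩
    intro hmem
    rcases List.mem_cons.1 hmem with h | h
    · cases mu <;> simp at h
    · obtain ⟨t, ht, h⟩ := List.mem_flatMap.1 h
      obtain ⟨ht, htp⟩ := List.mem_filter.1 ht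
      obtain ⟨i, hi⟩ := List.mem_iff_getElem?.1 ht
      exact (hb.1 i t hi ⟨p, by simpa using htp, Or.inr rfl⟩).1 h

theorem FixRestr.blockRestr (hG : ∀ n (α : L.Form n), α ∈ F.pos → G n α ∅) {φ : MuForm L}
    (hφ : φ.IsMuL F) (h : FixRestr d G Q φ) : BlockRestr d G Q φ.block := by
  induction h with
  | var _ => exact ⟨fun j s h => by simp [MuForm.block] at h, trivial⟩
  | free h =>
    exact .of_disjoint hG (MuForm.block_wf hφ) fun q hq hqQ =>
      Set.disjoint_left.1 h (MuForm.mem_block_fv.1 hq) hqQ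
  | or _ _ h1 h2 => exact .bin true (MuForm.block_wf hφ.1) (h1 hφ.1) (h2 hφ.2)
  | and _ _ h1 h2 => exact .bin false (MuForm.block_wf hφ.1) (h1 hφ.1) (h2 hφ.2)
  | @nxt Q n α φ B hα _ hfree ih =>
    have hwf := fun i => MuForm.block_wf (hφ.2 i)
    have hdisj : ∀ i ∉ B, ∀ q ∈ (φ i).block.fv, q ∉ Q := fun i hi q hq hqQ =>
      Set.disjoint_left.1 (hfree i hi) (MuForm.mem_block_fv.1 hq) hqQ
    refine ⟨StatesRestr.cat (F := F) fun b hb => ?_, B, hα, fun i hi s' hs' => ?_⟩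
    · obtain ⟨i, rfl⟩ := List.mem_ofFn.1 hb
      refine ⟨hwf i, ?_⟩
      by_cases hi : i ∈ B
      · exact ih i hi (hφ.2 i)
      · exact .of_disjoint hG (hwf i) (hdisj i hi)
    · obtain ⟨s, h1, h2, -⟩ := cat_offset (bs := List.ofFn fun i => (φ i).block) (i := i)
        (b := (φ i).block) (by simp)
      obtain rfl : s = s' := Option.some_injective _ (h1.symm.trans hs')
      rw [h2]
      exact hdisj i hi
  | mu hd _ h => subst hd; exact (h hφ.2).fix (TransTerm.allMod_cst _)
  | nu hd _ h => subst hd; exact (h hφ.2).fix (TransTerm.allMod_cst _)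

end Restr

theorem MuForm.Cont.noe {Q : Set ℕ} {φ : MuForm L} (h : φ.Cont F Q) : φ.Noe Q := by
  induction h with
  | var h => exact .var h
  | free h => exact .free h
  | or _ _ h1 h2 => exact .or h1 h2
  | and _ _ h1 h2 => exact .and h1 h2
  | nxt B _ _ h2 h1 =>
    refine .nxt fun i => ?_
    by_cases hi : i ∈ B
    exacts [h1 i hi, .free (h2 i hi)]
  | mu _ h => exact .mu h

theorem MuForm.CoCont.coNoe {Q : Set ℕ} {φ : MuForm L} (h : φ.CoCont F Q) : φ.CoNoe Q := by
  induction h with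
  | var h => exact .var h
  | free h => exact .free h
  | or _ _ h1 h2 => exact .or h1 h2
  | and _ _ h1 h2 => exact .and h1 h2
  | nxt B _ _ h2 h1 =>
    refine .nxt fun i => ?_
    by_cases hi : i ∈ B
    exacts [h1 i hi, .free (h2 i hi)]
  | nu _ h => exact .nu h

theorem MuForm.IsMuC.isMuD {φ : MuForm L} (h : φ.IsMuC F) : φ.IsMuD := by
  induction φ with
  | atom | natom => trivial
  | or φ ψ ih1 ih2 | and φ ψ ih1 ih2 => exact ⟨ih1 h.1, ih2 h.2⟩
  | nxt α φ ih => exact fun i => ih i (h i)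
  | mu p φ ih => exact ⟨ih h.1, h.2.noe⟩
  | nu p φ ih => exact ⟨ih h.1, h.2.coNoe⟩

/-- No class contains fixpoint operators of both kinds; this holds for alternation-free formulas. -/
def BlockMono (b : Block (TransTerm L)) : Prop :=
  ∀ (j : ℕ) (s : State (TransTerm L)), b.tail[j]? = some s → ∀ d, d ∈ s.cls → (!d) ∉ s.cls

theorem cat_forall {P : List ℕ → List Bool → Prop} {bs : List (Block (TransTerm L))}
    (hbs : ∀ b ∈ bs, P b.fv [] ∧ ∀ (j : ℕ) (s : State (TransTerm L)), b.tail[j]? = some s →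
      P s.dep s.cls) {j : ℕ} {s : State (TransTerm L)}
    (hj : (cat (TransTerm.ops L) bs).1[j]? = some s) : P s.dep s.cls := by
  induction bs generalizing j s with
  | nil => simp [cat] at hj
  | cons b bs ih =>
    simp only [cat, ← states_length] at hj
    rcases append_shift_getElem? hj with hj | ⟨i, s', rfl, hi, rfl⟩
    · rcases states_cases hj with ⟨rfl, rfl⟩ | ⟨i, s', rfl, hi, rfl⟩
      · exact (hbs b List.mem_cons_self).1
      · exact (hbs b List.mem_cons_self).2 i s' hi
    · exact (ih (fun c hc => hbs c (List.mem_cons_of_mem _ hc)) hi : P s'.dep s'.cls)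

theorem BlockMono.fix {mu : Bool} {c : TransTerm L} {p : ℕ} {b : Block (TransTerm L)}
    (hb : BlockMono b) (h : BlockRestr mu (fun _ _ _ => True) {p} b) :
    BlockMono (b.fix (TransTerm.ops L) mu c p) := by
  intro j s hj
  obtain ⟨s', hj', ⟨hp, rfl⟩ | ⟨hp, rfl⟩⟩ := fix_tail_cases hj
  · exact hb j s hj'
  · have key : ∀ d ∈ mu :: (b.tail.filter fun s => p ∈ s.dep).flatMap State.cls, d = mu := by
      intro d hd
      rcases List.mem_cons.1 hd with h | hd
      · exact h
      · obtain ⟨t, ht, hd⟩ := List.mem_flatMap.1 hd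
        obtain ⟨ht, htp⟩ := List.mem_filter.1 ht
        obtain ⟨i, hi⟩ := List.mem_iff_getElem?.1 ht
        have hnot := (h.1 i t hi ⟨p, by simpa using htp, rfl⟩).1
        cases d <;> cases mu <;> simp_all
    intro d hd hd'
    have := (key d hd).trans (key _ hd').symm
    cases d <;> simp at this

theorem MuForm.blockMono {φ : MuForm L} (hφ : φ.IsMuL F) (hD : φ.IsMuD) : BlockMono φ.block := by
  induction φ with
  | atom | natom => intro j s h; simp [block] at h
  | or φ ψ ih1 ih2 | and φ ψ ih1 ih2 =>
    intro j s hj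
    rcases append_shift_getElem? hj with hj | ⟨i, s', rfl, hi, rfl⟩
    · exact ih1 hφ.1 hD.1 j s hj
    · exact ih2 hφ.2 hD.2 i s' hi
  | nxt α φ ih =>
    intro j s hj
    refine cat_forall (P := fun _ cls => ∀ d, d ∈ cls → (!d) ∉ cls) ?_ hj
    intro b hb
    obtain ⟨i, rfl⟩ := List.mem_ofFn.1 hb
    exact ⟨by simp, ih i (hφ.2 i) (hD i)⟩
  | mu p φ ih =>
    exact (ih hφ.2 hD.1).fix (hD.2.fixRestr.blockRestr (fun _ _ _ => trivial) hφ.2)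
  | nu p φ ih =>
    exact (ih hφ.2 hD.1).fix (hD.2.fixRestr.blockRestr (fun _ _ _ => trivial) hφ.2)

/-! ### Cluster labels -/

/-- A labelling that does not increase along references and separates clusters; on each of its
levels, the classes of states linked by a reference agree. -/
structure Labelled (h : ℕ) (S : List (State (TransTerm L))) (lab : ℕ → ℕ) : Prop where
  le : ∀ j, lab j ≤ h
  ref : ∀ (j : ℕ) (s : State (TransTerm L)), S[j]? = some s → s.term.AllMod fun _ _ f =>
    ∀ i s', S[(f i).1]? = some s' →
      lab (f i).1 < lab j ∨ (lab (f i).1 = lab j ∧ s'.cls = s.cls)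

/-- In a state whose class contains only fixpoint operators of kind `d`, the modalities are
(co-)continuous in the argument places that refer to states on the same level. -/
def ContStates (F : L.Fragments) (S : List (State (TransTerm L))) (lab : ℕ → ℕ) : Prop :=
  ∀ (j : ℕ) (s : State (TransTerm L)), S[j]? = some s → ∀ d, d ∈ s.cls → (!d) ∉ s.cls →
    s.term.AllMod fun n α f => ∃ B : Set (Fin n), F.contFrag d n α B ∧
      ∀ i ∉ B, lab (f i).1 < lab j

section Labels

variable {h h' : ℕ} {S S' : List (State (TransTerm L))} {lab lab' : ℕ → ℕ}
  {b : Block (TransTerm L)}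

theorem TransTerm.AllMod.of_forall {Q : ∀ n : ℕ, L.Form n → (Fin n → ℕ × ℕ) → Prop}
    (h : ∀ n α f, Q n α f) (t : TransTerm L) : t.AllMod Q := by
  induction t with
  | lit | cst => trivial
  | bin b s t hs ht => exact ⟨hs, ht⟩
  | mod α f => exact h _ _ _

theorem Labelled.append {h₁ : ℕ} (hwf : StatesWF F h₁ S) (hS : Labelled h S lab)
    (hS' : Labelled h' S' lab') {k : ℕ} (hk : h ≤ k) (hk' : h' ≤ k) :
    Labelled k (S ++ shiftStates (TransTerm.ops L) S.length S') (joinFun S.length lab lab') := by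
  constructor
  · intro j
    unfold joinFun
    split_ifs
    exacts [(hS.le j).trans hk, (hS'.le _).trans hk']
  · intro j s hj
    rcases append_shift_getElem? hj with hj | ⟨i, s', rfl, hi, rfl⟩
    · refine ((hS.ref j s hj).and (hwf.ref_lt hj)).imp ?_
      rintro n α f ⟨h1, -, h2⟩ i s' hs'
      rw [List.getElem?_append_left (h2 i)] at hs'
      rw [joinFun_lt _ _ (h2 i), joinFun_lt _ _ (List.getElem?_eq_some_iff.1 hj).1]
      exact h1 i s' hs'
    · refine (TransTerm.allMod_mapRef _ _).2 ((hS'.ref i s' hi).imp ?_)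
      intro n α f h1 k s'' hs''
      rcases append_shift_getElem? hs'' with hlt | ⟨i', t, h3, h4, rfl⟩
      · have := (List.getElem?_eq_some_iff.1 hlt).1
        dsimp only at this
        omega
      · obtain rfl : i' = (f k).1 := by dsimp only at h3; omega
        rw [joinFun_add, joinFun_add]
        exact h1 k t h4

theorem ContStates.append {h₁ : ℕ} (hwf : StatesWF F h₁ S) (hS : ContStates F S lab)
    (hS' : ContStates F S' lab') :
    ContStates F (S ++ shiftStates (TransTerm.ops L) S.length S') (joinFun S.length lab lab') := by
  intro j s hj d hd hd'
  rcases append_shift_getElem? hj with hj | ⟨i, s', rfl, hi, rfl⟩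
  · refine ((hS j s hj d hd hd').and (hwf.ref_lt hj)).imp ?_
    rintro n α f ⟨⟨B, hB, hB'⟩, -, h2⟩
    refine ⟨B, hB, fun i hi => ?_⟩
    rw [joinFun_lt _ _ (h2 i), joinFun_lt _ _ (List.getElem?_eq_some_iff.1 hj).1]
    exact hB' i hi
  · refine (TransTerm.allMod_mapRef _ _).2 ((hS' i s' hi d hd hd').imp ?_)
    rintro n α f ⟨B, hB, hB'⟩
    refine ⟨B, hB, fun k hk => ?_⟩
    rw [joinFun_add, joinFun_add]
    exact hB' k hk

theorem Labelled.states (hb : Labelled h b.tail lab) :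
    Labelled (h + 1) (b.states (TransTerm.ops L)) (consFun (h + 1) lab) := by
  constructor
  · rintro (_ | j)
    exacts [le_rfl, (hb.le j).trans h.le_succ]
  · intro j s hj
    rcases states_cases hj with ⟨rfl, rfl⟩ | ⟨i, s', rfl, hi, rfl⟩
    · refine (TransTerm.allMod_mapRef _ _).2 (.of_forall ?_ _)
      intro n α f i s' _
      exact Or.inl (Nat.lt_succ_of_le (hb.le _))
    · refine (TransTerm.allMod_mapRef _ _).2 ((hb.ref i s' hi).imp ?_)
      intro n α f h1 k s'' hs''
      rw [states_getElem?_succ, Option.map_eq_some_iff] at hs''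
      obtain ⟨t, h2, rfl⟩ := hs''
      exact h1 k t h2

theorem ContStates.states (hb : ContStates F b.tail lab) :
    ContStates F (b.states (TransTerm.ops L)) (consFun (h + 1) lab) := by
  intro j s hj d hd hd'
  rcases states_cases hj with ⟨rfl, rfl⟩ | ⟨i, s', rfl, hi, rfl⟩
  · simp at hd
  · exact (TransTerm.allMod_mapRef _ _).2 (hb i s' hi d hd hd')

theorem exists_labelled_cat {K : Prop} {bs : List (Block (TransTerm L))}
    (hbs : ∀ b ∈ bs, BlockWF F b ∧ ∃ lab, Labelled b.height b.tail lab ∧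
      (K → ContStates F b.tail lab)) :
    ∃ lab, Labelled ((bs.map Block.height).foldr max 0 + 1) (cat (TransTerm.ops L) bs).1 lab ∧
      (K → ContStates F (cat (TransTerm.ops L) bs).1 lab) := by
  induction bs with
  | nil => exact ⟨fun _ => 0, ⟨fun _ => Nat.zero_le _, fun j s h => by simp [cat] at h⟩,
      fun _ j s h => by simp [cat] at h⟩
  | cons b bs ih =>
    obtain ⟨hwf, lab, h1, h2⟩ := hbs b List.mem_cons_self
    obtain ⟨lab', h3, h4⟩ := ih fun c hc => hbs c (List.mem_cons_of_mem _ hc)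
    have h5 := h1.states.append hwf.states h3 (k := ((b :: bs).map Block.height).foldr max 0 + 1)
      (by simp) (by simp)
    have h6 := fun hK => ((h2 hK).states (h := b.height)).append hwf.states (h4 hK)
    rw [states_length] at h5
    simp only [states_length] at h6
    exact ⟨_, h5, h6⟩

/-- At a fixpoint operator, all states that depend on its variable move to a new top level. -/
theorem exists_labelled_fix {K K' : Prop} {mu : Bool} {c : TransTerm L} (hc : ∀ Q, c.AllMod Q)
    {p : ℕ} (hwf : BlockWF F b)
    (hb : ∃ lab, Labelled b.height b.tail lab ∧ (K → ContStates F b.tail lab))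
    (hK : K' → K ∧ BlockRestr mu (F.contFrag mu) {p} b) :
    ∃ lab, Labelled (b.height + 1) (b.fix (TransTerm.ops L) mu c p).tail lab ∧
      (K' → ContStates F (b.fix (TransTerm.ops L) mu c p).tail lab) := by
  classical
  obtain ⟨lab, hlab, hcont⟩ := hb
  let lab' : ℕ → ℕ := fun j => if ∃ s, b.tail[j]? = some s ∧ p ∈ s.dep then b.height + 1 else lab j
  have hpos : ∀ {j : ℕ} {s : State (TransTerm L)}, b.tail[j]? = some s → p ∈ s.dep →
      lab' j = b.height + 1 := fun hj hp => if_pos ⟨_, hj, hp⟩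
  have hneg : ∀ {j : ℕ} {s : State (TransTerm L)}, b.tail[j]? = some s → p ∉ s.dep →
      lab' j = lab j := by
    intro j s hj hp
    refine if_neg ?_
    rintro ⟨s', hj', hp'⟩
    obtain rfl : s = s' := Option.some_injective _ (hj.symm.trans hj')
    exact hp hp'
  -- references from states that do not depend on `p`
  have hkeep : ∀ {j : ℕ} {s : State (TransTerm L)}, b.tail[j]? = some s → p ∉ s.dep →
      s.term.AllMod fun _ _ f => ∀ i, ∃ s', b.tail[(f i).1]? = some s' ∧ p ∉ s'.dep := by
    intro j s hj hp
    refine (hwf.tail.mods j s hj).imp fun n α f hf i => ?_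
    obtain ⟨-, -, -, s', h4, h5⟩ := hf.2 i
    exact ⟨s', h4, fun h => hp (h5 h)⟩
  refine ⟨lab', ⟨fun j => ?_, fun j s hj => ?_⟩, fun hk j s hj d hd hd' => ?_⟩
  · dsimp only [lab']
    split_ifs
    exacts [le_rfl, (hlab.le j).trans (Nat.le_succ _)]
  · obtain ⟨s', hj', ⟨hp, rfl⟩ | ⟨hp, rfl⟩⟩ := fix_tail_cases hj
    · refine ((hlab.ref j s hj').and (hkeep hj' hp)).imp ?_
      rintro n α f ⟨h1, h2⟩ i t ht
      obtain ⟨t', ht', htp⟩ := h2 i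
      obtain ⟨t'', ht'', ⟨-, rfl⟩ | ⟨hp', -⟩⟩ := fix_tail_cases ht
      · rw [hneg ht' htp, hneg hj' hp]
        exact h1 i t ht''
      · obtain rfl : t' = t'' := Option.some_injective _ (ht'.symm.trans ht'')
        exact (htp hp').elim
    · refine .of_forall (fun n α f i t ht => ?_) _
      obtain ⟨t', ht', ⟨htp, rfl⟩ | ⟨htp, rfl⟩⟩ := fix_tail_cases ht
      · rw [hneg ht' htp, hpos hj' hp]
        exact Or.inl (Nat.lt_succ_of_le (hlab.le _))
      · rw [hpos ht' htp, hpos hj' hp]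
        exact Or.inr ⟨rfl, rfl⟩
  · obtain ⟨hK, hr⟩ := hK hk
    obtain ⟨s', hj', ⟨hp, rfl⟩ | ⟨hp, rfl⟩⟩ := fix_tail_cases hj
    · refine ((hcont hK j s hj' d hd hd').and (hkeep hj' hp)).imp ?_
      rintro n α f ⟨⟨B, hB, hB'⟩, h2⟩
      refine ⟨B, hB, fun i hi => ?_⟩
      obtain ⟨t', ht', htp⟩ := h2 i
      rw [hneg ht' htp, hneg hj' hp]
      exact hB' i hi
    · obtain rfl : d = mu := by
        by_contra hne
        refine hd' (List.mem_cons.2 (Or.inl ?_))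
        cases d <;> cases mu <;> simp_all
      have key : ∀ {n : ℕ} {α : L.Form n} {f : Fin n → ℕ × ℕ},
          ModRestr (F.contFrag d) {p} b.tail n α f → 
          ∃ B : Set (Fin n), F.contFrag d n α B ∧ ∀ i ∉ B, lab' (f i).1 < lab' j := by
        rintro n α f ⟨B, hB, hB'⟩
        refine ⟨B, hB, fun i hi => ?_⟩
        rw [hpos hj' hp]
        refine Nat.lt_succ_of_le ((if_neg ?_).trans_le (hlab.le (f i).1))
        rintro ⟨t, ht, htp⟩
        exact hB' i hi t ht p htp rfl
      exact ((hr.1 j s' hj' ⟨p, hp, rfl⟩).2.imp fun _ _ _ => key).subst fun _ =>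
        (TransTerm.allMod_mapRef _ _).2 (((hr.2).imp fun _ _ _ => key).subst fun _ => hc _)

end Labels

theorem OneStepLanguage.Fragments.contFrag_empty {d : Bool} {n : ℕ} {α : L.Form n}
    (hα : α ∈ F.pos) : F.contFrag d n α ∅ := by
  unfold contFrag
  split_ifs
  · exact F.cont_of_disjoint _ _ hα (Set.disjoint_empty _)
  · exact F.cocont_of_disjoint _ _ hα (Set.disjoint_empty _)

theorem MuForm.exists_labelled {φ : MuForm L} (hφ : φ.IsMuL F) :
    ∃ lab, Labelled φ.block.height φ.block.tail lab ∧
      (φ.IsMuC F → ContStates F φ.block.tail lab) := by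
  induction φ with
  | atom | natom => exact ⟨fun _ => 0, ⟨fun _ => le_rfl, fun j s h => by simp [block] at h⟩,
      fun _ j s h => by simp [block] at h⟩
  | or φ ψ ih1 ih2 | and φ ψ ih1 ih2 =>
    obtain ⟨lab, h1, h2⟩ := ih1 hφ.1
    obtain ⟨lab', h3, h4⟩ := ih2 hφ.2
    exact ⟨_, h1.append (block_wf hφ.1).tail h3 (le_max_left _ _) (le_max_right _ _),
      fun h => (h2 h.1).append (block_wf hφ.1).tail (h4 h.2)⟩
  | nxt α φ ih =>
    refine exists_labelled_cat fun b hb => ?_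
    obtain ⟨i, rfl⟩ := List.mem_ofFn.1 hb
    obtain ⟨lab, h1, h2⟩ := ih i (hφ.2 i)
    exact ⟨block_wf (hφ.2 i), lab, h1, fun h => h2 (h i)⟩
  | mu p φ ih =>
    exact exists_labelled_fix (TransTerm.allMod_cst _) (block_wf hφ.2) (ih hφ.2) fun h =>
      ⟨h.1, h.2.fixRestr.blockRestr (fun _ _ => F.contFrag_empty) hφ.2⟩
  | nu p φ ih =>
    exact exists_labelled_fix (TransTerm.allMod_cst _) (block_wf hφ.2) (ih hφ.2) fun h =>
      ⟨h.1, h.2.fixRestr.blockRestr (fun _ _ => F.contFrag_empty) hφ.2⟩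

end

section

open Block Filter

/-! ### The automaton of a block -/

variable {L : OneStepLanguage.{u, w}} {F : L.Fragments}

/-- The state with number `x.1` and tag `x.2`, for tags below `K`. -/
def refIndex {N : ℕ} (hN : 0 < N) (K : ℕ) (x : ℕ × ℕ) : Fin N :=
  ⟨(x.1 * K + x.2) % N, Nat.mod_lt _ hN⟩

/-- The one-step formula of a transition term at a point of colour `c`. -/
def TransTerm.compile (C : L.Closed F) {N : ℕ} (hN : 0 < N) (K : ℕ) (c : Finset ℕ) :
    TransTerm L → L.Form N
  | lit b q => if decide (q ∈ c) = b then C.top N else C.bot N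
  | cst b => if b = true then C.top N else C.bot N
  | bin b s t => if b = true then C.disj (compile C hN K c s) (compile C hN K c t)
      else C.conj (compile C hN K c s) (compile C hN K c t)
  | mod α f => L.rename (fun i => refIndex hN K (f i)) α

/-- The priority of a state: `1` or `0` if only `μ`s or only `ν`s belong to its class, and its tag
otherwise. -/
def statePrio (cls : List Bool) (m : ℕ) : ℕ :=
  if true ∈ cls then if false ∈ cls then m else 1 else 0

namespace Block

variable {τ : Type*} (o : TermOps τ)

/-- The number of tags: `0` and the tags of the fixpoint operators. -/
def numTags (b : Block τ) : ℕ := 2 * b.height + 1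

/-- The number of states of the automaton; the head counts as a state, and each state occurs with
every tag. -/
def size (b : Block τ) : ℕ := (b.tail.length + 1) * b.numTags

/-- The state with number `j`, where `d` is a default value for its term. -/
def stateAt (d : τ) (b : Block τ) (j : ℕ) : State τ := (b.states o).getD j ⟨d, [], []⟩

theorem numTags_pos (b : Block τ) : 0 < b.numTags := Nat.succ_pos _

theorem size_pos (b : Block τ) : 0 < b.size := Nat.mul_pos (Nat.succ_pos _) b.numTags_pos

end Block

theorem TransTerm.compile_pos (C : L.Closed F) {N : ℕ} (hN : 0 < N) (K : ℕ) (c : Finset ℕ)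
    {t : TransTerm L} (ht : t.AllMod fun _ α _ => α ∈ F.pos) : t.compile C hN K c ∈ F.pos := by
  induction t with
  | lit b q => unfold compile; split_ifs; exacts [C.pos_top _, C.pos_bot _]
  | cst b => unfold compile; split_ifs; exacts [C.pos_top _, C.pos_bot _]
  | bin b s t hs ht' =>
    unfold compile
    split_ifs
    exacts [C.pos_disj _ _ (hs ht.1) (ht' ht.2), C.pos_conj _ _ (hs ht.1) (ht' ht.2)]
  | mod α f => exact F.pos_rename _ _ ht

/-- Transition formulas are (co-)continuous in `M` if their modal atoms are so up to renaming. -/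
theorem TransTerm.compile_contFrag (C : L.Closed F) {N : ℕ} (hN : 0 < N) (K : ℕ) (c : Finset ℕ)
    {d : Bool} {M : Set (Fin N)} {t : TransTerm L} (ht : t.AllMod fun n α f =>
      ∃ B : Set (Fin n), F.contFrag d n α B ∧ ∀ i ∉ B, refIndex hN K (f i) ∉ M) :
    F.contFrag d N (t.compile C hN K c) M := by
  have htop : F.contFrag d N (C.top N) M := by
    cases d
    · exact F.cocont_of_disjoint _ _ (C.pos_top N) (by simp [C.occ_top])
    · exact F.cont_of_disjoint _ _ (C.pos_top N) (by simp [C.occ_top])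
  have hbot : F.contFrag d N (C.bot N) M := by
    cases d
    · exact F.cocont_of_disjoint _ _ (C.pos_bot N) (by simp [C.occ_bot])
    · exact F.cont_of_disjoint _ _ (C.pos_bot N) (by simp [C.occ_bot])
  induction t with
  | lit b q => unfold compile; split_ifs; exacts [htop, hbot]
  | cst b => unfold compile; split_ifs; exacts [htop, hbot]
  | bin b s t hs ht' =>
    have h1 := hs ht.1
    have h2 := ht' ht.2
    unfold compile
    cases d <;> split_ifs
    exacts [C.cocont_disj _ _ _ h1 h2, C.cocont_conj _ _ _ h1 h2, C.cont_disj _ _ _ h1 h2,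
      C.cont_conj _ _ _ h1 h2]
  | mod α f =>
    obtain ⟨B, hB, hB'⟩ := ht
    have hsub : (fun i => refIndex hN K (f i)) ⁻¹' M ⊆ B := fun i hi => by
      by_contra h
      exact hB' i h hi
    cases d
    · exact F.cocont_rename _ _ _ _ hsub hB
    · exact F.cont_rename _ _ _ _ hsub hB

theorem TransTerm.occ_compile (C : L.Closed F) {N : ℕ} (hN : 0 < N) (K : ℕ) (c : Finset ℕ)
    {t : TransTerm L} {Q : ℕ × ℕ → Prop} (ht : t.AllMod fun _ _ f => ∀ i, Q (f i)) {a : Fin N}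
    (ha : a ∈ L.occ (t.compile C hN K c)) : ∃ x, Q x ∧ a = refIndex hN K x := by
  induction t with
  | lit b q => unfold compile at ha; split_ifs at ha <;> simp [C.occ_top, C.occ_bot] at ha
  | cst b => unfold compile at ha; split_ifs at ha <;> simp [C.occ_top, C.occ_bot] at ha
  | bin b s t hs ht' =>
    unfold compile at ha
    split_ifs at ha
    · exact (C.occ_disj _ _ ha).elim (hs ht.1) (ht' ht.2)
    · exact (C.occ_conj _ _ ha).elim (hs ht.1) (ht' ht.2)
  | mod α f =>
    obtain ⟨i, -, rfl⟩ := L.occ_rename _ _ ha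
    exact ⟨f i, ht i, rfl⟩

section Sat

variable {T : Type u} {R : T → T → Prop} {s : T} {N : ℕ} (hN : 0 < N) (K : ℕ)
  {c : Finset ℕ} (C : L.Closed F) {ρ : ℕ → Set T} {U : ℕ × ℕ → Set T}
  {V : Fin N → Set {t : T // R s t}}

theorem TransTerm.sat_compile {t : TransTerm L} (hρ : ∀ q, s ∈ ρ q ↔ q ∈ c)
    (hU : t.AllMod fun _ _ f => ∀ i x, x ∈ V (refIndex hN K (f i)) ↔ x.1 ∈ U (f i)) :
    L.sat V (t.compile C hN K c) ↔ s ∈ tsem true R ρ U t := by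
  induction t with
  | lit b q =>
    by_cases hq : q ∈ c <;> cases b <;> simp [compile, tsem, hq, C.sat_top, C.sat_bot, hρ]
  | cst b => cases b <;> simp [compile, tsem, C.sat_top, C.sat_bot]
  | bin b t t' h1 h2 =>
    cases b <;> simp [compile, tsem, C.sat_conj, C.sat_disj, h1 hU.1, h2 hU.2]
  | mod α f =>
    simp only [compile, tsem, L.sat_rename, if_true, Set.mem_ofPred_eq]
    exact iff_of_eq (congrArg (fun V => L.sat V α) (funext fun i => Set.ext fun x => hU i x))

theorem TransTerm.sat_compile_dual {t : TransTerm L} (hρ : ∀ q, s ∈ ρ q ↔ q ∉ c)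
    (hU : t.AllMod fun _ _ f => ∀ i x, x ∈ V (refIndex hN K (f i)) ↔ x.1 ∉ U (f i)) :
    L.sat V (t.compile C hN K c) ↔ s ∉ tsem false R ρ U t := by
  induction t with
  | lit b q =>
    by_cases hq : q ∈ c <;> cases b <;> simp [compile, tsem, hq, C.sat_top, C.sat_bot, hρ]
  | cst b => cases b <;> simp [compile, tsem, C.sat_top, C.sat_bot]
  | bin b t t' h1 h2 =>
    cases b <;> simp [compile, tsem, C.sat_conj, C.sat_disj, h1 hU.1, h2 hU.2]
    tauto
  | mod α f =>
    simp only [compile, tsem, L.sat_rename, Bool.false_eq_true, if_false, Set.mem_ofPred_eq,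
      not_not]
    exact iff_of_eq (congrArg (fun V => L.sat V α) (funext fun i => Set.ext fun x => hU i x))

end Sat

theorem Block.div_lt (b : Block (TransTerm L)) (a : Fin b.size) :
    a.1 / b.numTags < b.tail.length + 1 := Nat.div_lt_of_lt_mul (by
      rw [Nat.mul_comm]; exact a.2)

/-- The state with number `j` of a block of transition terms. -/
abbrev Block.termState (b : Block (TransTerm L)) (j : ℕ) : State (TransTerm L) :=
  b.stateAt (TransTerm.ops L) (.cst true) j

theorem Block.states_getElem?_div (b : Block (TransTerm L)) (a : Fin b.size) :
    (b.states (TransTerm.ops L))[a.1 / b.numTags]? = some (b.termState (a.1 / b.numTags)) := by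
  have h := b.div_lt a
  rw [← states_length] at h
  simp [termState, stateAt, List.getD_eq_getElem?_getD, List.getElem?_eq_getElem h]

/-- The automaton of a block.  The state with number `j` and tag `m` is `j * numTags + m`. -/
def Block.toAutomaton (C : L.Closed F) (P : Finset ℕ) (b : Block (TransTerm L))
    (hb : BlockWF F b) : ParityAutomaton F P where
  size := b.size
  trans a c := (b.termState (a.1 / b.numTags)).term.compile C b.size_pos b.numTags c.1
  trans_pos a _ := TransTerm.compile_pos C _ _ _
    ((hb.states.mods _ _ (b.states_getElem?_div a)).imp fun _ _ _ h => h.1)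
  prio a := statePrio (b.termState (a.1 / b.numTags)).cls (a.1 % b.numTags)
  init := ⟨0, b.size_pos⟩

theorem RefOK.refIndex_eq {b : Block (TransTerm L)} {j : ℕ} {s : State (TransTerm L)} {x : ℕ × ℕ}
    (hx : RefOK b.height (b.states (TransTerm.ops L)) j s x) :
    ((refIndex b.size_pos b.numTags x).1 / b.numTags,
      (refIndex b.size_pos b.numTags x).1 % b.numTags) = x := by
  obtain ⟨h1, -, -, s', h4, -⟩ := hx
  have h5 := (List.getElem?_eq_some_iff.1 h4).1
  rw [states_length] at h5
  have h6 : x.2 < b.numTags := by unfold numTags; omega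
  have h7 : x.1 * b.numTags + x.2 < b.size := calc
    x.1 * b.numTags + x.2 < (x.1 + 1) * b.numTags := by rw [Nat.succ_mul]; omega
    _ ≤ b.size := Nat.mul_le_mul_right _ h5
  refine Prod.ext ?_ ?_
  · simp only [refIndex, Nat.mod_eq_of_lt h7]
    rw [Nat.add_comm, Nat.add_mul_div_right _ _ b.numTags_pos, Nat.div_eq_of_lt h6, Nat.zero_add]
  · simp only [refIndex, Nat.mod_eq_of_lt h7]
    rw [Nat.add_comm, Nat.add_mul_mod_self_right, Nat.mod_eq_of_lt h6]

section Automaton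

variable (C : L.Closed F) {P : Finset ℕ} {b : Block (TransTerm L)} (hb : BlockWF F b)

/-- Any property of references is a property of transitions. -/
theorem Block.ref_of_occ {Q : ℕ × ℕ → Prop} {a a' : Fin b.size} {c : P.powerset}
    (hQ : (b.termState (a.1 / b.numTags)).term.AllMod fun _ _ f => ∀ i, Q (f i))
    (h : a' ∈ L.occ ((b.toAutomaton C P hb).trans a c)) :
    Q (a'.1 / b.numTags, a'.1 % b.numTags) ∧
      RefOK b.height (b.states (TransTerm.ops L)) (a.1 / b.numTags)
        (b.termState (a.1 / b.numTags)) (a'.1 / b.numTags, a'.1 % b.numTags) := by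
  have hm := hb.states.mods _ _ (b.states_getElem?_div a)
  obtain ⟨x, ⟨hx, hx'⟩, rfl⟩ := TransTerm.occ_compile C b.size_pos b.numTags c.1
    (Q := fun x => Q x ∧ RefOK b.height (b.states (TransTerm.ops L)) (a.1 / b.numTags)
        (b.termState (a.1 / b.numTags)) x) ((hQ.and hm).imp fun _ _ _ h i => ⟨h.1 i, h.2.2 i⟩) h
  rw [hx'.refIndex_eq]
  exact ⟨hx, hx'⟩

end Automaton

/-! ### Priorities on infinite paths -/

theorem exists_frequently_eq {p : ℕ → ℕ} {B : ℕ} (h : ∀ i, p i ≤ B) :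
    ∃ M, (∃ᶠ i in atTop, p i = M) ∧ ∀ᶠ i in atTop, p i ≤ M := by
  classical
  have hex : ∃ M, ∀ᶠ i in atTop, p i ≤ M := ⟨B, Eventually.of_forall h⟩
  refine ⟨Nat.find hex, fun hn => ?_, Nat.find_spec hex⟩
  have hlt : ∀ᶠ i in atTop, p i < Nat.find hex := by
    filter_upwards [hn, Nat.find_spec hex] with i h1 h2
    exact lt_of_le_of_ne h2 h1
  obtain ⟨i, hi⟩ := hlt.exists
  refine Nat.find_min hex (m := Nat.find hex - 1) (by omega) ?_
  filter_upwards [hlt] with i hi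
  omega

/-- On an infinite path along references that follows a progress measure, the maximal priority
that occurs infinitely often is even for Éloise's measures and odd for Abelard's. -/
theorem path_parity {pol : Bool} {h N : ℕ} {S : List (State (TransTerm L))} {lab : ℕ → ℕ}
    {x : ℕ → ℕ × ℕ} {s : ℕ → State (TransTerm L)}
    (href : ∀ i, RefOK h S (x i).1 (s i) (x (i + 1)))
    (hlab : ∀ i, lab (x (i + 1)).1 < lab (x i).1 ∨
      (lab (x (i + 1)).1 = lab (x i).1 ∧ (s (i + 1)).cls = (s i).cls))
    {r : ℕ → ℕ → Ordinal.{u}} (hz : ∀ i, ∀ k > N, r i k = 0)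
    (hr : ∀ i, LexLE (x (i + 1)).2 (r (i + 1)) (r i) ∧ ((x (i + 1)).2 ≠ 0 →
      (x (i + 1)).2.bodd = pol → LexLT (x (i + 1)).2 (r (i + 1)) (r i))) :
    ∃ M : ℕ, M.bodd = !pol ∧ (∃ᶠ i in atTop, statePrio (s i).cls (x i).2 = M) ∧
      ∀ᶠ i in atTop, statePrio (s i).cls (x i).2 ≤ M := by
  obtain ⟨M, hM, hM'⟩ := exists_frequently_eq (p := fun i => (x (i + 1)).2) (B := 2 * h)
    fun i => (href i).1
  obtain ⟨n, hn⟩ := eventually_atTop.1 hM'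
  -- untagged references lead to larger numbers
  have hM0 : M ≠ 0 := by
    rintro rfl
    have hlt : ∀ i, n ≤ i → (x i).1 < (x (i + 1)).1 := fun i hi =>
      (href i).2.1 (by have := hn i hi; omega)
    have hge : ∀ k, k ≤ (x (n + k)).1 := by
      intro k
      induction k with
      | zero => exact Nat.zero_le _
      | succ k ih => exact Nat.succ_le_of_lt (ih.trans_lt (hlt (n + k) (by omega)))
    obtain ⟨-, -, -, s', h4, -⟩ := href (n + S.length)
    have h5 := (List.getElem?_eq_some_iff.1 h4).1
    have h6 := hge (S.length + 1)
    rw [← Nat.add_assoc] at h6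
    omega
  -- the maximal tag occurring infinitely often is not one at which signatures decrease
  have hMpol : M.bodd = !pol := by
    by_contra hne
    have hne : M.bodd = pol := by cases pol <;> cases hb : M.bodd <;> simp_all
    obtain ⟨i₀, hi₀⟩ := eventually_not_lexLT (m := M) (r := fun i => r (n + i))
      (fun i => hz (n + i)) fun i => (hr (n + i)).1.weaken (hn (n + i) (by omega))
    obtain ⟨i, hi, hiM⟩ := frequently_atTop.1 hM (n + i₀)
    obtain ⟨e, rfl⟩ : ∃ e, i = n + e := ⟨i - n, by omega⟩
    refine hi₀ e (by omega) ?_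
    have := (hr (n + e)).2
    rw [hiM] at this
    exact this hM0 hne
  -- labels, and hence classes, are eventually constant
  obtain ⟨n', hn'⟩ : ∃ n', ∀ i ≥ n', (s (i + 1)).cls = (s i).cls := by
    have hanti : Antitone fun i => lab (x i).1 :=
      antitone_nat_of_succ_le fun i => (hlab i).elim le_of_lt fun h => h.1.le
    obtain ⟨n', hn'⟩ := Nat.sInf_mem (Set.range_nonempty fun i => lab (x i).1)
    refine ⟨n', fun i hi => ((hlab i).resolve_left fun hlt => ?_).2⟩
    have h1 : lab (x n').1 ≤ lab (x (i + 1)).1 := hn'.trans_le (Nat.sInf_le ⟨i + 1, rfl⟩)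
    have h2 : lab (x i).1 ≤ lab (x n').1 := hanti hi
    omega
  have hcls : ∀ i ≥ n', (s i).cls = (s n').cls := by
    intro i hi
    induction i, hi using Nat.le_induction with
    | base => rfl
    | succ i hi ih => rw [hn' i hi, ih]
  have hev : ∀ᶠ i in atTop, (s i).cls = (s n').cls := eventually_atTop.2 ⟨n', hcls⟩
  have hmem : M.bodd ∈ (s n').cls := by
    obtain ⟨i, hi, hiM⟩ := frequently_atTop.1 hM n'
    have h3 := (href i).2.2.1
    rw [hiM, hcls i hi] at h3
    exact h3 hM0
  have hMx : ∃ᶠ i in atTop, (x i).2 = M := by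
    refine frequently_atTop.2 fun a => ?_
    obtain ⟨i, hi, hiM⟩ := frequently_atTop.1 hM a
    exact ⟨i + 1, by omega, hiM⟩
  have hMx' : ∀ᶠ i in atTop, (x i).2 ≤ M := by
    refine eventually_atTop.2 ⟨n + 1, fun i hi => ?_⟩
    obtain ⟨e, rfl⟩ : ∃ e, i = e + 1 := ⟨i - 1, by omega⟩
    exact hn e (by omega)
  by_cases h1 : true ∈ (s n').cls
  · by_cases h2 : false ∈ (s n').cls
    · refine ⟨M, hMpol, (hMx.and_eventually hev).mono ?_, (hMx'.and hev).mono ?_⟩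
      · rintro i ⟨h3, h4⟩
        simp [statePrio, h4, h1, h2, h3]
      · rintro i ⟨h3, h4⟩
        simp [statePrio, h4, h1, h2, h3]
    · have hc : ∀ᶠ i in atTop, statePrio (s i).cls (x i).2 = 1 :=
        hev.mono fun i h4 => by simp [statePrio, h4, h1, h2]
      have hpol : pol = false := by
        cases pol
        · rfl
        · rw [hMpol] at hmem; exact (h2 hmem).elim
      exact ⟨1, by simp [hpol], hc.frequently, hc.mono fun i => le_of_eq⟩
  · have hc : ∀ᶠ i in atTop, statePrio (s i).cls (x i).2 = 0 :=
      hev.mono fun i h4 => by simp [statePrio, h4, h1]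
    have hpol : pol = true := by
      cases pol
      · rw [hMpol] at hmem; exact (h1 hmem).elim
      · rfl
    exact ⟨0, by simp [hpol], hc.frequently, hc.mono fun i => le_of_eq⟩

/-! ### The acceptance game -/

namespace BoardGame

variable {G : BoardGame.{u}} {f : List G.Pos → G.Pos} {x : G.Pos}

theorem IsFiniteMatch.concat {π : List G.Pos} {y z : G.Pos} (h : G.IsFiniteMatch f x π)
    (hy : π.getLast? = some y) (hE : G.E y z) (hz : y ∈ G.eloise → z = f π) :
    G.IsFiniteMatch f x (π ++ [z]) := by
  have hne : π ≠ [] := by rintro rfl; simp at hy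
  refine ⟨by rw [List.head?_append, h.1]; rfl, fun i hi => ?_⟩
  rw [List.length_append, List.length_singleton] at hi
  by_cases hi' : i + 1 < π.length
  · have := h.2 i hi'
    rw [List.getElem_append_left (by omega), List.getElem_append_left hi',
      List.take_append_of_le_length (by omega)]
    exact this
  · have hlen : π.length = i + 1 := by omega
    have hlast : π[i] = y := by
      rw [List.getLast?_eq_getElem?, hlen, Nat.add_sub_cancel,
        List.getElem?_eq_getElem (by omega)] at hy
      exact Option.some_injective _ hy
    rw [List.getElem_append_left (by omega), List.getElem_append_right (by omega), hlast,
      List.take_append_of_le_length (by omega), List.take_of_length_le (by omega)]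
    simpa [hlen] using ⟨hE, hz⟩

/-- A chain of longer and longer finite matches has an infinite match as its limit. -/
theorem exists_infiniteMatch {l : ℕ → List G.Pos} (hl : ∀ n, G.IsFiniteMatch f x (l n))
    (hpre : ∀ n, l n <+: l (n + 1)) (hlen : ∀ n, n < (l n).length) :
    ∃ π, G.IsInfiniteMatch f x π ∧ ∀ n i (h : i < (l n).length), π i = (l n)[i] := by
  have hmono : ∀ {m n}, m ≤ n → l m <+: l n := by
    intro m n h
    induction n, h using Nat.le_induction with
    | base => exact List.prefix_rfl
    | succ n _ ih => exact ih.trans (hpre n)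
  have key : ∀ n i (h : i < (l n).length), (l i)[i]'(hlen i) = (l n)[i] := by
    intro n i h
    rcases le_total i n with hin | hin
    · exact (hmono hin).getElem _
    · exact ((hmono hin).getElem _).symm
  refine ⟨fun i => (l i)[i]'(hlen i), ⟨?_, fun i => ?_⟩, key⟩
  · have := (hl 0).1
    rw [List.head?_eq_getElem?, List.getElem?_eq_getElem (hlen 0)] at this
    exact Option.some_injective _ this
  · have h := (hl (i + 1)).2 i (hlen (i + 1))
    have htake : (List.range (i + 1)).map (fun i => (l i)[i]'(hlen i)) =
        (l (i + 1)).take (i + 1) := by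
      refine List.ext_getElem (by simp [(hlen (i + 1)).le]) fun k h1 h2 => ?_
      rw [List.getElem_map, List.getElem_take, List.getElem_range]
      exact key _ _ _
    rw [htake]
    dsimp only
    rw [key (i + 1) i (by have := hlen (i + 1); omega)]
    exact h

end BoardGame

section Game

variable {P : Finset ℕ} {A : ParityAutomaton F P} {S : LTS.{u} P}

/-- A match of the acceptance game is won if and only if the maximal priority that occurs
infinitely often at its positions for Éloise is even. -/
theorem mem_parityWin_iff {π : ℕ → (A.acceptanceGame S).Pos} {y : ℕ → Fin A.size × S.T}
    (hy : ∀ i, π (2 * i) = Sum.inl (y i)) (hy' : ∀ i, ∃ V, π (2 * i + 1) = Sum.inr V) {M : ℕ}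
    (hM : ∃ᶠ i in atTop, A.prio (y i).1 = M) (hM' : ∀ᶠ i in atTop, A.prio (y i).1 ≤ M) :
    π ∈ (A.acceptanceGame S).Win ↔ Even M := by
  set p : (A.acceptanceGame S).Pos → ℕ := Sum.elim (fun x => A.prio x.1) (fun _ => 0)
  have h1 : ∃ᶠ i in atTop, p (π i) = M := by
    refine frequently_atTop.2 fun a => ?_
    obtain ⟨i, hi, h⟩ := frequently_atTop.1 hM a
    exact ⟨2 * i, by omega, by rw [hy]; exact h⟩
  have h2 : ∀ᶠ i in atTop, p (π i) ≤ M := by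
    obtain ⟨a, ha⟩ := eventually_atTop.1 hM'
    refine eventually_atTop.2 ⟨2 * a, fun i hi => ?_⟩
    rcases Nat.even_or_odd' i with ⟨k, rfl | rfl⟩
    · rw [hy]
      exact ha k (by omega)
    · obtain ⟨V, hV⟩ := hy' k
      rw [hV]
      exact Nat.zero_le _
  have h3 : ∀ k, (∃ᶠ i in atTop, p (π i) = k) → k ≤ M := by
    intro k hk
    obtain ⟨i, rfl, hi⟩ := (hk.and_eventually h2).exists
    exact hi
  constructor
  · rintro ⟨m, hm, hm1, hm2⟩
    rwa [le_antisymm (hm2 M h1) (h3 m hm1)]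
  · exact fun h => ⟨M, h, h1, h3⟩

/-- If Éloise can stay in `W` along `Q`, and all infinite paths along `Q` satisfy the parity
condition, then she wins with a positional strategy. -/
theorem ParityAutomaton.accepts_of_positional {W : Fin A.size → Set S.T}
    {Q : Fin A.size × S.T → Fin A.size × S.T → Prop} (h0 : S.init ∈ W A.init)
    (h1 : ∀ a s, s ∈ W a → L.sat (D := S.Succ s)
      (fun b => {t | t.1 ∈ W b ∧ Q (a, s) (b, t.1)}) (A.trans a (S.colour s)))
    (h2 : ∀ y : ℕ → Fin A.size × S.T, (∀ i, Q (y i) (y (i + 1))) → ∃ M, Even M ∧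
      (∃ᶠ i in atTop, A.prio (y i).1 = M) ∧ ∀ᶠ i in atTop, A.prio (y i).1 ≤ M) :
    A.Accepts S := by
  let V : Fin A.size × S.T → Fin A.size → Set S.T := fun x b =>
    {t | S.R x.2 t ∧ t ∈ W b ∧ Q x (b, t)}
  let f : List (A.acceptanceGame S).Pos → (A.acceptanceGame S).Pos := fun π =>
    match π.getLast? with
    | some (.inl x) => .inr (V x)
    | _ => .inl (A.init, S.init)
  let Good : (A.acceptanceGame S).Pos → Prop := fun x => match x with
    | .inl x => x.2 ∈ W x.1
    | .inr U => ∃ x, x.2 ∈ W x.1 ∧ U = V x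
  have hf : ∀ {π x}, π.getLast? = some (Sum.inl x) → f π = Sum.inr (V x) := by
    intro π x h
    simp only [f, h]
    rfl
  have hstep : ∀ {π : List (A.acceptanceGame S).Pos} {x y : (A.acceptanceGame S).Pos},
      π.getLast? = some x → Good x → (A.acceptanceGame S).E x y →
        (x ∈ (A.acceptanceGame S).eloise → y = f π) → Good y := by
    rintro π (x | U) y hπ hx hE hy
    · rw [hy ⟨x, rfl⟩, hf hπ]
      exact ⟨x, hx, rfl⟩
    · obtain ⟨x, hx, rfl⟩ := hx
      rcases y with ⟨b, t⟩ | U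
      · exact hE.2.1
      · exact hE.elim
  refine ⟨f, fun π y hπ hy hyE => ?_, fun π hπ => ?_⟩
  · have hgood : ∀ i (h : i < π.length), Good π[i] := by
      intro i
      induction i with
      | zero =>
        intro h
        have := hπ.1
        rw [List.head?_eq_getElem?, List.getElem?_eq_getElem h] at this
        rw [Option.some_injective _ this]
        exact h0
      | succ i ih =>
        intro h
        refine hstep (π := π.take (i + 1)) ?_ (ih (by omega)) (hπ.2 i h).1 (hπ.2 i h).2
        rw [List.getLast?_eq_getElem?, List.length_take, min_eq_left (by omega),
          Nat.add_sub_cancel, List.getElem?_take, if_pos (by omega), List.getElem?_eq_getElem]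
    obtain ⟨⟨a, s⟩, rfl⟩ := hyE
    have hne : π ≠ [] := by rintro rfl; simp at hy
    have hg : Good (Sum.inl (a, s)) := by
      have h := hgood (π.length - 1) (by have := List.length_pos_of_ne_nil hne; omega)
      rw [List.getLast?_eq_getElem?, List.getElem?_eq_getElem
        (by have := List.length_pos_of_ne_nil hne; omega)] at hy
      rwa [Option.some_injective _ hy] at h
    rw [hf hy]
    refine ⟨fun b t ht => ht.1, ?_⟩
    refine F.sat_mono (A.trans_pos _ _) (fun b t ht => ?_) (h1 a s hg)
    exact ⟨t.2, ht⟩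
  · have hlast : ∀ i, ((List.range (i + 1)).map π).getLast? = some (π i) := by
      intro i
      simp [List.range_succ]
    have hgood : ∀ i, Good (π i) := by
      intro i
      induction i with
      | zero => rw [hπ.1]; exact h0
      | succ i ih => exact hstep (hlast i) ih (hπ.2 i).1 (hπ.2 i).2
    have hinl : ∀ i, ∃ y, π (2 * i) = Sum.inl y := by
      intro i
      induction i with
      | zero => exact ⟨_, hπ.1⟩
      | succ i ih =>
        obtain ⟨y, hy⟩ := ih
        have h3 := (hπ.2 (2 * i)).2
        rw [hy] at h3
        have h3 := h3 ⟨y, rfl⟩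
        have h4 := hlast (2 * i)
        rw [hy] at h4
        rw [hf h4] at h3
        have h5 := (hπ.2 (2 * i + 1)).1
        rw [h3] at h5
        rw [show 2 * (i + 1) = 2 * i + 1 + 1 by ring]
        rcases hπ' : π (2 * i + 1 + 1) with y' | U
        · exact ⟨y', rfl⟩
        · rw [hπ'] at h5
          exact h5.elim
    choose y hy using hinl
    have hinr : ∀ i, π (2 * i + 1) = Sum.inr (V (y i)) := by
      intro i
      have h3 := (hπ.2 (2 * i)).2
      have h4 := hlast (2 * i)
      rw [hy] at h3 h4
      rw [h3 ⟨_, rfl⟩, hf h4]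
    obtain ⟨M, hM, hM1, hM2⟩ := h2 y fun i => by
      have h5 := (hπ.2 (2 * i + 1)).1
      rw [hinr, show 2 * i + 1 + 1 = 2 * (i + 1) by ring, hy] at h5
      exact h5.2.2
    exact (mem_parityWin_iff hy (fun i => ⟨_, hinr i⟩) hM1 hM2).2 hM

/-- If Abelard can stay in `W` along `Q` whatever Éloise does, and no infinite path along `Q`
satisfies the parity condition, then Éloise has no winning strategy. -/
theorem ParityAutomaton.not_accepts {W : Fin A.size → Set S.T}
    {Q : Fin A.size × S.T → Fin A.size × S.T → Prop} (h0 : S.init ∈ W A.init)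
    (h1 : ∀ a s, s ∈ W a → ∀ V : Fin A.size → Set (S.Succ s), L.sat V (A.trans a (S.colour s)) →
      ∃ b, ∃ t ∈ V b, t.1 ∈ W b ∧ Q (a, s) (b, t.1))
    (h2 : ∀ y : ℕ → Fin A.size × S.T, (∀ i, Q (y i) (y (i + 1))) → ∃ M, ¬ Even M ∧
      (∃ᶠ i in atTop, A.prio (y i).1 = M) ∧ ∀ᶠ i in atTop, A.prio (y i).1 ≤ M) :
    ¬ A.Accepts S := by
  rintro ⟨f, hf, hfw⟩
  -- finite matches that end at a position of `W`
  let pos : Fin A.size × S.T → (A.acceptanceGame S).Pos := Sum.inl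
  let val : (Fin A.size → Set S.T) → (A.acceptanceGame S).Pos := Sum.inr
  let H := {q : List (A.acceptanceGame S).Pos × (Fin A.size × S.T) //
    (A.acceptanceGame S).IsFiniteMatch f (pos (A.init, S.init)) q.1 ∧
      q.1.getLast? = some (pos q.2) ∧ q.2.2 ∈ W q.2.1}
  have hnext : ∀ q : H, ∃ q' : H, ∃ V : Fin A.size → Set S.T,
      q'.1.1 = q.1.1 ++ [val V, pos q'.1.2] ∧ Q q.1.2 q'.1.2 := by
    rintro ⟨⟨π, a, s⟩, hm, hl, hs⟩
    have hE := hf π _ hm hl ⟨_, rfl⟩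
    rcases hfπ : f π with y | V
    · rw [hfπ] at hE
      exact hE.elim
    · rw [hfπ] at hE
      obtain ⟨b, t, ht, hb, hQ⟩ := h1 a s hs _ hE.2
      have hm' := hm.concat hl (z := val V) hE fun _ => hfπ.symm
      have hlast : ((π ++ [val V]) ++ [pos (b, t.1)]).getLast? = some (pos (b, t.1)) :=
        List.getLast?_concat
      have hm'' := hm'.concat (y := val V) (z := pos (b, t.1)) List.getLast?_concat
        (show t.1 ∈ V b from ht) (by rintro ⟨_, h⟩; cases h)
      have happ : (π ++ [val V]) ++ [pos (b, t.1)] = π ++ [val V, pos (b, t.1)] :=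
        List.append_assoc ..
      rw [happ] at hlast
      dsimp only at hm''
      rw [happ] at hm''
      exact ⟨⟨(_, (b, t.1)), hm'', hlast, hb⟩, V, rfl, hQ⟩
  choose nx V hV hQ using hnext
  let q₀ : H := ⟨([pos (A.init, S.init)], (A.init, S.init)),
    ⟨rfl, fun i h => by
      have h : i + 1 < 1 := h
      omega⟩, rfl, h0⟩
  let q : ℕ → H := fun n => nx^[n] q₀
  have hq : ∀ n, q (n + 1) = nx (q n) := fun n => Function.iterate_succ_apply' _ _ _
  have hqV : ∀ n, (q (n + 1)).1.1 = (q n).1.1 ++ [val (V (q n)), pos (q (n + 1)).1.2] := by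
    intro n
    rw [hq]
    exact hV (q n)
  have hlen : ∀ n, (q n).1.1.length = 2 * n + 1 := by
    intro n
    induction n with
    | zero => rfl
    | succ n ih => rw [hqV, List.length_append, ih]; rfl
  obtain ⟨π, hπ, hπ'⟩ := BoardGame.exists_infiniteMatch (l := fun n => (q n).1.1)
    (fun n => (q n).2.1) (fun n => by rw [hqV]; exact List.prefix_append _ _)
    fun n => by rw [hlen]; omega
  have hy : ∀ i, π (2 * i) = Sum.inl (q i).1.2 := by
    intro i
    rw [hπ' i (2 * i) (by rw [hlen]; omega)]
    have h3 := (q i).2.2.1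
    rw [List.getLast?_eq_getElem?, List.getElem?_eq_getElem (by rw [hlen]; omega)] at h3
    have h4 := Option.some_injective _ h3
    simpa only [hlen, Nat.add_sub_cancel] using h4
  have hy' : ∀ i, ∃ V, π (2 * i + 1) = Sum.inr V := by
    intro i
    refine ⟨V (q i), Option.some_injective _ ?_⟩
    rw [hπ' (i + 1) (2 * i + 1) (by rw [hlen]; omega), ← List.getElem?_eq_getElem, hqV,
      List.getElem?_append_right (by rw [hlen]), hlen, Nat.sub_self]
    rfl
  obtain ⟨M, hM, hM1, hM2⟩ := h2 (fun i => (q i).1.2) fun i => by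
    rw [hq]
    exact hQ (q i)
  exact hM ((mem_parityWin_iff hy hy' hM1 hM2).1 (hfw π hπ))

end Game

end

section

open Block Filter

variable {L : OneStepLanguage.{u, w}} {F : L.Fragments}

/-! ### Correctness of the automaton -/

section Correctness

variable (C : L.Closed F) {P : Finset ℕ} {b : Block (TransTerm L)} (hb : BlockWF F b)

/-- The moves from `(a, s)` to `(b, t)` that respect the progress measure `r`. -/
def Block.Step (pol : Bool) (S : LTS.{u} P) (r : ℕ → S.T → ℕ → Ordinal.{u})
    (x y : Fin (b.toAutomaton C P hb).size × S.T) : Prop :=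
  y.1 ∈ L.occ ((b.toAutomaton C P hb).trans x.1 (S.colour x.2)) ∧
    LexLE (y.1.1 % b.numTags) (r (y.1.1 / b.numTags) y.2) (r (x.1.1 / b.numTags) x.2) ∧
    (y.1.1 % b.numTags ≠ 0 → (y.1.1 % b.numTags).bodd = pol →
      LexLT (y.1.1 % b.numTags) (r (y.1.1 / b.numTags) y.2) (r (x.1.1 / b.numTags) x.2))

variable {S : LTS.{u} P} {r : ℕ → S.T → ℕ → Ordinal.{u}} {pol : Bool} {W : ℕ → Set S.T}
  {ρ : ℕ → Set S.T} {h : ℕ} {lab : ℕ → ℕ}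

/-- Reading a label condition off a transition of the automaton. -/
theorem Labelled.of_occ (hlab : Labelled (b.height + 1) (b.states (TransTerm.ops L)) lab)
    {a a' : Fin b.size} {c : P.powerset} (h : a' ∈ L.occ ((b.toAutomaton C P hb).trans a c)) :
    lab (a'.1 / b.numTags) < lab (a.1 / b.numTags) ∨
      (lab (a'.1 / b.numTags) = lab (a.1 / b.numTags) ∧
        (b.termState (a'.1 / b.numTags)).cls = (b.termState (a.1 / b.numTags)).cls) :=
  (b.ref_of_occ C hb (Q := fun x => ∀ s', (b.states (TransTerm.ops L))[x.1]? = some s' →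
    lab x.1 < lab (a.1 / b.numTags) ∨ (lab x.1 = lab (a.1 / b.numTags) ∧
      s'.cls = (b.termState (a.1 / b.numTags)).cls)) (hlab.ref _ _ (b.states_getElem?_div a)) h).1
    _ (b.states_getElem?_div a')

theorem Block.parity_of_step
    (hlab : Labelled (b.height + 1) (b.states (TransTerm.ops L)) lab)
    (hr : IsProgress pol S.R ρ h (b.states (TransTerm.ops L)) W r)
    {y : ℕ → Fin (b.toAutomaton C P hb).size × S.T}
    (hy : ∀ i, Block.Step C hb pol S r (y i) (y (i + 1))) :
    ∃ M : ℕ, M.bodd = !pol ∧ (∃ᶠ i in atTop, (b.toAutomaton C P hb).prio (y i).1 = M) ∧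
      ∀ᶠ i in atTop, (b.toAutomaton C P hb).prio (y i).1 ≤ M :=
  path_parity (h := b.height) (N := 2 * h) (S := b.states (TransTerm.ops L)) (lab := lab)
    (x := fun i => ((y i).1.1 / b.numTags, (y i).1.1 % b.numTags))
    (s := fun i => b.termState ((y i).1.1 / b.numTags))
    (r := fun i => r ((y i).1.1 / b.numTags) (y i).2)
    (fun i => (b.ref_of_occ C hb (Q := fun _ => True)
      (.of_forall (fun _ _ _ _ => trivial) _) (hy i).1).2)
    (fun i => hlab.of_occ C hb (hy i).1) (fun _ k hk => hr.zero _ _ k hk) fun i => (hy i).2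

theorem Block.accepts_of_isProgress
    (hlab : Labelled (b.height + 1) (b.states (TransTerm.ops L)) lab)
    (hr : IsProgress true S.R (fun q => {s | q ∈ (S.colour s).1}) h
      (b.states (TransTerm.ops L)) W r)
    (h0 : S.init ∈ W 0) : (b.toAutomaton C P hb).Accepts S := by
  refine ParityAutomaton.accepts_of_positional (W := fun a => W (a.1 / b.numTags))
    (Q := Block.Step C hb true S r) ?_ (fun a s hs => ?_) fun y hy => ?_
  · show S.init ∈ W (0 / b.numTags)
    rwa [Nat.zero_div]
  · have hsem := hr.step _ _ (b.states_getElem?_div a) s hs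
    have hmods := hb.states.mods _ _ (b.states_getElem?_div a)
    let V : Fin b.size → Set (S.Succ s) := fun a' => {t | t.1 ∈ target true W r
      (r (a.1 / b.numTags) s) (a'.1 / b.numTags, a'.1 % b.numTags)}
    have hV := (TransTerm.sat_compile (V := V) b.size_pos b.numTags C
      (c := (S.colour s).1) (fun q => Iff.rfl) (hmods.imp fun n α f hf i x => by
        show x.1 ∈ target true W r _ _ ↔ _
        rw [(hf.2 i).refIndex_eq])).2 hsem
    -- Éloise may restrict herself to the states that occur in the transition formula
    refine (L.sat_congr _ _ _ fun a' ha' => ?_).1 hV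
    ext t
    exact ⟨fun ht => ⟨ht.1, ha', ht.2⟩, fun ht => ⟨ht.1, ht.2.2⟩⟩
  · obtain ⟨M, hM, h1⟩ := b.parity_of_step C hb hlab hr hy
    exact ⟨M, Nat.even_iff.2 (by rw [Nat.mod_two_of_bodd, hM]; rfl), h1⟩

theorem Block.not_accepts_of_isProgress
    (hlab : Labelled (b.height + 1) (b.states (TransTerm.ops L)) lab)
    (hr : IsProgress false S.R (fun q => {s | q ∈ (S.colour s).1}ᶜ) h
      (b.states (TransTerm.ops L)) W r)
    (h0 : S.init ∈ W 0) : ¬ (b.toAutomaton C P hb).Accepts S := by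
  refine ParityAutomaton.not_accepts (W := fun a => W (a.1 / b.numTags))
    (Q := Block.Step C hb false S r) ?_ (fun a s hs V hV => ?_) fun y hy => ?_
  · show S.init ∈ W (0 / b.numTags)
    rwa [Nat.zero_div]
  · by_contra hcon
    have hsem := hr.step _ _ (b.states_getElem?_div a) s hs
    have hmods := hb.states.mods _ _ (b.states_getElem?_div a)
    let V' : Fin b.size → Set (S.Succ s) := fun a' => {t | t.1 ∉ target false W r
      (r (a.1 / b.numTags) s) (a'.1 / b.numTags, a'.1 % b.numTags)}
    refine (TransTerm.sat_compile_dual (V := V') b.size_pos b.numTags C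
      (c := (S.colour s).1) (fun q => Iff.rfl) (hmods.imp fun n α f hf i x => by
        show x.1 ∉ target false W r _ _ ↔ _
        rw [(hf.2 i).refIndex_eq])).1 ?_ hsem
    -- only the states that occur in the transition formula matter
    have hocc : L.sat (fun a' => {t | t ∈ V a' ∧
        a' ∈ L.occ ((b.toAutomaton C P hb).trans a (S.colour s))})
        ((b.toAutomaton C P hb).trans a (S.colour s)) :=
      (L.sat_congr _ _ _ fun a' ha' => by
        ext t
        exact ⟨fun ht => ⟨ht, ha'⟩, fun ht => ht.1⟩).1 hV
    refine F.sat_mono ((b.toAutomaton C P hb).trans_pos a (S.colour s)) ?_ hocc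
    rintro a' t ⟨ht, ha'⟩ htar
    exact hcon ⟨a', t, ht, htar.1, ha', htar.2⟩
  · obtain ⟨M, hM, h1⟩ := b.parity_of_step C hb hlab hr hy
    exact ⟨M, by rw [Nat.even_iff, Nat.mod_two_of_bodd, hM]; simp, h1⟩

end Correctness

/-- The automaton of a formula. -/
def MuForm.toAutomaton (C : L.Closed F) (P : Finset ℕ) {φ : MuForm L} (hφ : φ.IsMuL F) :
    ParityAutomaton F P := φ.block.toAutomaton C P (MuForm.block_wf hφ)

theorem MuForm.accepts_iff (C : L.Closed F) {P : Finset ℕ} {φ : MuForm L} (hφ : φ.IsMuL F)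
    (S : LTS.{u} P) : (MuForm.toAutomaton C P hφ).Accepts S ↔ φ.Holds S := by
  obtain ⟨lab, hlab, -⟩ := MuForm.exists_labelled hφ
  by_cases h : φ.Holds S
  · refine iff_of_true ?_ h
    obtain ⟨W, r, hr, hW⟩ := (MuForm.realizes_block hφ true S.R
      fun q => {s | q ∈ (S.colour s).1}).states (MuForm.block_wf hφ)
    exact φ.block.accepts_of_isProgress C _ hlab.states hr (hW h)
  · refine iff_of_false ?_ h
    obtain ⟨W, r, hr, hW⟩ := (MuForm.realizes_block hφ false S.R
      fun q => {s | q ∈ (S.colour s).1}ᶜ).states (MuForm.block_wf hφ)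
    refine φ.block.not_accepts_of_isProgress C _ hlab.states hr (hW ?_)
    simpa [polExt, MuForm.Holds] using h

/-! ### Clusters of the automaton -/

section Clusters

variable (C : L.Closed F) {P : Finset ℕ} {b : Block (TransTerm L)} (hb : BlockWF F b)
  {lab : ℕ → ℕ}

/-- Along activity, labels do not increase; while they stay the same, so do the classes, and if
the class is empty then the numbers of the states increase. -/
theorem Labelled.of_active (hlab : Labelled (b.height + 1) (b.states (TransTerm.ops L)) lab)
    {a a' : Fin b.size} (h : (b.toAutomaton C P hb).Active a a') :
    lab (a'.1 / b.numTags) < lab (a.1 / b.numTags) ∨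
      (lab (a'.1 / b.numTags) = lab (a.1 / b.numTags) ∧
        (b.termState (a'.1 / b.numTags)).cls = (b.termState (a.1 / b.numTags)).cls ∧
        ((b.termState (a.1 / b.numTags)).cls = [] → a.1 / b.numTags < a'.1 / b.numTags)) := by
  have key : ∀ {a a' : Fin b.size} {c : P.powerset},
      a' ∈ L.occ ((b.toAutomaton C P hb).trans a c) →
      lab (a'.1 / b.numTags) < lab (a.1 / b.numTags) ∨
      (lab (a'.1 / b.numTags) = lab (a.1 / b.numTags) ∧
        (b.termState (a'.1 / b.numTags)).cls = (b.termState (a.1 / b.numTags)).cls ∧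
        ((b.termState (a.1 / b.numTags)).cls = [] → a.1 / b.numTags < a'.1 / b.numTags)) := by
    intro a a' c h
    refine (hlab.of_occ C hb h).imp_right fun h' => ⟨h'.1, h'.2, fun hnil => ?_⟩
    obtain ⟨-, -, h2, h3, -⟩ := b.ref_of_occ C hb (Q := fun _ => True)
      (.of_forall (fun _ _ _ _ => trivial) _) h
    refine h2 (by_contra fun h4 => ?_)
    have := h3 h4
    rw [hnil] at this
    exact List.not_mem_nil this
  induction h with
  | single h => obtain ⟨c, hc⟩ := h; exact key hc
  | tail _ h ih =>
    obtain ⟨c, hc⟩ := h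
    rcases key hc with h1 | ⟨h1, h2, h3⟩ <;> rcases ih with h4 | ⟨h4, h5, h6⟩
    · exact Or.inl (h1.trans h4)
    · exact Or.inl (h1.trans_eq h4)
    · exact Or.inl (h1.trans_lt h4)
    · exact Or.inr ⟨h1.trans h4, h2.trans h5, fun h => (h6 h).trans (h3 (h5.trans h))⟩

/-- In a cluster, all labels and all classes agree; if the class is empty, then the cluster
consists of a single state. -/
theorem Labelled.of_cluster (hlab : Labelled (b.height + 1) (b.states (TransTerm.ops L)) lab)
    {a a' : Fin b.size} (h : a' ∈ (b.toAutomaton C P hb).cluster a) :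
    lab (a'.1 / b.numTags) = lab (a.1 / b.numTags) ∧
      (b.termState (a'.1 / b.numTags)).cls = (b.termState (a.1 / b.numTags)).cls ∧
      ((b.termState (a.1 / b.numTags)).cls = [] → a' = a) := by
  induction h with
  | rel x y h =>
    rcases hlab.of_active C hb h.1 with h1 | ⟨h1, h2, h3⟩
    · rcases hlab.of_active C hb h.2 with h4 | ⟨h4, -, -⟩ <;> omega
    · refine ⟨h1, h2, fun hnil => ?_⟩
      rcases hlab.of_active C hb h.2 with h4 | ⟨-, -, h5⟩
      · omega
      · have := h3 hnil
        have := h5 (h2.trans hnil)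
        omega
  | refl x => exact ⟨rfl, rfl, fun _ => rfl⟩
  | symm x y _ ih => exact ⟨ih.1.symm, ih.2.1.symm, fun h => (ih.2.2 (ih.2.1.symm.trans h)).symm⟩
  | trans x y z _ _ ih1 ih2 =>
    exact ⟨ih2.1.trans ih1.1, ih2.2.1.trans ih1.2.1, fun h =>
      (ih2.2.2 (ih1.2.1.trans h)).trans (ih1.2.2 h)⟩

theorem BlockMono.states (hm : BlockMono b) {j : ℕ} {s : State (TransTerm L)}
    (hj : (b.states (TransTerm.ops L))[j]? = some s) (d : Bool) (hd : d ∈ s.cls) :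
    (!d) ∉ s.cls := by
  rcases states_cases hj with ⟨rfl, rfl⟩ | ⟨i, s', rfl, hi, rfl⟩
  · exact List.not_mem_nil
  · exact hm i s' hi d hd

theorem Block.isWeak (hlab : Labelled (b.height + 1) (b.states (TransTerm.ops L)) lab)
    (hm : BlockMono b) : (b.toAutomaton C P hb).IsWeak := by
  have key : ∀ (a : Fin b.size) (m : ℕ), statePrio (b.termState (a.1 / b.numTags)).cls m =
      if true ∈ (b.termState (a.1 / b.numTags)).cls then 1 else 0 := by
    intro a m
    unfold statePrio
    split_ifs with h1 h2
    · exact (hm.states (b.states_getElem?_div a) true h1 h2).elim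
    · rfl
    · rfl
  refine ⟨fun a => ?_, fun a a' h => ?_⟩
  · refine (key a _).trans_le ?_
    split_ifs <;> simp
  · refine (key a _).trans (Eq.trans ?_ (key a' _).symm)
    rw [(hlab.of_cluster C hb h).2.1]

theorem Block.isContinuous (hlab : Labelled (b.height + 1) (b.states (TransTerm.ops L)) lab)
    (hm : BlockMono b) (hc : ContStates F (b.states (TransTerm.ops L)) lab) :
    (b.toAutomaton C P hb).IsContinuous := by
  have key : ∀ (a : Fin b.size) (c : P.powerset) (d : Bool),
      d ∈ (b.termState (a.1 / b.numTags)).cls →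
      F.contFrag d _ ((b.toAutomaton C P hb).trans a c) ((b.toAutomaton C P hb).cluster a) := by
    intro a c d hd
    refine TransTerm.compile_contFrag C _ _ _ (((hc _ _ (b.states_getElem?_div a) d hd
      (hm.states (b.states_getElem?_div a) d hd)).and
        (hb.states.mods _ _ (b.states_getElem?_div a))).imp ?_)
    rintro n α f ⟨⟨B, hB, hB'⟩, -, hf⟩
    refine ⟨B, hB, fun i hi hmem => (hB' i hi).ne ?_⟩
    have h1 := (hlab.of_cluster C hb hmem).1
    exact (congrArg (fun x => lab x.1) (hf i).refIndex_eq).symm.trans h1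
  refine fun a c => ⟨fun h => ?_, fun h => ?_⟩
  · have ht : true ∈ (b.termState (a.1 / b.numTags)).cls := by
      by_contra hn
      have h : statePrio (b.termState (a.1 / b.numTags)).cls _ = 1 := h
      simp [statePrio, hn] at h
    exact key a c true ht
  · by_cases hf : false ∈ (b.termState (a.1 / b.numTags)).cls
    · exact key a c false hf
    have ht : true ∉ (b.termState (a.1 / b.numTags)).cls := by
      intro ht
      have h : statePrio (b.termState (a.1 / b.numTags)).cls _ = 0 := h
      simp [statePrio, ht, hf] at h
    have hnil : (b.termState (a.1 / b.numTags)).cls = [] :=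
      List.eq_nil_iff_forall_not_mem.2 fun d => by cases d; exacts [hf, ht]
    -- a state with empty class does not refer to its own cluster
    refine TransTerm.compile_contFrag (d := false) C _ _ _
      ((hb.states.mods _ _ (b.states_getElem?_div a)).imp ?_)
    rintro n α f ⟨hα, hr⟩
    refine ⟨∅, F.contFrag_empty hα, fun i _ hmem => ?_⟩
    have h1 := (hlab.of_cluster C hb hmem).2.2 hnil
    have h2 : a.1 / b.numTags = (f i).1 :=
      (congrArg (fun x : Fin b.size => x.1 / b.numTags) h1.symm).trans
        (congrArg Prod.fst (hr i).refIndex_eq)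
    obtain ⟨-, h3, h4, -⟩ := hr i
    rw [hnil] at h4
    have h5 := h3 (by_contra fun h => List.not_mem_nil (h4 h))
    omega

end Clusters

theorem MuForm.isWeak_toAutomaton (C : L.Closed F) {P : Finset ℕ} {φ : MuForm L}
    (hφ : φ.IsMuL F) (hD : φ.IsMuD) : (MuForm.toAutomaton C P hφ).IsWeak := by
  obtain ⟨lab, hlab, -⟩ := MuForm.exists_labelled hφ
  exact φ.block.isWeak C _ hlab.states (MuForm.blockMono hφ hD)

theorem MuForm.isWeakContinuous_toAutomaton (C : L.Closed F) {P : Finset ℕ} {φ : MuForm L}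
    (hφ : φ.IsMuL F) (hC : φ.IsMuC F) : (MuForm.toAutomaton C P hφ).IsWeakContinuous := by
  obtain ⟨lab, hlab, hcont⟩ := MuForm.exists_labelled hφ
  exact ⟨MuForm.isWeak_toAutomaton C hφ hC.isMuD, φ.block.isContinuous C _ hlab.states
    (MuForm.blockMono hφ hC.isMuD) ((hcont hC).states (h := φ.block.height))⟩

end

section

open Block Filter

/-! ### Codes of transition terms -/

variable {L : OneStepLanguage.{u, w}} {F : L.Fragments}

/-- Transition terms in prefix notation.  A token `((k, x), l)` is a literal `¬x` or `x` (`k = 0, 1`), a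
constant `⊥` or `⊤` (`k = 2, 3`), a connective `∧` or `∨` (`k = 4, 5`), or a modal atom with one-step
formula coded by `x` and list of references `l` (`k = 6`). -/
abbrev TermCode := List ((ℕ × ℕ) × List (ℕ × ℕ))

namespace TermCode

def shift (k : ℕ) (t : TermCode) : TermCode :=
  t.map fun x => (x.1, x.2.map fun y => (y.1 + k, y.2))

def retag (m : ℕ) (t : TermCode) : TermCode :=
  t.map fun x => (x.1, x.2.map fun y => (y.1, m))

def subst (p : ℕ) (t v : TermCode) : TermCode :=
  t.flatMap fun x => if x.1 = (1, p) then v else [x]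

def ops : TermOps TermCode := ⟨shift, retag, subst⟩

/-- A boolean combination; `k` is the kind of the connective. -/
def bin (k : ℕ) (s t : TermCode) : TermCode := ((k, 0), []) :: (s ++ t)

/-- A modal atom with `n` arguments, for the one-step formula with code `x`. -/
def mod (n x : ℕ) (os : List ℕ) : TermCode :=
  [((6, x), (List.range n).map fun i => (os.getD i 0, 0))]

def bot : TermCode := [((2, 0), [])]

def top : TermCode := [((3, 0), [])]

end TermCode

section Encode

variable {C : L.Closed F} (E : C.Coding)

/-- The code of a transition term. -/
def TransTerm.encode : TransTerm L → TermCode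
  | lit b q => [((b.toNat, q), [])]
  | cst b => [((2 + b.toNat, 0), [])]
  | bin b s t => TermCode.bin (4 + b.toNat) (encode s) (encode t)
  | mod α f => [((6, E.code α), List.ofFn f)]

theorem TransTerm.encode_shift (k : ℕ) (t : TransTerm L) :
    (t.shift k).encode E = (t.encode E).shift k := by
  induction t with
  | lit b q | cst b => rfl
  | bin b s t hs ht =>
    refine (congrArg₂ (TermCode.bin _) hs ht).trans ?_
    simp [encode, TermCode.bin, TermCode.shift]
  | mod α f =>
    simp only [encode, shift, mapRef, TermCode.shift, List.map_cons, List.map_nil, List.map_ofFn]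
    rfl

theorem TransTerm.encode_retag (m : ℕ) (t : TransTerm L) :
    (t.retag m).encode E = (t.encode E).retag m := by
  induction t with
  | lit b q | cst b => rfl
  | bin b s t hs ht =>
    refine (congrArg₂ (TermCode.bin _) hs ht).trans ?_
    simp [encode, TermCode.bin, TermCode.retag]
  | mod α f =>
    simp only [encode, retag, mapRef, TermCode.retag, List.map_cons, List.map_nil, List.map_ofFn]
    rfl

theorem TransTerm.encode_subst (p : ℕ) (t v : TransTerm L) :
    (t.subst p v).encode E = (t.encode E).subst p (v.encode E) := by
  induction t with
  | lit b q =>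
    cases b
    · simp [encode, subst, TermCode.subst]
    · by_cases h : q = p <;> simp [encode, subst, TermCode.subst, h]
  | cst b => cases b <;> simp [encode, subst, TermCode.subst]
  | bin b s t hs ht =>
    refine (congrArg₂ (TermCode.bin _) hs ht).trans ?_
    cases b <;> simp [encode, TermCode.bin, TermCode.subst]
  | mod α f => simp [encode, subst, TermCode.subst]

end Encode

namespace Block

variable {τ σ : Type*}

/-- The action on blocks of a map between transition terms. -/
def map (g : τ → σ) (b : Block τ) : Block σ :=
  ⟨g b.head, b.fv, b.tail.map (State.mapTerm g), b.height⟩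

variable {o : TermOps τ} {o' : TermOps σ} {g : τ → σ}

theorem map_shiftStates (hs : ∀ k t, g (o.shift k t) = o'.shift k (g t)) (k : ℕ)
    (S : List (State τ)) : (shiftStates o k S).map (State.mapTerm g) =
      shiftStates o' k (S.map (State.mapTerm g)) := by
  simp [shiftStates, State.mapTerm, hs]

theorem states_map (hs : ∀ k t, g (o.shift k t) = o'.shift k (g t)) (b : Block τ) :
    (b.map g).states o' = (b.states o).map (State.mapTerm g) := by
  simp only [states, List.map_cons, map_shiftStates hs]
  simp [State.mapTerm, map, hs]

theorem cat_map (hs : ∀ k t, g (o.shift k t) = o'.shift k (g t)) (bs : List (Block τ)) :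
    cat o' (bs.map (map g)) = ((cat o bs).1.map (State.mapTerm g), (cat o bs).2) := by
  induction bs with
  | nil => rfl
  | cons b bs ih =>
    simp only [List.map_cons, cat, ih, List.map_append, states_map hs, map_shiftStates hs]
    simp [map]

theorem map_bin (hs : ∀ k t, g (o.shift k t) = o'.shift k (g t)) {f : τ → τ → τ}
    {f' : σ → σ → σ} (hf : ∀ s t, g (f s t) = f' (g s) (g t)) (b c : Block τ) :
    (bin o f b c).map g = bin o' f' (b.map g) (c.map g) := by
  simp only [bin, map, hf, hs, List.map_append, map_shiftStates hs, List.length_map]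

theorem map_next (hs : ∀ k t, g (o.shift k t) = o'.shift k (g t)) {mk : List ℕ → τ}
    {mk' : List ℕ → σ} (hmk : ∀ os, g (mk os) = mk' os) (bs : List (Block τ)) :
    (next o mk bs).map g = next o' mk' (bs.map (map g)) := by
  simp only [next, cat_map hs, map, hmk, List.flatMap_map, List.map_map]
  rfl

theorem map_fix (hr : ∀ m t, g (o.retag m t) = o'.retag m (g t))
    (hu : ∀ p s t, g (o.subst p s t) = o'.subst p (g s) (g t)) (mu : Bool) (c : τ) (p : ℕ)
    (b : Block τ) : (b.fix o mu c p).map g = (b.map g).fix o' mu (g c) p := by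
  have hcls : ((b.tail.map (State.mapTerm g)).filter fun s => p ∈ s.dep).flatMap State.cls =
      (b.tail.filter fun s => p ∈ s.dep).flatMap State.cls := by
    rw [List.filter_map, List.flatMap_map]
    rfl
  simp only [fix, map, hu, hcls, List.map_map]
  congr 1
  refine List.map_congr_left fun s _ => ?_
  by_cases hp : p ∈ s.dep <;> simp [State.mapTerm, hp, hu, hr]

end Block

section Parse

variable {C : L.Closed F} (E : C.Coding)

/-- One step of the evaluation of a formula in prefix notation to a coded block, from right to left
and with a stack of the blocks of subformulas. -/
def parseStep (x : ℕ × ℕ) (st : List (Block TermCode)) : List (Block TermCode) :=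
  let d : Block TermCode := ⟨[], [], [], 0⟩
  if x.1 = 0 then ⟨[((1, x.2), [])], [x.2], [], 0⟩ :: st
  else if x.1 = 1 then ⟨[((0, x.2), [])], [x.2], [], 0⟩ :: st
  else if x.1 = 2 then .bin TermCode.ops (TermCode.bin 5) (st.getD 0 d) (st.getD 1 d) :: st.drop 2
  else if x.1 = 3 then .bin TermCode.ops (TermCode.bin 4) (st.getD 0 d) (st.getD 1 d) :: st.drop 2
  else if x.1 = 4 then
    .next TermCode.ops (TermCode.mod x.2.unpair.1 x.2.unpair.2) (st.take x.2.unpair.1) ::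
      st.drop x.2.unpair.1
  else if x.1 = 5 then .fix TermCode.ops true TermCode.bot x.2 (st.getD 0 d) :: st.drop 1
  else .fix TermCode.ops false TermCode.top x.2 (st.getD 0 d) :: st.drop 1

theorem foldr_flatten_ofFn {α β : Type*} (f : α → List β → List β) {n : ℕ} {l : Fin n → List α}
    {b : Fin n → β} (h : ∀ i st, (l i).foldr f st = b i :: st) (st : List β) :
    (List.ofFn l).flatten.foldr f st = List.ofFn b ++ st := by
  induction n with
  | zero => simp
  | succ n ih =>
    rw [List.ofFn_succ, List.ofFn_succ, List.flatten_cons, List.foldr_append,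
      ih (fun i => h i.succ), h 0, List.cons_append]

theorem MuForm.foldr_parseStep (φ : MuForm L) (st : List (Block TermCode)) :
    (φ.toWord E).foldr parseStep st = φ.block.map (TransTerm.encode E) :: st := by
  have hs : ∀ k t, TransTerm.encode E ((TransTerm.ops L).shift k t) =
    TermCode.ops.shift k (TransTerm.encode E t) := TransTerm.encode_shift E
  have hr : ∀ k t, TransTerm.encode E ((TransTerm.ops L).retag k t) =
    TermCode.ops.retag k (TransTerm.encode E t) := TransTerm.encode_retag E
  have hu : ∀ p s t, TransTerm.encode E ((TransTerm.ops L).subst p s t) =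
    TermCode.ops.subst p (TransTerm.encode E s) (TransTerm.encode E t) := TransTerm.encode_subst E
  induction φ generalizing st with
  | atom q | natom q => rfl
  | or φ ψ hφ hψ =>
    simp only [toWord, List.foldr_cons, List.foldr_append, hφ, hψ, block,
      map_bin hs (f := .bin true) (f' := TermCode.bin 5) fun _ _ => rfl]
    rfl
  | and φ ψ hφ hψ =>
    simp only [toWord, List.foldr_cons, List.foldr_append, hφ, hψ, block,
      map_bin hs (f := .bin false) (f' := TermCode.bin 4) fun _ _ => rfl]
    rfl
  | @nxt n α φ ih =>
    rw [block, map_next hs (mk' := TermCode.mod n (E.code α)), List.map_ofFn]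
    · simp only [toWord, List.foldr_cons, foldr_flatten_ofFn parseStep ih]
      simp [parseStep, Function.comp_def]
    · intro os
      simp only [TransTerm.encode, TermCode.mod]
      congr 2
      exact List.ext_getElem (by simp) fun i h1 h2 => by simp
  | mu p φ ih =>
    simp only [toWord, List.foldr_cons, ih, block, map_fix hr hu]
    rfl
  | nu p φ ih =>
    simp only [toWord, List.foldr_cons, ih, block, map_fix hr hu]
    rfl

end Parse

section Compile

variable {C : L.Closed F} (E : C.Coding)

/-- One step of the evaluation of a coded transition term to the code of a one-step formula, from
right to left and with a stack of the codes of subterms.  Here `x = ((N, K), c)` consists of the number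
of states, the number of tags and the colour. -/
noncomputable def compileStep (x : (ℕ × ℕ) × List ℕ) (y : (ℕ × ℕ) × List (ℕ × ℕ)) (st : List ℕ) :
    List ℕ :=
  if y.1.1 = 0 then
    (if y.1.2 ∈ x.2 then E.code (C.bot x.1.1) else E.code (C.top x.1.1)) :: st
  else if y.1.1 = 1 then
    (if y.1.2 ∈ x.2 then E.code (C.top x.1.1) else E.code (C.bot x.1.1)) :: st
  else if y.1.1 = 2 then E.code (C.bot x.1.1) :: st
  else if y.1.1 = 3 then E.code (C.top x.1.1) :: st
  else if y.1.1 = 4 then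
    E.computable_conj.choose (x.1.1, st.getD 0 0, st.getD 1 0) :: st.drop 2
  else if y.1.1 = 5 then
    E.computable_disj.choose (x.1.1, st.getD 0 0, st.getD 1 0) :: st.drop 2
  else E.computable_rename.choose
    (y.2.length, x.1.1, y.2.map fun z => (z.1 * x.1.2 + z.2) % x.1.1, y.1.2) :: st

theorem TransTerm.foldr_compileStep {N : ℕ} (hN : 0 < N) (K : ℕ) {c : Finset ℕ} {l : List ℕ}
    (hl : ∀ q, q ∈ l ↔ q ∈ c) (t : TransTerm L) (st : List ℕ) :
    (t.encode E).foldr (compileStep E ((N, K), l)) st = E.code (t.compile C hN K c) :: st := by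
  induction t generalizing st with
  | lit b q =>
    cases b <;> by_cases hq : q ∈ c <;> simp [encode, compileStep, compile, hl, hq]
  | cst b => cases b <;> simp [encode, compileStep, compile]
  | bin b s t hs ht =>
    cases b
    · simp [encode, TermCode.bin, hs, ht, compileStep, compile,
        E.computable_conj.choose_spec.2 N]
    · simp [encode, TermCode.bin, hs, ht, compileStep, compile,
        E.computable_disj.choose_spec.2 N]
  | @mod n α f =>
    have := E.computable_rename.choose_spec.2 n N (fun i => refIndex hN K (f i)) α
    simp only [encode, compileStep, compile, ← this, List.foldr_cons, List.foldr_nil,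
      List.length_ofFn, List.map_ofFn]
    rfl

/-- The table of an automaton, from the coded block and the list of colours. -/
noncomputable def blockTable (cs : List (List ℕ)) (b : Block TermCode) :
    ℕ × ℕ × List (ℕ × List ℕ) :=
  (b.size, 0, (List.range b.size).map fun a =>
    (statePrio (b.stateAt TermCode.ops TermCode.top (a / b.numTags)).cls (a % b.numTags),
      cs.map fun c => ((b.stateAt TermCode.ops TermCode.top (a / b.numTags)).term.foldr
        (compileStep E ((b.size, b.numTags), c)) []).getD 0 0))

theorem Block.toTable_toAutomaton (P : Finset ℕ) {b : Block (TransTerm L)} (hb : BlockWF F b) :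
    (b.toAutomaton C P hb).toTable E = blockTable E
      ((List.range (2 ^ P.sup Nat.succ)).map fun m => (ParityAutomaton.colourOf P m).1.toList)
      (b.map (TransTerm.encode E)) := by
  have hsize : (b.map (TransTerm.encode E)).size = b.size := by simp [Block.map, size, numTags]
  have hst : ∀ j, (b.map (TransTerm.encode E)).stateAt TermCode.ops TermCode.top j =
      (b.termState j).mapTerm (TransTerm.encode E) := by
    intro j
    unfold termState stateAt
    rw [states_map (o := TransTerm.ops L) (TransTerm.encode_shift E)]
    exact List.getD_map _ (⟨.cst true, [], []⟩ : State (TransTerm L)) (State.mapTerm _)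
  unfold blockTable ParityAutomaton.toTable
  rw [hsize]
  refine Prod.ext rfl (Prod.ext rfl ?_)
  refine List.ext_getElem (by simp [toAutomaton]) fun a h1 h2 => ?_
  rw [List.getElem_ofFn, List.getElem_map, List.getElem_range, hst, List.map_map]
  refine Prod.ext rfl (List.map_congr_left fun m _ => ?_)
  have h3 := TransTerm.foldr_compileStep E b.size_pos b.numTags
    (c := (ParityAutomaton.colourOf P m).1) (fun q => Finset.mem_toList)
    (b.termState (a / b.numTags)).term []
  exact (congrArg (fun l => l.getD 0 0) h3).symm

end Compile

end

section

open Block Filter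

/-! ### Computability of the translation -/

theorem Computable.ite {α σ : Type*} [Primcodable α] [Primcodable σ] {c : α → Prop}
    [DecidablePred c] {f g : α → σ} (hc : PrimrecPred c) (hf : Computable f)
    (hg : Computable g) : Computable fun a => if c a then f a else g a := by
  simpa [Bool.cond_decide] using Computable.cond hc.decide.to_comp hf hg

theorem Computable.list_foldl {α β σ : Type*} [Primcodable α] [Primcodable β] [Primcodable σ]
    {f : α → List β} {g : α → σ} {h : α → σ × β → σ} (hf : Computable f) (hg : Computable g)
    (hh : Computable₂ h) : Computable fun a => (f a).foldl (fun s b => h a (s, b)) (g a) := by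
  have key : ∀ (a : α) (n : ℕ), Nat.rec (motive := fun _ => σ) (g a)
      (fun n s => Option.casesOn (f a)[n]? s fun b => h a (s, b)) n =
        ((f a).take n).foldl (fun s b => h a (s, b)) (g a) := by
    intro a n
    induction n with
    | zero => rfl
    | succ n ih =>
      simp only [ih, List.take_add_one, List.foldl_append]
      cases (f a)[n]? <;> rfl
  refine (Computable.nat_rec (h := fun a p => Option.casesOn (f a)[p.1]? p.2 fun b => h a (p.2, b))
    (Computable.list_length.comp hf) hg
    (Computable.option_casesOn (Computable.list_getElem?.comp (hf.comp Computable.fst)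
      (Computable.fst.comp Computable.snd)) (Computable.snd.comp Computable.snd)
      (hh.comp (Computable.fst.comp Computable.fst) ((Computable.snd.comp
        (Computable.snd.comp Computable.fst)).pair Computable.snd)).to₂).to₂).of_eq fun a => ?_
  rw [key, List.take_length]

theorem Computable.list_foldr {α β σ : Type*} [Primcodable α] [Primcodable β] [Primcodable σ]
    {f : α → List β} {g : α → σ} {h : α → β × σ → σ} (hf : Computable f) (hg : Computable g)
    (hh : Computable₂ h) : Computable fun a => (f a).foldr (fun b s => h a (b, s)) (g a) :=
  (Computable.list_foldl (Computable.list_reverse.comp hf) hg (hh.comp Computable.fst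
    ((Computable.snd.comp Computable.snd).pair (Computable.fst.comp Computable.snd))).to₂).of_eq
    fun a => by simp [List.foldl_reverse]

theorem Computable.list_map {α β σ : Type*} [Primcodable α] [Primcodable β] [Primcodable σ]
    {f : α → List β} {g : α → β → σ} (hf : Computable f) (hg : Computable₂ g) :
    Computable fun a => (f a).map (g a) :=
  (Computable.list_foldr (h := fun a p => g a p.1 :: p.2) hf (Computable.const [])
    (Computable.list_cons.comp (hg.comp Computable.fst (Computable.fst.comp Computable.snd))
      (Computable.snd.comp Computable.snd)).to₂).of_eq fun a => by
        induction f a <;> simp [*]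

theorem PrimrecRel.list_mem {α : Type*} [Primcodable α] :
    PrimrecRel fun (a : α) (l : List α) => a ∈ l :=
  ((Primrec.eq (α := α)).exists_mem_list.swap).of_eq fun a l => by simp

section Instances

variable (τ : Type*)

def stateEquiv : State τ ≃ τ × List ℕ × List Bool where
  toFun s := (s.term, s.dep, s.cls)
  invFun x := ⟨x.1, x.2.1, x.2.2⟩

def blockEquiv : Block τ ≃ τ × List ℕ × List (State τ) × ℕ where
  toFun b := (b.head, b.fv, b.tail, b.height)
  invFun x := ⟨x.1, x.2.1, x.2.2.1, x.2.2.2⟩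

instance [Primcodable τ] : Primcodable (State τ) := Primcodable.ofEquiv _ (stateEquiv τ)

instance [Primcodable τ] : Primcodable (Block τ) := Primcodable.ofEquiv _ (blockEquiv τ)

end Instances

namespace Primrec

variable {α τ : Type*} [Primcodable α] [Primcodable τ]

theorem state_equiv : Primrec (stateEquiv τ) := .of_equiv

theorem block_equiv : Primrec (blockEquiv τ) := .of_equiv

theorem state_term : Primrec (State.term : State τ → τ) := fst.comp state_equiv

theorem state_dep : Primrec (State.dep : State τ → List ℕ) := fst.comp (snd.comp state_equiv)

theorem state_cls : Primrec (State.cls : State τ → List Bool) := snd.comp (snd.comp state_equiv)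

theorem block_head : Primrec (Block.head : Block τ → τ) := fst.comp block_equiv

theorem block_fv : Primrec (Block.fv : Block τ → List ℕ) := fst.comp (snd.comp block_equiv)

theorem block_tail : Primrec (Block.tail : Block τ → List (State τ)) :=
  fst.comp (snd.comp (snd.comp block_equiv))

theorem block_height : Primrec (Block.height : Block τ → ℕ) :=
  snd.comp (snd.comp (snd.comp block_equiv))

theorem state_mk {f : α → τ} {g : α → List ℕ} {h : α → List Bool} (hf : Primrec f)
    (hg : Primrec g) (hh : Primrec h) : Primrec fun a => State.mk (f a) (g a) (h a) :=
  (of_equiv_symm (e := stateEquiv τ)).comp (hf.pair (hg.pair hh))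

theorem block_mk {f : α → τ} {g : α → List ℕ} {h : α → List (State τ)} {k : α → ℕ}
    (hf : Primrec f) (hg : Primrec g) (hh : Primrec h) (hk : Primrec k) :
    Primrec fun a => Block.mk (f a) (g a) (h a) (k a) :=
  (of_equiv_symm (e := blockEquiv τ)).comp (hf.pair (hg.pair (hh.pair hk)))

/-! #### Codes of transition terms and of blocks -/

theorem termCode_shift : Primrec₂ TermCode.ops.shift :=
  list_map snd ((pair (fst.comp snd) (list_map (snd.comp snd)
    ((pair (nat_add.comp (fst.comp snd) (fst.comp (fst.comp fst))) (snd.comp snd)).to₂))).to₂)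

theorem termCode_retag : Primrec₂ TermCode.ops.retag :=
  list_map snd ((pair (fst.comp snd) (list_map (snd.comp snd)
    ((pair (fst.comp snd) (fst.comp (fst.comp fst))).to₂))).to₂)

theorem termCode_subst {f : α → ℕ} {g h : α → TermCode} (hf : Primrec f) (hg : Primrec g)
    (hh : Primrec h) : Primrec fun a => TermCode.ops.subst (f a) (g a) (h a) :=
  list_flatMap hg ((ite (Primrec.eq.comp (fst.comp snd) (pair (const 1) (hf.comp fst)))
    (hh.comp fst) (list_cons.comp snd (const []))).to₂)

theorem termCode_bin (k : ℕ) : Primrec₂ (TermCode.bin k) :=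
  list_cons.comp (const ((k, 0), [])) list_append

theorem termCode_mod {f g : α → ℕ} {h : α → List ℕ} (hf : Primrec f) (hg : Primrec g)
    (hh : Primrec h) : Primrec fun a => TermCode.mod (f a) (g a) (h a) :=
  list_cons.comp (pair (pair (const 6) hg) (list_map (list_range.comp hf)
    ((pair ((list_getD 0).comp (hh.comp fst) snd) (const 0)).to₂))) (const [])

theorem shiftStates {f : α → ℕ} {g : α → List (State TermCode)} (hf : Primrec f)
    (hg : Primrec g) : Primrec fun a => Block.shiftStates TermCode.ops (f a) (g a) :=
  list_map hg ((state_mk (termCode_shift.comp (hf.comp fst) (state_term.comp snd))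
    (state_dep.comp snd) (state_cls.comp snd)).to₂)

theorem block_states : Primrec (Block.states TermCode.ops) :=
  list_cons.comp (state_mk (termCode_shift.comp (const 1) block_head) block_fv (const []))
    (shiftStates (const 1) block_tail)

theorem block_cat : Primrec (Block.cat TermCode.ops) := by
  have h1 : Primrec fun p : List (Block TermCode) × Block TermCode ×
      (List (State TermCode) × List ℕ) => p.2.1.tail.length + 1 :=
    succ.comp (list_length.comp (block_tail.comp (fst.comp snd)))
  refine (list_foldr (g := fun _ => ([], [])) (h := fun _ p =>
    (p.1.states TermCode.ops ++ Block.shiftStates TermCode.ops (p.1.tail.length + 1) p.2.1,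
      0 :: p.2.2.map fun k => k + (p.1.tail.length + 1))) Primrec.id (const _)
    ((pair (list_append.comp (block_states.comp (fst.comp snd))
      (shiftStates h1 (fst.comp (snd.comp snd))))
      (list_cons.comp (const 0) (list_map (snd.comp (snd.comp snd))
        ((nat_add.comp snd (h1.comp fst)).to₂)))).to₂)).of_eq fun bs => ?_
  induction bs with
  | nil => rfl
  | cons b bs ih =>
    rw [Block.cat, ← ih]
    rfl

theorem block_bin {f : TermCode → TermCode → TermCode} (hf : Primrec₂ f) :
    Primrec₂ (Block.bin TermCode.ops f) := by
  have h1 : Primrec fun p : Block TermCode × Block TermCode => p.1.tail.length :=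
    list_length.comp (block_tail.comp fst)
  exact block_mk (hf.comp (block_head.comp fst) (termCode_shift.comp h1 (block_head.comp snd)))
    (list_append.comp (block_fv.comp fst) (block_fv.comp snd))
    (list_append.comp (block_tail.comp fst) (shiftStates h1 (block_tail.comp snd)))
    (nat_max.comp (block_height.comp fst) (block_height.comp snd))

theorem block_next {f g : α → ℕ} {h : α → List (Block TermCode)} (hf : Primrec f)
    (hg : Primrec g) (hh : Primrec h) :
    Primrec fun a => Block.next TermCode.ops (TermCode.mod (f a) (g a)) (h a) :=
  block_mk (termCode_mod hf hg (snd.comp (block_cat.comp hh)))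
    (list_flatMap hh (block_fv.comp snd).to₂) (fst.comp (block_cat.comp hh))
    (succ.comp (list_foldr (h := fun _ p => max p.1 p.2) (list_map hh (block_height.comp snd).to₂)
      (const 0) (nat_max.comp (fst.comp snd) (snd.comp snd)).to₂))

theorem filter_ne {f : α → ℕ} {g : α → List ℕ} (hf : Primrec f) (hg : Primrec g) :
    Primrec fun a => (g a).filter fun q => q ≠ f a :=
  (PrimrecRel.listFilter (R := fun q p : ℕ => q ≠ p) (Primrec.eq.not)).comp hg hf

theorem block_fix (mu : Bool) {c : TermCode} {f : α → ℕ} {g : α → Block TermCode}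
    (hf : Primrec f) (hg : Primrec g) :
    Primrec fun a => Block.fix TermCode.ops mu c (f a) (g a) := by
  have ht := termCode_subst hf (block_head.comp hg) (const c)
  have hfv := filter_ne hf (block_fv.comp hg)
  have hrel : PrimrecRel fun (s : State TermCode) (p : ℕ) => p ∈ s.dep :=
    PrimrecRel.list_mem.comp snd (state_dep.comp fst)
  have hcls : Primrec fun a => mu :: ((g a).tail.filter fun s => f a ∈ s.dep).flatMap State.cls :=
    list_cons.comp (const mu) (list_flatMap (hrel.listFilter.comp (block_tail.comp hg) hf)
      (state_cls.comp snd).to₂)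
  have htag : Primrec fun a => fixTag mu (g a).height :=
    nat_add.comp (nat_mul.comp (const 2) (block_height.comp hg)) (const (bif mu then 1 else 2))
  exact block_mk ht hfv (list_map (block_tail.comp hg) ((ite (hrel.comp snd (hf.comp fst))
    (state_mk (termCode_subst (hf.comp fst) (state_term.comp snd)
      ((termCode_retag.comp htag ht).comp fst))
      (list_append.comp (filter_ne (hf.comp fst) (state_dep.comp snd)) (hfv.comp fst))
      (hcls.comp fst)) snd).to₂)) (succ.comp (block_height.comp hg))

theorem parseStep : Primrec₂ parseStep := by
  have hkind : ∀ k : ℕ, PrimrecPred fun p : (ℕ × ℕ) × List (Block TermCode) => p.1.1 = k :=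
    fun k => Primrec.eq.comp (fst.comp fst) (const k)
  have hget : ∀ k : ℕ, Primrec fun p : (ℕ × ℕ) × List (Block TermCode) =>
      p.2.getD k ⟨[], [], [], 0⟩ := fun k => (list_getD _).comp snd (const k)
  have hdrop : ∀ k : ℕ, Primrec fun p : (ℕ × ℕ) × List (Block TermCode) => p.2.drop k :=
    fun k => list_drop.comp (const k) snd
  have hatom : ∀ k : ℕ, Primrec fun p : (ℕ × ℕ) × List (Block TermCode) =>
      (⟨[((k, p.1.2), [])], [p.1.2], [], 0⟩ : Block TermCode) := fun k =>
    block_mk (list_cons.comp (pair (pair (const k) (snd.comp fst)) (const [])) (const []))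
      (list_cons.comp (snd.comp fst) (const [])) (const []) (const 0)
  have h1 : Primrec fun p : (ℕ × ℕ) × List (Block TermCode) => p.1.2.unpair.1 :=
    fst.comp (unpair.comp (snd.comp fst))
  have h2 : Primrec fun p : (ℕ × ℕ) × List (Block TermCode) => p.1.2.unpair.2 :=
    snd.comp (unpair.comp (snd.comp fst))
  exact ite (hkind 0) (list_cons.comp (hatom 1) snd) <|
    ite (hkind 1) (list_cons.comp (hatom 0) snd) <|
    ite (hkind 2)
      (list_cons.comp ((block_bin (termCode_bin 5)).comp (hget 0) (hget 1)) (hdrop 2)) <|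
    ite (hkind 3)
      (list_cons.comp ((block_bin (termCode_bin 4)).comp (hget 0) (hget 1)) (hdrop 2)) <|
    ite (hkind 4)
      (list_cons.comp (block_next h1 h2 (list_take.comp h1 snd)) (list_drop.comp h1 snd)) <|
    ite (hkind 5) (list_cons.comp (block_fix true (snd.comp fst) (hget 0)) (hdrop 1))
      (list_cons.comp (block_fix false (snd.comp fst) (hget 0)) (hdrop 1))

theorem statePrio : Primrec₂ statePrio :=
  have hmem : ∀ d : Bool, PrimrecPred fun p : List Bool × ℕ => d ∈ p.1 := fun d =>
    PrimrecRel.list_mem.comp (const d) fst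
  ite (hmem true) (ite (hmem false) snd (const 1)) (const 0)

theorem block_numTags : Primrec (Block.numTags : Block τ → ℕ) :=
  succ.comp (nat_mul.comp (const 2) block_height)

theorem block_size : Primrec (Block.size : Block τ → ℕ) :=
  nat_mul.comp (succ.comp (list_length.comp block_tail)) block_numTags

theorem block_stateAt (d : TermCode) : Primrec₂ (Block.stateAt TermCode.ops d) :=
  (list_getD _).comp (block_states.comp fst) snd

end Primrec

variable {L : OneStepLanguage.{u, w}} {F : L.Fragments} {C : L.Closed F} (E : C.Coding)

theorem computable_compileStep : Computable
    fun x : ((ℕ × ℕ) × List ℕ) × ((ℕ × ℕ) × List (ℕ × ℕ)) × List ℕ =>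
      compileStep E x.1 x.2.1 x.2.2 := by
  have hkind : ∀ k : ℕ, PrimrecPred fun p : ((ℕ × ℕ) × List ℕ) × ((ℕ × ℕ) × List (ℕ × ℕ)) × List ℕ =>
      p.2.1.1.1 = k := fun k => Primrec.eq.comp
    (Primrec.fst.comp (Primrec.fst.comp (Primrec.fst.comp Primrec.snd))) (Primrec.const k)
  have hN : Primrec fun p : ((ℕ × ℕ) × List ℕ) × ((ℕ × ℕ) × List (ℕ × ℕ)) × List ℕ => p.1.1.1 :=
    Primrec.fst.comp (Primrec.fst.comp Primrec.fst)
  have hK : Primrec fun p : ((ℕ × ℕ) × List ℕ) × ((ℕ × ℕ) × List (ℕ × ℕ)) × List ℕ => p.1.1.2 :=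
    Primrec.snd.comp (Primrec.fst.comp Primrec.fst)
  have hx : Primrec fun p : ((ℕ × ℕ) × List ℕ) × ((ℕ × ℕ) × List (ℕ × ℕ)) × List ℕ =>
      p.2.1.1.2 := Primrec.snd.comp (Primrec.fst.comp (Primrec.fst.comp Primrec.snd))
  have hrefs : Primrec fun p : ((ℕ × ℕ) × List ℕ) × ((ℕ × ℕ) × List (ℕ × ℕ)) × List ℕ =>
      p.2.1.2 := Primrec.snd.comp (Primrec.fst.comp Primrec.snd)
  have hst : Primrec fun p : ((ℕ × ℕ) × List ℕ) × ((ℕ × ℕ) × List (ℕ × ℕ)) × List ℕ => p.2.2 :=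
    Primrec.snd.comp Primrec.snd
  have hmem : PrimrecPred fun p : ((ℕ × ℕ) × List ℕ) × ((ℕ × ℕ) × List (ℕ × ℕ)) × List ℕ =>
      p.2.1.1.2 ∈ p.1.2 := PrimrecRel.list_mem.comp hx (Primrec.snd.comp Primrec.fst)
  have hget : ∀ k : ℕ, Primrec fun p : ((ℕ × ℕ) × List ℕ) × ((ℕ × ℕ) × List (ℕ × ℕ)) × List ℕ =>
      p.2.2.getD k 0 := fun k => (Primrec.list_getD 0).comp hst (Primrec.const k)
  have hargs := (hN.pair ((hget 0).pair (hget 1))).to_comp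
  have hdrop := (Primrec.list_drop.comp (Primrec.const 2) hst).to_comp
  have htop := E.computable_top.comp hN.to_comp
  have hbot := E.computable_bot.comp hN.to_comp
  have hidx : Primrec fun p : ((ℕ × ℕ) × List ℕ) × ((ℕ × ℕ) × List (ℕ × ℕ)) × List ℕ =>
      p.2.1.2.map fun z => (z.1 * p.1.1.2 + z.2) % p.1.1.1 :=
    Primrec.list_map hrefs (Primrec.nat_mod.comp (Primrec.nat_add.comp
      (Primrec.nat_mul.comp (Primrec.fst.comp Primrec.snd) (hK.comp Primrec.fst))
      (Primrec.snd.comp Primrec.snd)) (hN.comp Primrec.fst)).to₂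
  have cons := @Computable.list_cons ℕ _
  exact .ite (hkind 0) (cons.comp (.ite hmem hbot htop) hst.to_comp) <|
    .ite (hkind 1) (cons.comp (.ite hmem htop hbot) hst.to_comp) <|
    .ite (hkind 2) (cons.comp hbot hst.to_comp) <|
    .ite (hkind 3) (cons.comp htop hst.to_comp) <|
    .ite (hkind 4) (cons.comp (E.computable_conj.choose_spec.1.comp hargs) hdrop) <|
    .ite (hkind 5) (cons.comp (E.computable_disj.choose_spec.1.comp hargs) hdrop) <|
      cons.comp (E.computable_rename.choose_spec.1.comp
        ((Primrec.list_length.comp hrefs).pair (hN.pair (hidx.pair hx))).to_comp) hst.to_comp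

theorem Computable.compileStep {α : Type*} [Primcodable α] {f : α → (ℕ × ℕ) × List ℕ}
    {g : α → (ℕ × ℕ) × List (ℕ × ℕ)} {h : α → List ℕ} (hf : Computable f) (hg : Computable g)
    (hh : Computable h) : Computable fun a => compileStep E (f a) (g a) (h a) :=
  (computable_compileStep E).comp (hf.pair (hg.pair hh))

theorem computable_blockTable (cs : List (List ℕ)) : Computable (blockTable E cs) := by
  have hN := Primrec.block_size (τ := TermCode)
  have hK := Primrec.block_numTags (τ := TermCode)
  have hst : Primrec fun p : Block TermCode × ℕ =>
      p.1.stateAt TermCode.ops TermCode.top (p.2 / p.1.numTags) :=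
    (Primrec.block_stateAt _).comp .fst (Primrec.nat_div.comp .snd (hK.comp .fst))
  have hprio : Primrec fun p : Block TermCode × ℕ => statePrio
      (p.1.stateAt TermCode.ops TermCode.top (p.2 / p.1.numTags)).cls (p.2 % p.1.numTags) :=
    Primrec.statePrio.comp (Primrec.state_cls.comp hst) (Primrec.nat_mod.comp .snd (hK.comp .fst))
  have hterm : Primrec fun p : (Block TermCode × ℕ) × List ℕ =>
      (p.1.1.stateAt TermCode.ops TermCode.top (p.1.2 / p.1.1.numTags)).term :=
    Primrec.state_term.comp (hst.comp Primrec.fst)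
  have hpar : Primrec fun p : (Block TermCode × ℕ) × List ℕ =>
      ((p.1.1.size, p.1.1.numTags), p.2) :=
    ((hN.comp (Primrec.fst.comp Primrec.fst)).pair (hK.comp (Primrec.fst.comp Primrec.fst))).pair
      Primrec.snd
  have hstep : Computable₂ fun (p : (Block TermCode × ℕ) × List ℕ)
      (q : ((ℕ × ℕ) × List (ℕ × ℕ)) × List ℕ) =>
        compileStep E ((p.1.1.size, p.1.1.numTags), p.2) q.1 q.2 :=
    Computable.compileStep E (hpar.comp Primrec.fst).to_comp (Computable.fst.comp Computable.snd)
      (Computable.snd.comp Computable.snd)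
  have hcode : Computable fun p : (Block TermCode × ℕ) × List ℕ =>
      (p.1.1.stateAt TermCode.ops TermCode.top (p.1.2 / p.1.1.numTags)).term.foldr
        (compileStep E ((p.1.1.size, p.1.1.numTags), p.2)) [] :=
    Computable.list_foldr hterm.to_comp (Computable.const []) hstep
  have hcodes : Computable fun p : Block TermCode × ℕ => cs.map fun c =>
      ((p.1.stateAt TermCode.ops TermCode.top (p.2 / p.1.numTags)).term.foldr
        (compileStep E ((p.1.size, p.1.numTags), c)) []).getD 0 0 :=
    Computable.list_map (Computable.const cs)
      ((Primrec.list_getD 0).to_comp.comp hcode (Computable.const 0)).to₂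
  have hrows : Computable fun b : Block TermCode => (List.range b.size).map fun a =>
      (statePrio (b.stateAt TermCode.ops TermCode.top (a / b.numTags)).cls (a % b.numTags),
        cs.map fun c => ((b.stateAt TermCode.ops TermCode.top (a / b.numTags)).term.foldr
          (compileStep E ((b.size, b.numTags), c)) []).getD 0 0) :=
    Computable.list_map (Primrec.list_range.comp hN).to_comp (hprio.to_comp.pair hcodes).to₂
  exact hN.to_comp.pair ((Computable.const 0).pair hrows)

theorem MuForm.effectiveTranslation_toAutomaton (C : L.Closed F) (P : Finset ℕ) :
    EffectiveTranslation C fun ξ : MuL F P => MuForm.toAutomaton C P ξ.2.1 := by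
  intro E
  refine ⟨fun w => blockTable E
    ((List.range (2 ^ P.sup Nat.succ)).map fun m => (ParityAutomaton.colourOf P m).1.toList)
    ((w.foldr parseStep []).getD 0 ⟨[], [], [], 0⟩), ?_, fun ξ => ?_⟩
  · exact (computable_blockTable E _).comp ((Primrec.list_getD _).comp
      (Primrec.list_foldr (h := fun _ p => parseStep p.1 p.2) Primrec.id (Primrec.const [])
        (Primrec.parseStep.comp (Primrec.fst.comp Primrec.snd)
          (Primrec.snd.comp Primrec.snd)).to₂) (Primrec.const 0)).to_comp
  · dsimp only
    rw [MuForm.foldr_parseStep, List.getD_cons_zero]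
    exact (Block.toTable_toAutomaton E P _).symm

end

theorem mainTheorem12 (L : OneStepLanguage.{u, w}) (F : L.Fragments) (C : L.Closed F)
    (P : Finset ℕ) :
    ∃ tr : MuL F P → ParityAutomaton F P, EffectiveTranslation C tr ∧
      ∀ ξ : MuL F P,
        (∀ S : LTS.{u} P, (tr ξ).Accepts S ↔ ξ.1.Holds S) ∧
        (ξ.1.IsMuD → (tr ξ).IsWeak) ∧
        (ξ.1.IsMuC F → (tr ξ).IsWeakContinuous) :=
  ⟨_, MuForm.effectiveTranslation_toAutomaton C P, fun ξ =>
    ⟨MuForm.accepts_iff C ξ.2.1, MuForm.isWeak_toAutomaton C ξ.2.1,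
      MuForm.isWeakContinuous_toAutomaton C ξ.2.1⟩⟩
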